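/- Let $\ell\in\mathbb R\setminus\{0\}$, $m\in\mathbb R$, $k\in\mathbb Z$ and $R>|\ell|$. On $\mathbb R^3=\mathbb R_t\times\mathbb R^2_x$ use cylindrical coordinates $(t,r,\varphi)$, $r=|x|$, and set $$\Box_k=\Big(1-\frac{\ell^2}{r^2}\Big)\partial_t^2-\frac1{r^2}(r\partial_r)^2-\frac{2i\ell k}{r^2}\partial_t+\frac{k^2}{r^2},$$ which is elliptic in $(t,r)$ for $0<r<|\ell|$ and hyperbolic for $r>|\ell|$. Let $\varrho,\psi,\chi,\tilde\chi:\mathbb R\to\mathbb R$ be smooth with $\varrho=1$ on $(\tfrac34,\tfrac54)$, $\operatorname{supp}\varrho\subset(\tfrac23,\tfrac43)$; $\psi=1$ on $(-\tfrac1{10},\tfrac1{10})$, $\operatorname{supp}\psi\subset(-\tfrac15,\tfrac15)$; $\chi=1$ on $(R+1,\infty)$, $\operatorname{supp}\chi\subset(R,\infty)$; $\tilde\chi=1$ on $\operatorname{supp}\chi$, $\operatorname{supp}\tilde\chi\subset(R,\infty)$. With $(\lambda,\xi,\eta)$ dual to $(t,r,\varphi)$, let $W_0$ be the Weyl quantization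 on $\mathbb R^3$ of $$w=-\operatorname{sgn}(\lambda)\,\lambda^2\,\varrho(\xi/\lambda)\,\psi(|\eta/\lambda|)\,\chi(r)\qquad(w=0\text{ at }\lambda=0),$$ let $W=\tilde\chi(r)\,W_0\,\tilde\chi(r)$, which is formally self-adjoint, and $$P=\Box_k+m^2-iW,\qquad P^*=\Box_k+m^2+iW.$$ A locally $L^2$ function $u$ has mode $k$ if $(\partial_\varphi-ik)u=0$ in the sense of distributions on $\mathbb R_t\times(\mathbb R^2\setminus\{0\})$; $\mathcal E'_k\cap L^2$ is the set of $u\in L^2(\mathbb R^3)$ of mode $k$ with compact support in $\mathbb R^3$; $\mathscr D_k$ is the set of functions of mode $k$ in $C_c^\infty(\mathbb R_t\times(\mathbb R^2\setminus\{0\}))$. For an operator $L$ with formal adjoint $L^*$, the equation $Lu=f$ is understood weakly: $\langle u,L^*\phi\rangle=\langle f,\phi\rangle$ for all $\phi\in\mathscr D_k$, where $\langle u,v\rangle=\int u\bar v$ and $\langle \delta_q,\phi\rangle=\overline{\phi(q)}$. Then: 1. If $u\in\mathcal E'_k\cap L^2$ and $Pu=0$ or $P^*u=0$, then $\operatorname{supp}u\subset\{r\ge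 R\}$. 2. There is no nonzero solution supported away from the elliptic region: if $u$ has mode $k$, $(1+|z|)^{-N}u\in L^2(\mathbb R^3)$ for some $N$, $(\Box_k+m^2)u=0$ on $\mathbb R^3$ and $\operatorname{supp}u\subset\{r\ge|\ell|\}$, then $u=0$ almost everywhere. 3. There is no fundamental solution supported in the forward cone of a point of the hyperbolic region: if $q=(t_q,x_q)$ with $|x_q|>|\ell|$, then no $u$ of mode $k$ with $(1+|z|)^{-N}u\in L^2(\mathbb R^3)$ for some $N$ satisfies $(\Box_k+m^2)u=\delta_q$ and $\operatorname{supp}u\subset\{t\ge t_q,\ r\ge|\ell|\}$ (a set that contains the forward light cone $\{r\ge|\ell|,\ t-t_q\ge|\int_{|x_q|}^{r}\sqrt{1-\ell^2/s^2}\,ds|\}$ of $q$). -/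

import Mathlib

open MeasureTheory
open scoped ContDiff ComplexConjugate

noncomputable section

namespace CosmicString

/-- The spacetime `ℝ_t × ℝ²_x`; a point is `(t, x₁, x₂)`.  Its `volume` is Lebesgue measure.
The same type carries the dual (frequency) variables `(τ, p₁, p₂)`. -/
abbrev Spacetime : Type := ℝ × ℝ × ℝ

/-- The cylindrical radius `r = |x|`. -/
def rad (z : Spacetime) : ℝ := Real.sqrt (z.2.1 ^ 2 + z.2.2 ^ 2)

/-- `∂_t φ`. -/
def dT (φ : Spacetime → ℂ) (z : Spacetime) : ℂ := fderiv ℝ φ z (1, 0, 0)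

/-- `r ∂_r φ = x₁ ∂_{x₁} φ + x₂ ∂_{x₂} φ`. -/
def rdR (φ : Spacetime → ℂ) (z : Spacetime) : ℂ := fderiv ℝ φ z (0, z.2.1, z.2.2)

/-- `∂_φ`, the angular derivative `x₁ ∂_{x₂} - x₂ ∂_{x₁}`. -/
def dAng (φ : Spacetime → ℂ) (z : Spacetime) : ℂ := fderiv ℝ φ z (0, -z.2.2, z.2.1)

/-- Test functions on `U`: smooth, compactly supported in `U` and away from the axis `x = 0`. -/
structure IsTest (U : Set Spacetime) (φ : Spacetime → ℂ) : Prop where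
  smooth : ContDiff ℝ ∞ φ
  compact : HasCompactSupport φ
  supp : tsupport φ ⊆ U
  off_axis : ∀ z ∈ tsupport φ, 0 < rad z

/-- Test functions on `U` of angular mode `k`, i.e. annihilated by `∂_φ - i k`. -/
structure IsTestMode (k : ℤ) (U : Set Spacetime) (φ : Spacetime → ℂ) : Prop
    extends IsTest U φ where
  mode : ∀ z, dAng φ z = Complex.I * (k : ℂ) * φ z

/-- `(∂_φ - i k) u = 0` in the sense of distributions on `ℝ_t × (ℝ²_x ∖ {0})`. -/
def IsMode (k : ℤ) (u : Spacetime → ℂ) : Prop :=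
  ∀ φ : Spacetime → ℂ, IsTest Set.univ φ →
    ∫ z, u z * (dAng φ z + Complex.I * (k : ℂ) * φ z) = 0

/-- The (distributional) support of a locally integrable function: the complement of the largest
open set on which it vanishes almost everywhere. -/
def essSupp (u : Spacetime → ℂ) : Set Spacetime :=
  {z | ∀ U : Set Spacetime, IsOpen U → z ∈ U → ¬ (u =ᵐ[volume.restrict U] 0)}

/-- `u ∈ 𝓔'_k ∩ L²`: a square integrable function with compact support in `ℝ³`
and angular mode `k`. -/
structure IsCompactL2Mode (k : ℤ) (u : Spacetime → ℂ) : Prop where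
  memLp : MemLp u 2 volume
  compact : IsCompact (essSupp u)
  mode : IsMode k u

/-- A locally square integrable function of at most polynomial growth (in the `L²` sense)
and of angular mode `k`. -/
structure IsTemperedL2Mode (k : ℤ) (u : Spacetime → ℂ) : Prop where
  memLp : ∃ N : ℕ, MemLp (fun z => ((((1 + ‖z‖) ^ N)⁻¹ : ℝ) : ℂ) * u z) 2 volume
  mode : IsMode k u

/-- `(□_k + m²) φ`, where
`□_k = (1 - ℓ²/r²) ∂_t² - r⁻² (r ∂_r)² - (2 i ℓ k / r²) ∂_t + k² / r²`. -/
def boxMass (ℓ m : ℝ) (k : ℤ) (φ : Spacetime → ℂ) (z : Spacetime) : ℂ :=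
  (1 - (ℓ : ℂ) ^ 2 / (rad z : ℂ) ^ 2) * dT (dT φ) z
    - rdR (rdR φ) z / (rad z : ℂ) ^ 2
    - 2 * (ℓ : ℂ) * Complex.I * (k : ℂ) / (rad z : ℂ) ^ 2 * dT φ z
    + (k : ℂ) ^ 2 / (rad z : ℂ) ^ 2 * φ z
    + (m : ℂ) ^ 2 * φ z

/-- The Euclidean pairing `z · ζ` of position and frequency. -/
def pair (z ζ : Spacetime) : ℝ := z.1 * ζ.1 + z.2.1 * ζ.2.1 + z.2.2 * ζ.2.2

/-- The Weyl quantization on `ℝ³` of the symbol `a(z, ζ)`: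
`(2π)⁻³ ∫ ∫ e^{i (z - y) · ζ} a((z + y)/2, ζ) φ(y) dy dζ`. -/
def weyl (a : Spacetime → Spacetime → ℝ) (φ : Spacetime → ℂ) (z : Spacetime) : ℂ :=
  (((2 * Real.pi) ^ 3 : ℝ) : ℂ)⁻¹ *
    ∫ ζ : Spacetime, ∫ y : Spacetime,
      Complex.exp (Complex.I * (pair (z - y) ζ : ℂ)) * (a ((1 / 2 : ℝ) • (z + y)) ζ : ℂ) * φ y

/-- The cutoff functions `ϱ, ψ, χ, χ̃` entering the construction of `W`. -/
structure Cutoffs (R : ℝ) (ϱ ψ χ χ' : ℝ → ℝ) : Prop where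
  smooth_ϱ : ContDiff ℝ ∞ ϱ
  one_ϱ : ∀ s ∈ Set.Ioo (3 / 4 : ℝ) (5 / 4), ϱ s = 1
  supp_ϱ : tsupport ϱ ⊆ Set.Ioo (2 / 3 : ℝ) (4 / 3)
  smooth_ψ : ContDiff ℝ ∞ ψ
  one_ψ : ∀ s ∈ Set.Ioo (-1 / 10 : ℝ) (1 / 10), ψ s = 1
  supp_ψ : tsupport ψ ⊆ Set.Ioo (-1 / 5 : ℝ) (1 / 5)
  smooth_χ : ContDiff ℝ ∞ χ
  one_χ : ∀ s ∈ Set.Ioi (R + 1), χ s = 1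
  supp_χ : tsupport χ ⊆ Set.Ioi R
  smooth_χ' : ContDiff ℝ ∞ χ'
  one_χ' : ∀ s ∈ tsupport χ, χ' s = 1
  supp_χ' : tsupport χ' ⊆ Set.Ioi R

/-- The radial frequency `ξ = x · p / |x|`, dual to `r`. -/
def freqR (z ζ : Spacetime) : ℝ := (z.2.1 * ζ.2.1 + z.2.2 * ζ.2.2) / rad z

/-- The angular frequency `η = x₁ p₂ - x₂ p₁`, dual to the angle. -/
def freqAng (z ζ : Spacetime) : ℝ := z.2.1 * ζ.2.2 - z.2.2 * ζ.2.1

/-- The symbol `w = - sgn(τ) τ² ϱ(ξ/τ) ψ(|η/τ|) χ(r)`, with `τ` the frequency dual to `t`;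
it is `0` at `τ = 0`. -/
def symbolW (ϱ ψ χ : ℝ → ℝ) (z ζ : Spacetime) : ℝ :=
  -(Real.sign ζ.1) * ζ.1 ^ 2 * ϱ (freqR z ζ / ζ.1) * ψ |freqAng z ζ / ζ.1| * χ (rad z)

/-- `W = χ̃ W₀ χ̃`, with `W₀` the Weyl quantization of `w`. -/
def opW (ϱ ψ χ χ' : ℝ → ℝ) (φ : Spacetime → ℂ) (z : Spacetime) : ℂ :=
  (χ' (rad z) : ℂ) * weyl (symbolW ϱ ψ χ) (fun y => (χ' (rad y) : ℂ) * φ y) z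

/-- `P = □_k + m² - i W`. -/
def opP (ℓ m : ℝ) (k : ℤ) (ϱ ψ χ χ' : ℝ → ℝ) (φ : Spacetime → ℂ) (z : Spacetime) : ℂ :=
  boxMass ℓ m k φ z - Complex.I * opW ϱ ψ χ χ' φ z

/-- `P^* = □_k + m² + i W`, the formal adjoint of `P` on functions of mode `k`; the operator `W`
is formally self-adjoint, being `χ̃ W₀ χ̃` with `χ̃` real and `W₀` the Weyl quantization of a real
symbol. -/
def opPstar (ℓ m : ℝ) (k : ℤ) (ϱ ψ χ χ' : ℝ → ℝ) (φ : Spacetime → ℂ) (z : Spacetime) : ℂ :=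
  boxMass ℓ m k φ z + Complex.I * opW ϱ ψ χ χ' φ z

/-- Weak solutions on `U` among functions of mode `k`.  If `L'` is the formal adjoint of `L`, then
`WeakSol k L' U u f` says `L u = f` on `U`, that is `⟨u, L' φ⟩ = ⟨f, φ⟩` for all test functions
`φ` of mode `k` on `U`, with `⟨u, v⟩ = ∫ u v̄`; `f` is given by its pairings `φ ↦ ⟨f, φ⟩`. -/
def WeakSol (k : ℤ) (L' : (Spacetime → ℂ) → Spacetime → ℂ) (U : Set Spacetime)
    (u : Spacetime → ℂ) (f : (Spacetime → ℂ) → ℂ) : Prop :=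
  ∀ φ : Spacetime → ℂ, IsTestMode k U φ → ∫ z, u z * conj (L' φ z) = f φ

/-- `P u = 0` on `ℝ³`. -/
def SolvesP (ℓ m : ℝ) (k : ℤ) (ϱ ψ χ χ' : ℝ → ℝ) (u : Spacetime → ℂ) : Prop :=
  WeakSol k (opPstar ℓ m k ϱ ψ χ χ') Set.univ u (fun _ => 0)

/-- `P^* u = 0` on `ℝ³`. -/
def SolvesPstar (ℓ m : ℝ) (k : ℤ) (ϱ ψ χ χ' : ℝ → ℝ) (u : Spacetime → ℂ) : Prop :=
  WeakSol k (opP ℓ m k ϱ ψ χ χ') Set.univ u (fun _ => 0)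

/-- `(□_k + m²) u = 0` on `ℝ³`; the operator is its own formal adjoint. -/
def SolvesBox (ℓ m : ℝ) (k : ℤ) (u : Spacetime → ℂ) : Prop :=
  WeakSol k (boxMass ℓ m k) Set.univ u (fun _ => 0)

/-- `(□_k + m²) u = δ_q` on `ℝ³` within the mode `k`, where `⟨δ_q, φ⟩` is the conjugate
of `φ(q)`. -/
def IsFundamental (ℓ m : ℝ) (k : ℤ) (q : Spacetime) (u : Spacetime → ℂ) : Prop :=
  WeakSol k (boxMass ℓ m k) Set.univ u (fun φ => conj (φ q))

end CosmicString

end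

/-!
In the variable `s = log r` the operator `r² (□_k + m²)` acts on functions `c(t, s) e^{i k θ}` as
`(e^{2 s} - ℓ²) ∂_t² - ∂_s² - 2 i ℓ k ∂_t + k² + m² e^{2 s}`.  Its coefficients do not depend on
`t`, so pairing a solution with a function `g(t)` separates variables (`IsReducedSol.weak_ode`):
for `g = e^{μ t}` the pairing `v(s) = ∫ c g dt` solves `v'' = Q v` with
`Q = (e^{2 s} - ℓ²) μ² + 2 i ℓ k μ + k² + m² e^{2 s}` (`IsReducedSol.weak_ode_exp`).  A function of
mode `k` is determined by its angular coefficient `c` (`ae_eq_zero_of_angCoeff_eq_zero`), and it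
suffices to study `c`.

**Compactly supported solutions.**  The damping operator `W` acts on `r > R` only, so in `r < R` the
equation is that of `□_k + m²`.  For `μ = -2 π i τ` and `σ = 2 π τ` one has
`Q = (k + ℓ σ)² - e^{2 s} (σ² - m²)`, which for `r < |ℓ| / 2` and large `τ` is at least a multiple
of `τ²`: this is the ellipticity.  By convexity of `|v|²`, a solution that is square integrable up
to the axis decays like `e^{-ε |τ|}` (`norm_le_exp_mul_integral_of_ode`).  Hence, near the axis,
`c(·, s)` is the restriction of a function holomorphic in a strip; having compact support, it
vanishes (`ae_eq_zero_of_norm_fourier_le_exp`).  Uniqueness for the ordinary differential equation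
carries the vanishing, frequency by frequency, from the axis to `r = R`
(`ae_eq_zero_of_isReducedSol_of_compact`).

**Solutions vanishing in the elliptic region.**  Here `c` has arbitrary polynomial growth in `t`,
and its Fourier transform is not a function.  It is paired instead with the derivatives `g_n` of a
modulated Gaussian.  The pairings `v_n` satisfy the hierarchy
`v_n'' = (e^{2 s} - ℓ²) v_{n + 2} + 2 i ℓ k v_{n + 1} + (k² + m² e^{2 s}) v_n` with vanishing Cauchy
data.  Each two-fold integration gains two powers of `s`, so that `j` iterations yield a factor
`1 / (2 j)!`, whereas `g_{2 j + 2}` is of size `C^j √((2 j + 2)!)`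
(`norm_gaussianWaveDeriv_le`).  Therefore `v_0 = 0` (`secondPrimitive_eq_zero_of_hierarchy`), which
says that the Fourier transform of `c(t, s) e^{-t² / 2}` in `t` is zero.

**Fundamental solutions.**  If `c` is supported in `t ≥ t_q`, its Laplace transform at frequency
one is defined and solves `v'' = Q v - κ' δ` with `κ' ≠ 0`, where
`Re Q = (1 + m²) e^{2 s} - ℓ² + k²` is nonnegative for `r ≥ |ℓ|` and tends to infinity.  If moreover
`c` vanishes for `r < |ℓ|`, then `v` vanishes up to the source; beyond it `v` is the solution with
data `v = 0`, `v' = -κ'`, which grows faster than every power of `r = e^s`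
(`eventually_exp_le_norm_sq_of_ode`).  This contradicts temperedness
(`eq_zero_of_isReducedSol_of_retarded`).
-/

noncomputable section

namespace CosmicString

/-! ### Weak differential equations on the line -/

/-- Real-valued test functions on an open subset `U` of the line. -/
structure IsLineTest (U : Set ℝ) (h : ℝ → ℝ) : Prop where
  smooth : ContDiff ℝ ∞ h
  compact : HasCompactSupport h
  supp : tsupport h ⊆ U

protected theorem IsLineTest.deriv {U : Set ℝ} {h : ℝ → ℝ} (hh : IsLineTest U h) :
    IsLineTest U (deriv h) where
  smooth := (contDiff_infty_iff_deriv.1 hh.smooth).2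
  compact := hh.compact.deriv
  supp := (tsupport_deriv_subset (𝕜 := ℝ)).trans hh.supp

theorem IsLineTest.integrable_smul {U : Set ℝ} {h : ℝ → ℝ} (hh : IsLineTest U h) {v : ℝ → ℂ}
    (hv : LocallyIntegrable v) : Integrable (fun s => h s • v s) :=
  hv.integrable_smul_left_of_hasCompactSupport hh.smooth.continuous hh.compact

theorem IsLineTest.sub_const_mul {U : Set ℝ} {h ρ : ℝ → ℝ} (hh : IsLineTest U h)
    (hρ : IsLineTest U ρ) (c : ℝ) : IsLineTest U (fun s => h s - c * ρ s) where
  smooth := hh.smooth.sub (contDiff_const.mul hρ.smooth)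
  compact := by
    have h1 : HasCompactSupport (fun s => c * ρ s) := hρ.compact.mul_left
    exact hh.compact.sub h1
  supp := by
    refine (tsupport_sub (f := h) (g := fun s => c * ρ s)).trans (Set.union_subset hh.supp ?_)
    exact (tsupport_mul_subset_right (f := fun _ => c)).trans hρ.supp

/-- A test function on a left half-line with vanishing integral is the derivative of one. -/
theorem IsLineTest.exists_deriv_eq {S : ℝ} {h : ℝ → ℝ} (hh : IsLineTest (Set.Iio S) h)
    (h0 : ∫ s, h s = 0) : ∃ φ, IsLineTest (Set.Iio S) φ ∧ deriv φ = h := by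
  have hc : Continuous h := hh.smooth.continuous
  obtain ⟨B, hBS, hB⟩ : ∃ B < S, tsupport h ⊆ Set.Iic B := by
    rcases (tsupport h).eq_empty_or_nonempty with he | hne
    · exact ⟨S - 1, by linarith, by simp [he]⟩
    · obtain ⟨B, hB, hmax⟩ := hh.compact.isCompact.exists_isMaxOn hne continuousOn_id
      exact ⟨B, hh.supp hB, fun x hx => hmax hx⟩
  obtain ⟨A, hA⟩ : ∃ A, tsupport h ⊆ Set.Ioi A := by
    obtain ⟨A, hA⟩ := hh.compact.isCompact.bddBelow
    exact ⟨A - 1, fun x hx => by have := hA hx; simp only [Set.mem_Ioi]; linarith⟩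
  have hzA : ∀ s ≤ A, h s = 0 := fun s hs => by
    by_contra hne
    exact absurd (hA (subset_tsupport _ hne)) (not_lt.2 hs)
  have hzB : ∀ s, B < s → h s = 0 := fun s hs => by
    by_contra hne
    exact absurd (hB (subset_tsupport _ hne)) (not_le.2 hs)
  have hder : ∀ s, HasDerivAt (fun s => ∫ x in A..s, h x) (h s) s := fun s =>
    intervalIntegral.integral_hasDerivAt_right (hc.intervalIntegrable _ _)
      (hc.stronglyMeasurableAtFilter _ _) hc.continuousAt
  have hd : deriv (fun s => ∫ x in A..s, h x) = h := funext fun s => (hder s).deriv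
  have hleft : ∀ s ≤ A, ∫ x in A..s, h x = 0 := fun s hs => by
    rw [intervalIntegral.integral_symm, intervalIntegral.integral_of_le hs,
      setIntegral_eq_zero_of_forall_eq_zero (fun x hx => hzA x hx.2), neg_zero]
  have hright : ∀ s, B ≤ s → ∫ x in A..s, h x = 0 := fun s hs => by
    rcases le_total s A with hsA | hsA
    · exact hleft s hsA
    · rw [intervalIntegral.integral_of_le hsA, setIntegral_eq_integral_of_forall_compl_eq_zero, h0]
      intro x hx
      by_cases hxA : x ≤ A
      · exact hzA x hxA
      · exact hzB x (lt_of_le_of_lt hs (by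
          by_contra hcon
          exact hx ⟨not_le.1 hxA, not_lt.1 hcon⟩))
  -- The primitive from the left is also compactly supported because the integral vanishes.
  have hsub : Function.support (fun s => ∫ x in A..s, h x) ⊆ Set.Icc A B := fun s hs => by
    constructor
    · by_contra hcon
      exact hs (hleft s (not_le.1 hcon).le)
    · by_contra hcon
      exact hs (hright s (not_le.1 hcon).le)
  have hts : tsupport (fun s => ∫ x in A..s, h x) ⊆ Set.Icc A B :=
    closure_minimal hsub isClosed_Icc
  refine ⟨fun s => ∫ x in A..s, h x, ⟨?_, ?_, ?_⟩, hd⟩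
  · rw [contDiff_infty_iff_deriv, hd]
    exact ⟨fun s => (hder s).differentiableAt, hh.smooth⟩
  · exact isCompact_Icc.of_isClosed_subset (isClosed_tsupport _) hts
  · exact hts.trans fun x hx => lt_of_le_of_lt hx.2 hBS

theorem exists_isLineTest_integral_eq_one (S : ℝ) :
    ∃ ρ, IsLineTest (Set.Iio S) ρ ∧ ∫ s, ρ s = 1 := by
  let f : ContDiffBump (S - 2) := ⟨1 / 2, 1, by norm_num, by norm_num⟩
  refine ⟨f.normed volume, ⟨f.contDiff_normed, f.hasCompactSupport_normed, ?_⟩,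
    f.integral_normed⟩
  rw [f.tsupport_normed_eq]
  intro x hx
  have : |x - (S - 2)| ≤ 1 := by rw [← Real.dist_eq]; exact hx
  have := (abs_le.1 this).2
  simp only [Set.mem_Iio]
  linarith

theorem ae_eq_of_forall_isLineTest {S : ℝ} {v : ℝ → ℂ} (hv : LocallyIntegrable v)
    (h : ∀ ρ, IsLineTest (Set.Iio S) ρ → ∫ s, ρ s • v s = 0) : ∀ᵐ s, s < S → v s = 0 :=
  isOpen_Iio.ae_eq_zero_of_integral_contDiff_smul_eq_zero (hv.locallyIntegrableOn _)
    fun ρ h1 h2 h3 => h ρ ⟨h1, h2, h3⟩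

/-- The lemma of du Bois-Reymond: a function with vanishing weak derivative is constant. -/
theorem ae_eq_const_of_weak_deriv_eq_zero {S : ℝ} {v : ℝ → ℂ} (hv : LocallyIntegrable v)
    (h : ∀ ρ, IsLineTest (Set.Iio S) ρ → ∫ s, deriv ρ s • v s = 0) :
    ∃ a : ℂ, ∀ᵐ s, s < S → v s = a := by
  obtain ⟨ρ, hρ, hρ1⟩ := exists_isLineTest_integral_eq_one S
  refine ⟨∫ s, ρ s • v s, ?_⟩
  set a := ∫ s, ρ s • v s with ha
  have hvc : LocallyIntegrable (fun s => v s - a) := hv.sub (locallyIntegrable_const a)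
  have key := ae_eq_of_forall_isLineTest (S := S) hvc ?_
  · filter_upwards [key] with s hs hsS
    exact sub_eq_zero.1 (hs hsS)
  -- Every test function is a multiple of `ρ` plus the derivative of a test function.
  intro ψ hψ
  have hψi : Integrable ψ := hψ.smooth.continuous.integrable_of_hasCompactSupport hψ.compact
  have hρi : Integrable ρ := hρ.smooth.continuous.integrable_of_hasCompactSupport hρ.compact
  obtain ⟨φ, hφ, hφd⟩ := (hψ.sub_const_mul hρ (∫ s, ψ s)).exists_deriv_eq (by
    rw [integral_sub hψi (hρi.const_mul _), integral_const_mul, hρ1, mul_one, sub_self])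
  have h1 := h φ hφ
  rw [hφd] at h1
  simp only [sub_smul, mul_smul] at h1
  rw [integral_sub (hψ.integrable_smul hv) ((hρ.integrable_smul hv).fun_smul _),
    integral_smul, ← ha] at h1
  simp only [smul_sub]
  rw [integral_sub (hψ.integrable_smul hv) (hψi.smul_const a), integral_smul_const]
  exact h1

/-- A function whose second derivative vanishes weakly on a half-line is affine there. -/
theorem ae_eq_affine_of_weak_deriv_deriv_eq_zero {S : ℝ} {v : ℝ → ℂ} (hv : LocallyIntegrable v)
    (h : ∀ ρ, IsLineTest (Set.Iio S) ρ → ∫ s, deriv (deriv ρ) s • v s = 0) :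
    ∃ a b : ℂ, ∀ᵐ s, s < S → v s = a + s • b := by
  obtain ⟨ρ, hρ, hρ1⟩ := exists_isLineTest_integral_eq_one S
  -- The slope is the pairing of the weak derivative of `v` with `ρ`.
  set b := -∫ s, deriv ρ s • v s with hb
  have hlin : LocallyIntegrable (fun s : ℝ => s • b) :=
    (by fun_prop : Continuous (fun s : ℝ => s • b)).locallyIntegrable
  obtain ⟨a, ha⟩ := ae_eq_const_of_weak_deriv_eq_zero (S := S) (hv.sub hlin) (by
    intro ψ hψ
    have hψi : Integrable ψ := hψ.smooth.continuous.integrable_of_hasCompactSupport hψ.compact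
    have hρi : Integrable ρ := hρ.smooth.continuous.integrable_of_hasCompactSupport hρ.compact
    have hψ' : Differentiable ℝ ψ := hψ.smooth.differentiable (by simp)
    have hρ' : Differentiable ℝ ρ := hρ.smooth.differentiable (by simp)
    obtain ⟨φ, hφ, hφd⟩ := (hψ.sub_const_mul hρ (∫ s, ψ s)).exists_deriv_eq (by
      rw [integral_sub hψi (hρi.const_mul _), integral_const_mul, hρ1, mul_one, sub_self])
    have h1 := h φ hφ
    rw [hφd] at h1
    have h2 : deriv (fun s => ψ s - (∫ s, ψ s) * ρ s) =
        fun s => deriv ψ s - (∫ s, ψ s) * deriv ρ s := by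
      funext s
      exact ((hψ' s).hasDerivAt.sub ((hρ' s).hasDerivAt.const_mul _)).deriv
    rw [h2] at h1
    simp only [sub_smul, mul_smul] at h1
    rw [integral_sub (hψ.deriv.integrable_smul hv) ((hρ.deriv.integrable_smul hv).fun_smul _),
      integral_smul] at h1
    have h3 : ∫ s, deriv ψ s * s = -∫ s, ψ s := by
      have := integral_mul_deriv_eq_deriv_mul_of_integrable (u := fun s : ℝ => s)
        (u' := fun _ => 1) (v := ψ) (v' := deriv ψ) (fun s _ => hasDerivAt_id' s)
        (fun s _ => (hψ' s).hasDerivAt) ?_ (by simpa [Pi.mul_def] using hψi) ?_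
      · simpa [mul_comm] using this
      · exact (continuous_id.mul hψ.deriv.smooth.continuous).integrable_of_hasCompactSupport
          hψ.deriv.compact.mul_left
      · exact (continuous_id.mul hψ.smooth.continuous).integrable_of_hasCompactSupport
          hψ.compact.mul_left
    simp only [Pi.sub_apply, smul_sub, ← mul_smul]
    rw [integral_sub (hψ.deriv.integrable_smul hv), integral_smul_const, h3]
    · rw [sub_eq_zero.1 h1, hb]
      simp
    · exact ((hψ.deriv.smooth.continuous.mul continuous_id).integrable_of_hasCompactSupport
          hψ.deriv.compact.mul_right).smul_const b)
  refine ⟨a, b, ?_⟩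
  filter_upwards [ha] with s hs hsS
  rw [← hs hsS]
  simp

theorem IsLineTest.exists_Ioo {U : Set ℝ} {h : ℝ → ℝ} (hh : IsLineTest U h) :
    ∃ A B, tsupport h ⊆ Set.Ioo A B := by
  obtain ⟨A, hA⟩ := hh.compact.isCompact.bddBelow
  obtain ⟨B, hB⟩ := hh.compact.isCompact.bddAbove
  exact ⟨A - 1, B + 1, fun x hx => ⟨by have := hA hx; linarith, by have := hB hx; linarith⟩⟩

/-- Integration by parts for the primitive of a locally integrable function. -/
theorem integral_deriv_smul_primitive {U : Set ℝ} {h : ℝ → ℝ} (hh : IsLineTest U h) {w : ℝ → ℂ}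
    (hw : LocallyIntegrable w) (s₀ : ℝ) :
    ∫ s, deriv h s • ∫ x in s₀..s, w x = -∫ s, h s • w s := by
  obtain ⟨A, B, hAB⟩ := hh.exists_Ioo
  have hii : ∀ a b, IntervalIntegrable w volume a b := fun a b =>
    (hw.integrableOn_isCompact isCompact_uIcc).intervalIntegrable
  have hc1 : ContDiff ℝ 1 h := hh.smooth.of_le (by norm_cast)
  have hd : ∀ s, s ∉ Set.Ioo A B → deriv h s = 0 := fun s hs => by
    by_contra hne
    exact hs (hAB (tsupport_deriv_subset (𝕜 := ℝ) (subset_tsupport _ hne)))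
  have hz : ∀ s, s ∉ Set.Ioo A B → h s = 0 := fun s hs => by
    by_contra hne
    exact hs (hAB (subset_tsupport _ hne))
  have hdi : Integrable (deriv h) :=
    hh.deriv.smooth.continuous.integrable_of_hasCompactSupport hh.deriv.compact
  -- Truncating `w` to the support of `h` makes the double integral absolutely convergent, so that
  -- Fubini's theorem applies.
  set w' : ℝ → ℂ := (Set.Ioc A B).indicator w with hw'
  have hw'i : Integrable w' := by
    rw [hw', integrable_indicator_iff measurableSet_Ioc]
    exact (hw.integrableOn_isCompact isCompact_Icc).mono_set Set.Ioc_subset_Icc_self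
  have hprim : ∀ s, deriv h s • ∫ x in s₀..s, w x =
      deriv h s • (∫ x in s₀..A, w x) + deriv h s • ∫ x in Set.Iic s, w' x := fun s => by
    by_cases hs : s ∈ Set.Ioo A B
    · rw [← smul_add, ← intervalIntegral.integral_add_adjacent_intervals (hii s₀ A) (hii A s),
        intervalIntegral.integral_of_le hs.1.le, hw', setIntegral_indicator measurableSet_Ioc]
      congr 4
      ext x
      simp only [Set.mem_Ioc, Set.mem_inter_iff, Set.mem_Iic]
      exact ⟨fun hx => ⟨hx.2, hx.1, hx.2.trans hs.2.le⟩, fun hx => ⟨hx.2.1, hx.1⟩⟩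
    · simp [hd s hs]
  have hF : Integrable (Function.uncurry fun s x : ℝ =>
      {p : ℝ × ℝ | p.2 ≤ p.1}.indicator (fun p => deriv h p.1 • w' p.2) (s, x))
      (volume.prod volume) := by
    have : Integrable (fun p : ℝ × ℝ => deriv h p.1 • w' p.2) (volume.prod volume) :=
      hdi.smul_prod hw'i
    exact this.indicator (measurableSet_le measurable_snd measurable_fst)
  have e1 : ∀ s, deriv h s • ∫ x in Set.Iic s, w' x =
      ∫ x, {p : ℝ × ℝ | p.2 ≤ p.1}.indicator (fun p => deriv h p.1 • w' p.2) (s, x) := fun s => by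
    rw [← integral_smul, ← integral_indicator measurableSet_Iic]
    rfl
  have e2 : ∀ x, ∫ s, {p : ℝ × ℝ | p.2 ≤ p.1}.indicator (fun p => deriv h p.1 • w' p.2) (s, x) =
      -(h x • w' x) := fun x => by
    have : (fun s => {p : ℝ × ℝ | p.2 ≤ p.1}.indicator (fun p => deriv h p.1 • w' p.2) (s, x)) =
        (Set.Ici x).indicator fun s => deriv h s • w' x := rfl
    rw [this, integral_indicator measurableSet_Ici, integral_smul_const, integral_Ici_eq_integral_Ioi,
      hh.compact.integral_Ioi_deriv_eq hc1, neg_smul]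
  have hi1 : Integrable fun s => deriv h s • ∫ x in s₀..A, w x := hdi.smul_const _
  have hi2 : Integrable fun s => deriv h s • ∫ x in Set.Iic s, w' x := by
    simp only [e1]
    exact hF.integral_prod_left
  rw [integral_congr_ae (ae_of_all _ hprim), integral_add hi1 hi2, integral_smul_const]
  have h0 : ∫ s, deriv h s = 0 :=
    integral_eq_zero_of_hasDerivAt_of_integrable
      (fun s => (hc1.differentiable one_ne_zero s).hasDerivAt) hdi
      (hh.smooth.continuous.integrable_of_hasCompactSupport hh.compact)
  rw [h0, zero_smul, zero_add, integral_congr_ae (ae_of_all _ e1), integral_integral_swap hF,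
    integral_congr_ae (ae_of_all _ e2), integral_neg]
  congr 1
  refine integral_congr_ae (ae_of_all _ fun x => ?_)
  by_cases hx : x ∈ Set.Ioo A B
  · simp [hw', Set.indicator_of_mem (show x ∈ Set.Ioc A B from ⟨hx.1, hx.2.le⟩)]
  · simp [hz x hx]

theorem continuous_primitive_of_locallyIntegrable {w : ℝ → ℂ} (hw : LocallyIntegrable w)
    (s₀ : ℝ) : Continuous fun s => ∫ x in s₀..s, w x :=
  intervalIntegral.continuous_primitive
    (fun _ _ => (hw.integrableOn_isCompact isCompact_uIcc).intervalIntegrable) s₀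

/-- The second primitive of `w` with vanishing Cauchy data at `s₀`. -/
def secondPrimitive (s₀ : ℝ) (w : ℝ → ℂ) (s : ℝ) : ℂ := ∫ y in s₀..s, ∫ x in s₀..y, w x

theorem hasDerivAt_secondPrimitive {w : ℝ → ℂ} (hw : LocallyIntegrable w) (s₀ s : ℝ) :
    HasDerivAt (secondPrimitive s₀ w) (∫ x in s₀..s, w x) s := by
  have hc := continuous_primitive_of_locallyIntegrable hw s₀
  exact intervalIntegral.integral_hasDerivAt_right (hc.intervalIntegrable _ _)
      (hc.stronglyMeasurableAtFilter _ _) hc.continuousAt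

theorem continuous_secondPrimitive {w : ℝ → ℂ} (hw : LocallyIntegrable w) (s₀ : ℝ) :
    Continuous (secondPrimitive s₀ w) :=
  continuous_iff_continuousAt.2 fun s => (hasDerivAt_secondPrimitive hw s₀ s).continuousAt

theorem integral_deriv_deriv_smul_secondPrimitive {U : Set ℝ} {h : ℝ → ℝ} (hh : IsLineTest U h)
    {w : ℝ → ℂ} (hw : LocallyIntegrable w) (s₀ : ℝ) :
    ∫ s, deriv (deriv h) s • secondPrimitive s₀ w s = ∫ s, h s • w s := by
  have h1 := integral_deriv_smul_primitive hh.deriv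
    (continuous_primitive_of_locallyIntegrable hw s₀).locallyIntegrable s₀
  have h2 := integral_deriv_smul_primitive hh hw s₀
  rw [h2, neg_neg] at h1
  exact h1

/-- Weakly, the second derivative of `max (s - p) 0` is the Dirac measure at `p`. -/
theorem integral_deriv_deriv_smul_posPart {U : Set ℝ} {h : ℝ → ℝ} (hh : IsLineTest U h)
    (p : ℝ) (κ : ℂ) : ∫ s, deriv (deriv h) s • (max (s - p) 0 • κ) = h p • κ := by
  set w : ℝ → ℂ := (Set.Ioi p).indicator fun _ => κ with hw
  have hwl : LocallyIntegrable w := (locallyIntegrable_const κ).indicator measurableSet_Ioi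
  have hprim : ∀ s, max (s - p) 0 • κ = ∫ x in p..s, w x := fun s => by
    rcases le_total p s with hs | hs
    · rw [intervalIntegral.integral_of_le hs, hw, setIntegral_indicator measurableSet_Ioi,
        Set.inter_eq_left.2 Set.Ioc_subset_Ioi_self]
      simp [hs]
    · rw [intervalIntegral.integral_symm, intervalIntegral.integral_of_le hs,
        setIntegral_eq_zero_of_forall_eq_zero]
      · simp [hs]
      · intro x hx
        exact Set.indicator_of_notMem (by simpa using hx.2) _
  have h1 := integral_deriv_smul_primitive hh.deriv hwl p
  simp only [hprim]
  rw [h1]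
  have hc1 : ContDiff ℝ 1 h := hh.smooth.of_le (by norm_cast)
  have : (fun s => deriv h s • w s) = (Set.Ioi p).indicator fun s => deriv h s • κ := by
    funext s
    by_cases hs : s ∈ Set.Ioi p
    · simp [hw, hs]
    · simp [hw, hs]
  rw [this, integral_indicator measurableSet_Ioi, integral_smul_const,
    hh.compact.integral_Ioi_deriv_eq hc1, neg_smul, neg_neg]

/-- Weak solutions of `v'' = w - κ δ_p` on a left half-line are given by integrating twice. -/
theorem ae_eq_of_weak_deriv_deriv {S p : ℝ} {v w : ℝ → ℂ} {κ : ℂ} (hv : LocallyIntegrable v)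
    (hw : LocallyIntegrable w) (s₀ : ℝ)
    (h : ∀ ρ, IsLineTest (Set.Iio S) ρ →
      ∫ s, deriv (deriv ρ) s • v s = (∫ s, ρ s • w s) - ρ p • κ) :
    ∃ a b : ℂ, ∀ᵐ s, s < S →
      v s = a + s • b - max (s - p) 0 • κ + secondPrimitive s₀ w s := by
  have hV : LocallyIntegrable (secondPrimitive s₀ w) :=
    (continuous_secondPrimitive hw s₀).locallyIntegrable
  have hk : LocallyIntegrable (fun s : ℝ => max (s - p) 0 • κ) :=
    (by fun_prop : Continuous (fun s : ℝ => max (s - p) 0 • κ)).locallyIntegrable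
  obtain ⟨a, b, hab⟩ := ae_eq_affine_of_weak_deriv_deriv_eq_zero (S := S)
    (v := fun s => v s + max (s - p) 0 • κ - secondPrimitive s₀ w s) ((hv.add hk).sub hV) (by
    intro ρ hρ
    have hρ2 := hρ.deriv.deriv
    simp only [smul_sub, smul_add]
    rw [integral_sub, integral_add, h ρ hρ, integral_deriv_deriv_smul_posPart hρ,
      integral_deriv_deriv_smul_secondPrimitive hρ hw]
    · ring
    · exact hρ2.integrable_smul hv
    · exact hρ2.integrable_smul hk
    · exact (hρ2.integrable_smul hv).add (hρ2.integrable_smul hk)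
    · exact hρ2.integrable_smul hV)
  refine ⟨a, b, ?_⟩
  filter_upwards [hab] with s hs hsS
  rw [← hs hsS]
  ring

theorem secondPrimitive_eq_zero {s₀ s : ℝ} {w : ℝ → ℂ} (hw : ∀ᵐ x, x < s₀ → w x = 0)
    (hs : s ≤ s₀) : secondPrimitive s₀ w s = 0 := by
  have h1 : ∀ y ≤ s₀, ∫ x in s₀..y, w x = 0 := fun y hy => by
    rw [intervalIntegral.integral_symm, intervalIntegral.integral_of_le hy, neg_eq_zero]
    refine integral_eq_zero_of_ae ?_
    rw [Filter.EventuallyEq, ae_restrict_iff' measurableSet_Ioc]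
    filter_upwards [hw, compl_mem_ae_iff.2 (measure_singleton s₀)] with x hx hxs hx2
    exact hx (lt_of_le_of_ne hx2.2 (by simpa using hxs))
  rw [secondPrimitive, intervalIntegral.integral_symm, intervalIntegral.integral_of_le hs,
    setIntegral_eq_zero_of_forall_eq_zero (fun y hy => h1 y hy.2), neg_zero]

/-- A weak solution of `v'' = w - κ δ_p` that vanishes far to the left has vanishing Cauchy
data there. -/
theorem ae_eq_of_weak_deriv_deriv_of_eq_zero {S p s₀ : ℝ} {v w : ℝ → ℂ} {κ : ℂ}
    (hv : LocallyIntegrable v) (hw : LocallyIntegrable w)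
    (h : ∀ ρ, IsLineTest (Set.Iio S) ρ →
      ∫ s, deriv (deriv ρ) s • v s = (∫ s, ρ s • w s) - ρ p • κ)
    (hv0 : ∀ᵐ s, s < s₀ → v s = 0) (hw0 : ∀ᵐ s, s < s₀ → w s = 0) (hp : s₀ ≤ p) (hS : s₀ < S) :
    ∀ᵐ s, s < S → v s = -(max (s - p) 0 • κ) + secondPrimitive s₀ w s := by
  obtain ⟨a, b, hab⟩ := ae_eq_of_weak_deriv_deriv hv hw s₀ h
  have haff : ∀ᵐ s, s < s₀ → a + s • b = 0 := by
    filter_upwards [hab, hv0] with s h1 h2 hs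
    have h3 := h1 (hs.trans hS)
    rw [h2 hs, secondPrimitive_eq_zero hw0 hs.le, max_eq_right (by linarith)] at h3
    simpa using h3.symm
  have haff' : ∀ s ∈ Set.Iio s₀, a + s • b = 0 := by
    have hc : ContinuousOn (fun s : ℝ => a + s • b) (Set.Iio s₀) := by fun_prop
    have := Measure.eqOn_open_of_ae_eq (μ := volume) (f := fun s : ℝ => a + s • b)
      (g := fun _ => 0) (U := Set.Iio s₀)
      ((ae_restrict_iff' measurableSet_Iio).2 haff) isOpen_Iio hc continuousOn_const
    exact fun s hs => this hs
  have e1 := haff' (s₀ - 1) (by simp)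
  have e2 := haff' (s₀ - 2) (by simp)
  have hb : b = 0 := by
    simp only [Complex.real_smul] at e1 e2
    push_cast at e1 e2
    linear_combination e1 - e2
  have ha : a = 0 := by simpa [hb] using e1
  filter_upwards [hab] with s h1 hs
  rw [h1 hs, ha, hb]
  simp

/-! ### Volterra iteration and convexity estimates -/

theorem norm_secondPrimitive_le {s₀ S s : ℝ} {w : ℝ → ℂ} {f : ℝ → ℝ}
    (hf : IntegrableOn f (Set.Ioc s₀ S)) (hwf : ∀ᵐ x, x ∈ Set.Ioc s₀ S → ‖w x‖ ≤ f x)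
    (hs : s ∈ Set.Icc s₀ S) :
    ‖secondPrimitive s₀ w s‖ ≤ ∫ y in s₀..s, ∫ x in s₀..y, f x := by
  have hfi : ∀ y ∈ Set.Icc s₀ S, IntervalIntegrable f volume s₀ y := fun y hy => by
    rw [intervalIntegrable_iff_integrableOn_Ioc_of_le hy.1]
    exact hf.mono_set (Set.Ioc_subset_Ioc_right hy.2)
  have hsS : s₀ ≤ S := hs.1.trans hs.2
  refine intervalIntegral.norm_integral_le_of_norm_le hs.1 (ae_of_all _ fun y hy => ?_) ?_
  · refine intervalIntegral.norm_integral_le_of_norm_le hy.1.le ?_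
      (hfi y ⟨hy.1.le, hy.2.trans hs.2⟩)
    filter_upwards [hwf] with x hx hxy
    exact hx ⟨hxy.1, hxy.2.trans (hy.2.trans hs.2)⟩
  · have hc : ContinuousOn (fun y => ∫ x in s₀..y, f x) (Set.uIcc s₀ S) :=
      intervalIntegral.continuousOn_primitive_interval' (hfi S ⟨hsS, le_rfl⟩) Set.left_mem_uIcc
    refine (hc.mono ?_).intervalIntegrable
    rw [Set.uIcc_of_le hs.1, Set.uIcc_of_le hsS]
    exact Set.Icc_subset_Icc_right hs.2

theorem integral_integral_sub_pow (s₀ s C : ℝ) (m : ℕ) :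
    ∫ y in s₀..s, ∫ x in s₀..y, C * (x - s₀) ^ m =
      C * ((s - s₀) ^ (m + 2) / ((m + 1) * (m + 2))) := by
  have h : ∀ n : ℕ, ∀ y : ℝ, ∫ x in s₀..y, (x - s₀) ^ n = (y - s₀) ^ (n + 1) / (n + 1) := by
    intro n y
    rw [intervalIntegral.integral_comp_sub_right (fun x => x ^ n) s₀, integral_pow]
    simp
  simp only [intervalIntegral.integral_const_mul, h, intervalIntegral.integral_div]
  push_cast
  field_simp
  ring

/-- Uniqueness for a hierarchy of Cauchy problems `v_n'' = w_n`, in which `w_n` is controlled by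
`v_n`, `v_{n+1}` and `v_{n+2}`.  Iterating the Volterra equation `j` times gains a factor
`1 / (2 j)!`, which has to beat the growth of the a priori bounds `b_n`. -/
theorem secondPrimitive_eq_zero_of_hierarchy {s₀ S K : ℝ} (hK : 0 ≤ K) {v w : ℕ → ℝ → ℂ}
    {b : ℕ → ℝ} {M : ℝ → ℝ}
    (hv : ∀ n, ∀ᵐ s, s ∈ Set.Ioc s₀ S → v n s = secondPrimitive s₀ (w n) s)
    (hwv : ∀ n, ∀ᵐ s, s ∈ Set.Ioc s₀ S →
      ‖w n s‖ ≤ K * (‖v n s‖ + ‖v (n + 1) s‖ + ‖v (n + 2) s‖))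
    (hb : Monotone b) (hM : IntegrableOn M (Set.Ioc s₀ S)) (hM0 : ∀ s, 0 ≤ M s)
    (hbM : ∀ n, ∀ᵐ s, s ∈ Set.Ioc s₀ S → ‖v n s‖ ≤ b n * M s)
    (hlim : ∀ x : ℝ, Filter.Tendsto (fun j : ℕ => x ^ j * b (2 * j + 2) / (2 * j).factorial)
      Filter.atTop (nhds 0))
    {s : ℝ} (hs : s ∈ Set.Icc s₀ S) : secondPrimitive s₀ (w 0) s = 0 := by
  have hsS : s₀ ≤ S := hs.1.trans hs.2
  set D : ℝ := (S - s₀) * (3 * K * ∫ x in s₀..S, M x) with hD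
  have hMI : ∀ y ∈ Set.Icc s₀ S, IntervalIntegrable M volume s₀ y := fun y hy => by
    rw [intervalIntegrable_iff_integrableOn_Ioc_of_le hy.1]
    exact hM.mono_set (Set.Ioc_subset_Ioc_right hy.2)
  have key : ∀ j n : ℕ, ∀ s ∈ Set.Icc s₀ S, ‖secondPrimitive s₀ (w n) s‖ ≤
      (3 * K) ^ j * ((s - s₀) ^ (2 * j) / (2 * j).factorial) * (D * b (n + 2 * j + 2)) := by
    intro j
    induction j with
    | zero =>
      intro n s hs
      have hb0 : 0 ≤ b (n + 2) * ∫ x in s₀..S, M x := by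
        rw [← intervalIntegral.integral_const_mul]
        refine intervalIntegral.integral_nonneg_of_ae_restrict hsS ?_
        rw [Filter.EventuallyLE, ← restrict_Ioc_eq_restrict_Icc,
          ae_restrict_iff' measurableSet_Ioc]
        filter_upwards [hbM (n + 2)] with x hx hxs
        exact (norm_nonneg _).trans (hx hxs)
      -- The first step uses only that `M` is integrable: one of the two integrations turns it into
      -- a bounded function.
      have h1 := norm_secondPrimitive_le (w := w n) (f := fun x => 3 * K * b (n + 2) * M x)
        (hM.const_mul _) (by
          filter_upwards [hwv n, hbM n, hbM (n + 1), hbM (n + 2)] with x h0 h1 h2 h3 hx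
          have e1 := mul_le_mul_of_nonneg_right (hb (show n ≤ n + 2 by omega)) (hM0 x)
          have e2 := mul_le_mul_of_nonneg_right (hb (show n + 1 ≤ n + 2 by omega)) (hM0 x)
          calc ‖w n x‖ ≤ K * (‖v n x‖ + ‖v (n + 1) x‖ + ‖v (n + 2) x‖) := h0 hx
            _ ≤ K * (b (n + 2) * M x + b (n + 2) * M x + b (n + 2) * M x) := by
              gcongr
              · exact (h1 hx).trans e1
              · exact (h2 hx).trans e2
              · exact h3 hx
            _ = 3 * K * b (n + 2) * M x := by ring) hs
      refine h1.trans ?_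
      simp only [intervalIntegral.integral_const_mul]
      have h2 : ∫ y in s₀..s, ∫ x in s₀..y, b (n + 2) * M x ≤
          ∫ y in s₀..s, b (n + 2) * ∫ x in s₀..S, M x := by
        have := intervalIntegral.norm_integral_le_of_norm_le_const (a := s₀) (b := s)
          (f := fun y => ∫ x in s₀..y, b (n + 2) * M x)
          (C := b (n + 2) * ∫ x in s₀..S, M x) (fun y hy => by
            rw [Set.uIoc_of_le hs.1] at hy
            have hyS : y ∈ Set.Icc s₀ S := ⟨hy.1.le, hy.2.trans hs.2⟩
            have hnn : ∀ᵐ x, x ∈ Set.Ioc s₀ S → 0 ≤ b (n + 2) * M x := by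
              filter_upwards [hbM (n + 2)] with x hx hxs
              exact (norm_nonneg _).trans (hx hxs)
            rw [Real.norm_of_nonneg, ← intervalIntegral.integral_const_mul]
            · rw [intervalIntegral.integral_of_le hyS.1, intervalIntegral.integral_of_le hsS]
              refine setIntegral_mono_set (hM.const_mul _) ?_
                (Set.Ioc_subset_Ioc_right hyS.2).eventuallyLE
              rw [Filter.EventuallyLE, ae_restrict_iff' measurableSet_Ioc]
              exact hnn
            · refine intervalIntegral.integral_nonneg_of_ae_restrict hyS.1 ?_
              rw [Filter.EventuallyLE, ← restrict_Ioc_eq_restrict_Icc,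
                ae_restrict_iff' measurableSet_Ioc]
              filter_upwards [hnn] with x hx hxs
              exact hx ⟨hxs.1, hxs.2.trans hyS.2⟩)
        rw [intervalIntegral.integral_const, smul_eq_mul]
        refine (le_abs_self _).trans (this.trans (le_of_eq ?_))
        rw [abs_of_nonneg (by linarith [hs.1])]
        ring
      simp only [intervalIntegral.integral_const_mul, intervalIntegral.integral_const,
        smul_eq_mul] at h2
      calc 3 * K * b (n + 2) * (∫ y in s₀..s, ∫ x in s₀..y, M x)
          = 3 * K * (b (n + 2) * (∫ y in s₀..s, ∫ x in s₀..y, M x)) := by ring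
        _ ≤ 3 * K * ((s - s₀) * (b (n + 2) * ∫ x in s₀..S, M x)) := by
          refine mul_le_mul_of_nonneg_left (h2.trans (le_of_eq ?_)) (by linarith)
          ring
        _ ≤ 3 * K * ((S - s₀) * (b (n + 2) * ∫ x in s₀..S, M x)) := by
          gcongr
          exact hs.2
        _ = _ := by
          rw [hD]
          simp
          ring
    | succ j ih =>
      intro n s hs
      set C : ℝ := (3 * K) ^ (j + 1) / (2 * j).factorial * (D * b (n + 2 * (j + 1) + 2)) with hC
      have hfac : (0 : ℝ) < (2 * j).factorial := by positivity
      have hDb : ∀ p q : ℕ, p ≤ q → D * b p ≤ D * b q := fun p q hpq =>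
        mul_le_mul_of_nonneg_left (hb hpq) (by
          refine mul_nonneg (by linarith) (mul_nonneg (by linarith) ?_)
          exact intervalIntegral.integral_nonneg hsS fun x _ => hM0 x)
      have h1 := norm_secondPrimitive_le (w := w n) (f := fun x => C * (x - s₀) ^ (2 * j))
        ((by fun_prop : Continuous fun x => C * (x - s₀) ^ (2 * j)).integrableOn_Ioc) (by
          filter_upwards [hwv n, hv n, hv (n + 1), hv (n + 2)] with x h0 h1 h2 h3 hx
          have hxI : x ∈ Set.Icc s₀ S := ⟨hx.1.le, hx.2⟩
          have hx0 : 0 ≤ x - s₀ := by linarith [hx.1]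
          have i1 := ih n x hxI
          have i2 := ih (n + 1) x hxI
          have i3 := ih (n + 2) x hxI
          rw [← h1 hx] at i1
          rw [← h2 hx] at i2
          rw [← h3 hx] at i3
          set E := (3 * K) ^ j * ((x - s₀) ^ (2 * j) / (2 * j).factorial) with hE
          have hE0 : 0 ≤ E := by positivity
          have j1 := i1.trans (mul_le_mul_of_nonneg_left
            (hDb (n + 2 * j + 2) (n + 2 * (j + 1) + 2) (by omega)) hE0)
          have j2 := i2.trans (mul_le_mul_of_nonneg_left
            (hDb (n + 1 + 2 * j + 2) (n + 2 * (j + 1) + 2) (by omega)) hE0)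
          have j3 := i3.trans (mul_le_mul_of_nonneg_left
            (hDb (n + 2 + 2 * j + 2) (n + 2 * (j + 1) + 2) (by omega)) hE0)
          calc ‖w n x‖ ≤ K * (‖v n x‖ + ‖v (n + 1) x‖ + ‖v (n + 2) x‖) := h0 hx
            _ ≤ K * (E * (D * b (n + 2 * (j + 1) + 2)) + E * (D * b (n + 2 * (j + 1) + 2)) +
                E * (D * b (n + 2 * (j + 1) + 2))) := by gcongr
            _ = C * (x - s₀) ^ (2 * j) := by
              rw [hC, hE, pow_succ]
              field_simp
              ring) hs
      rw [integral_integral_sub_pow] at h1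
      refine h1.trans (le_of_eq ?_)
      have hfac2 : ((2 * (j + 1)).factorial : ℝ) =
          (((2 * j : ℕ) : ℝ) + 2) * ((((2 * j : ℕ) : ℝ) + 1) * (2 * j).factorial) := by
        rw [show 2 * (j + 1) = (2 * j + 1) + 1 by ring, Nat.factorial_succ, Nat.factorial_succ]
        push_cast
        ring
      rw [hC, hfac2]
      have e1 : ((2 * j : ℕ) : ℝ) + 1 ≠ 0 := by positivity
      have e2 : ((2 * j : ℕ) : ℝ) + 2 ≠ 0 := by positivity
      rw [show 2 * (j + 1) = 2 * j + 2 by ring]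
      field_simp
  have hlim2 : Filter.Tendsto (fun j : ℕ => (3 * K) ^ j * ((s - s₀) ^ (2 * j) /
      (2 * j).factorial) * (D * b (0 + 2 * j + 2))) Filter.atTop (nhds 0) := by
    have := (hlim (3 * K * (s - s₀) ^ 2)).const_mul D
    rw [mul_zero] at this
    refine this.congr fun j => ?_
    rw [zero_add, mul_pow, ← pow_mul]
    ring
  have hle := ge_of_tendsto' hlim2 fun j => key j 0 s hs
  exact norm_eq_zero.1 (le_antisymm hle (norm_nonneg _))

/-- Uniqueness for the Cauchy problem `y'' = Q y`, in integrated form. -/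
theorem eq_zero_of_volterra {s₀ S : ℝ} {y Q : ℝ → ℂ} (hy : ContinuousOn y (Set.Icc s₀ S))
    (hQ : ContinuousOn Q (Set.Icc s₀ S)) {w : ℝ → ℂ}
    (hw : ∀ᵐ s, s ∈ Set.Ioc s₀ S → w s = Q s * y s)
    (h : ∀ s ∈ Set.Ioc s₀ S, y s = secondPrimitive s₀ w s)
    {s : ℝ} (hs : s ∈ Set.Ioc s₀ S) : y s = 0 := by
  obtain ⟨K, hK⟩ := isCompact_Icc.exists_bound_of_continuousOn hQ
  obtain ⟨C, hC⟩ := isCompact_Icc.exists_bound_of_continuousOn hy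
  have hsI : s ∈ Set.Icc s₀ S := ⟨hs.1.le, hs.2⟩
  have hK0 : 0 ≤ K := (norm_nonneg _).trans (hK s hsI)
  have hC0 : 0 ≤ C := (norm_nonneg _).trans (hC s hsI)
  rw [h s hs]
  refine secondPrimitive_eq_zero_of_hierarchy (S := S) (K := K) (v := fun _ => y) (w := fun _ => w)
    (b := fun _ => 1) (M := fun _ => C) hK0 (fun n => ae_of_all _ h) (fun n => ?_)
    monotone_const ?_ (fun _ => hC0) (fun n => ae_of_all _ fun x hx => ?_) (fun x => ?_) hsI
  · filter_upwards [hw] with x hx hxs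
    rw [hx hxs, norm_mul]
    have h0 := norm_nonneg (y x)
    calc ‖Q x‖ * ‖y x‖ ≤ K * ‖y x‖ := by
          gcongr
          exact hK x ⟨hxs.1.le, hxs.2⟩
      _ ≤ _ := by
          gcongr
          linarith
  · exact integrableOn_const (by simp)
  · simpa using hC x ⟨hx.1.le, hx.2⟩
  · have h1 := FloorSemiring.tendsto_pow_div_factorial_atTop (max |x| 1)
    have h2 : Filter.Tendsto (fun j : ℕ => 2 * j) Filter.atTop Filter.atTop :=
      Filter.tendsto_id.const_mul_atTop' (by norm_num)
    refine squeeze_zero_norm (fun j => ?_) (h1.comp h2)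
    simp only [mul_one, Function.comp, norm_div, norm_pow, Real.norm_eq_abs, Nat.abs_cast]
    gcongr
    calc |x| ^ j ≤ (max |x| 1) ^ j := by gcongr; exact le_max_left _ _
      _ ≤ (max |x| 1) ^ (2 * j) := pow_le_pow_right₀ (le_max_right _ _) (by omega)

/-- Exponential growth of a solution of `N'' ≥ L² N` that is not the decaying one. -/
theorem eventually_exp_le_of_deriv_deriv_ge {N N₁ N₂ : ℝ → ℝ} {L x₀ : ℝ} (hL : 0 < L)
    (h1 : ∀ x ≥ x₀, HasDerivAt N (N₁ x) x) (h2 : ∀ x ≥ x₀, HasDerivAt N₁ (N₂ x) x)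
    (h3 : ∀ x ≥ x₀, L ^ 2 * N x ≤ N₂ x) (h0 : 0 < N₁ x₀ + L * N x₀) :
    ∃ c > 0, ∀ᶠ x in Filter.atTop, c * Real.exp (L * x) ≤ N x := by
  have hexp : ∀ a x : ℝ, HasDerivAt (fun x => Real.exp (a * x)) (Real.exp (a * x) * a) x :=
    fun a x => by simpa using ((hasDerivAt_id x).const_mul a).exp
  set c₀ := Real.exp (-L * x₀) * (N₁ x₀ + L * N x₀) with hc₀
  have hc₀p : 0 < c₀ := by positivity
  -- The inequality factors: `(d/dx - L)(N' + L N) ≥ 0`.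
  have m1 : MonotoneOn (fun x => Real.exp (-L * x) * (N₁ x + L * N x)) (Set.Ici x₀) := by
    have hd : ∀ x ≥ x₀, HasDerivAt (fun x => Real.exp (-L * x) * (N₁ x + L * N x))
        (Real.exp (-L * x) * (-L) * (N₁ x + L * N x) +
          Real.exp (-L * x) * (N₂ x + L * N₁ x)) x := fun x hx =>
      (hexp (-L) x).mul ((h2 x hx).add ((h1 x hx).const_mul L))
    refine monotoneOn_of_deriv_nonneg (convex_Ici _)
      (fun x hx => (hd x hx).continuousAt.continuousWithinAt)
      (fun x hx => (hd x (interior_subset hx)).differentiableAt.differentiableWithinAt)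
      (fun x hx => ?_)
    rw [(hd x (interior_subset hx)).deriv]
    have := h3 x (interior_subset hx)
    have e : Real.exp (-L * x) * (-L) * (N₁ x + L * N x) +
        Real.exp (-L * x) * (N₂ x + L * N₁ x) = Real.exp (-L * x) * (N₂ x - L ^ 2 * N x) := by
      ring
    rw [e]
    exact mul_nonneg (Real.exp_pos _).le (by linarith)
  have hg : ∀ x ≥ x₀, c₀ * Real.exp (L * x) ≤ N₁ x + L * N x := fun x hx => by
    have := m1 (Set.self_mem_Ici) hx hx
    simp only at this
    rw [← hc₀] at this
    calc c₀ * Real.exp (L * x) ≤ Real.exp (-L * x) * (N₁ x + L * N x) * Real.exp (L * x) := by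
          gcongr
      _ = Real.exp (-L * x + L * x) * (N₁ x + L * N x) := by rw [Real.exp_add]; ring
      _ = _ := by simp
  have m2 : MonotoneOn (fun x => Real.exp (L * x) * N x - c₀ / (2 * L) * Real.exp (2 * L * x))
      (Set.Ici x₀) := by
    have hd : ∀ x ≥ x₀, HasDerivAt
        (fun x => Real.exp (L * x) * N x - c₀ / (2 * L) * Real.exp (2 * L * x))
        (Real.exp (L * x) * L * N x + Real.exp (L * x) * N₁ x -
          c₀ / (2 * L) * (Real.exp (2 * L * x) * (2 * L))) x := fun x hx =>
      ((hexp L x).mul (h1 x hx)).sub ((hexp (2 * L) x).const_mul _)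
    refine monotoneOn_of_deriv_nonneg (convex_Ici _)
      (fun x hx => (hd x hx).continuousAt.continuousWithinAt)
      (fun x hx => (hd x (interior_subset hx)).differentiableAt.differentiableWithinAt)
      (fun x hx => ?_)
    rw [(hd x (interior_subset hx)).deriv]
    have := hg x (interior_subset hx)
    have e : Real.exp (L * x) * L * N x + Real.exp (L * x) * N₁ x -
          c₀ / (2 * L) * (Real.exp (2 * L * x) * (2 * L)) =
        Real.exp (L * x) * (N₁ x + L * N x - c₀ * Real.exp (L * x)) := by
      rw [show 2 * L * x = L * x + L * x by ring, Real.exp_add]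
      field_simp
      ring
    rw [e]
    exact mul_nonneg (Real.exp_pos _).le (by linarith)
  set C := Real.exp (L * x₀) * N x₀ - c₀ / (2 * L) * Real.exp (2 * L * x₀) with hC
  refine ⟨c₀ / (4 * L), by positivity, ?_⟩
  have htend : Filter.Tendsto (fun x : ℝ => Real.exp (2 * L * x)) Filter.atTop Filter.atTop :=
    Real.tendsto_exp_atTop.comp (Filter.tendsto_id.const_mul_atTop (by positivity))
  filter_upwards [Filter.eventually_ge_atTop x₀,
    htend.eventually_ge_atTop (-C * (4 * L) / c₀)] with x hx hx2
  have h4 := m2 (Set.self_mem_Ici) hx hx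
  simp only at h4
  rw [← hC] at h4
  have h5 : -C ≤ c₀ / (4 * L) * Real.exp (2 * L * x) := by
    rw [div_le_iff₀ hc₀p] at hx2
    rw [div_mul_eq_mul_div, le_div_iff₀ (by positivity)]
    linarith
  have h6 : c₀ / (4 * L) * Real.exp (2 * L * x) ≤ Real.exp (L * x) * N x := by
    have : c₀ / (2 * L) = 2 * (c₀ / (4 * L)) := by field_simp; norm_num
    rw [this] at h4
    linarith
  rw [show 2 * L * x = L * x + L * x by ring, Real.exp_add] at h6
  have hp := Real.exp_pos (L * x)
  nlinarith

/-- The first two derivatives of `‖y‖²` for a solution of `y'' = q y`; the second one is nonnegative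
when `Re q` is. -/
theorem hasDerivAt_norm_sq_of_ode {y y₁ : ℝ → ℂ} {q : ℂ} {s : ℝ}
    (h : HasDerivAt y (y₁ s) s) (h1 : HasDerivAt y₁ (q * y s) s) :
    HasDerivAt (fun s => ‖y s‖ ^ 2) (2 * inner ℝ (y s) (y₁ s)) s ∧
    HasDerivAt (fun s => 2 * inner ℝ (y s) (y₁ s))
      (2 * (q.re * ‖y s‖ ^ 2 + ‖y₁ s‖ ^ 2)) s := by
  have h2 := (h.inner ℝ h1).const_mul 2
  refine ⟨h.norm_sq, ?_⟩
  refine h2.congr_deriv ?_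
  rw [real_inner_self_eq_norm_sq, Complex.inner, Complex.sq_norm (y s), Complex.normSq_apply]
  simp
  ring

/-- Weak solutions of `v'' = Q v` on a left half-line are classical. -/
theorem exists_hasDerivAt_of_weak_ode {S : ℝ} {v Q : ℝ → ℂ} (hv : LocallyIntegrable v)
    (hQ : Continuous Q)
    (h : ∀ ρ, IsLineTest (Set.Iio S) ρ →
      ∫ s, deriv (deriv ρ) s • v s = ∫ s, ρ s • (Q s * v s)) :
    ∃ y y₁ : ℝ → ℂ, (∀ s < S, HasDerivAt y (y₁ s) s) ∧
      (∀ s < S, HasDerivAt y₁ (Q s * y s) s) ∧ ∀ᵐ s, s < S → v s = y s := by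
  have hw : LocallyIntegrable (fun s => Q s * v s) := by
    have := hv.locallyIntegrableOn Set.univ
    exact locallyIntegrableOn_univ.1
      (this.continuousOn_mul hQ.continuousOn isOpen_univ.isLocallyClosed)
  obtain ⟨a, b, hab⟩ := ae_eq_of_weak_deriv_deriv (p := 0) (κ := 0) hv hw (S - 1)
    (by simpa using h)
  set y : ℝ → ℂ := fun s => a + s • b + secondPrimitive (S - 1) (fun s => Q s * v s) s with hy
  have hyc : Continuous y := by
    have := continuous_secondPrimitive hw (S - 1)
    fun_prop
  have hQy : Continuous fun s => Q s * y s := hQ.mul hyc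
  have hvy : ∀ᵐ s, s < S → v s = y s := by
    filter_upwards [hab] with s hs hsS
    simpa [hy] using hs hsS
  refine ⟨y, fun s => b + ∫ x in (S - 1)..s, Q x * y x, fun s hs => ?_, fun s hs => ?_, hvy⟩
  · have h1 := ((((hasDerivAt_id s).smul_const b).const_add a)).add
      (hasDerivAt_secondPrimitive hw (S - 1) s)
    have h2 : ∫ x in (S - 1)..s, Q x * v x = ∫ x in (S - 1)..s, Q x * y x := by
      refine intervalIntegral.integral_congr_ae ?_
      filter_upwards [hvy] with x hx hxs
      rw [hx (lt_of_le_of_lt hxs.2 (max_lt (by linarith) hs))]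
    rw [h2, one_smul] at h1
    exact h1
  · exact (intervalIntegral.integral_hasDerivAt_right (hQy.intervalIntegrable _ _)
      (hQy.stronglyMeasurableAtFilter _ _) hQy.continuousAt).const_add b

/-- A solution of `y'' = Q y` that vanishes far to the left vanishes. -/
theorem eq_zero_of_ode_of_eq_zero_left {S s₀ : ℝ} {y y₁ Q : ℝ → ℂ} (hQ : Continuous Q)
    (hy : ∀ s < S, HasDerivAt y (y₁ s) s) (hy₁ : ∀ s < S, HasDerivAt y₁ (Q s * y s) s)
    (h0 : ∀ s < s₀, y s = 0) {s : ℝ} (hs : s < S) : y s = 0 := by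
  rcases lt_or_ge s s₀ with hlt | hge
  · exact h0 s hlt
  set a := s₀ - 1 with ha
  have haS : a < S := by linarith
  have hyc : ContinuousOn y (Set.Icc a s) := fun x hx =>
    (hy x (lt_of_le_of_lt hx.2 hs)).continuousAt.continuousWithinAt
  have hy₁c : ContinuousOn y₁ (Set.Icc a s) := fun x hx =>
    (hy₁ x (lt_of_le_of_lt hx.2 hs)).continuousAt.continuousWithinAt
  have hya : y a = 0 := h0 a (by linarith)
  have hy₁a : y₁ a = 0 := by
    refine (hy a haS).unique ((hasDerivAt_const a (0 : ℂ)).congr_of_eventuallyEq ?_)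
    filter_upwards [Iio_mem_nhds (show a < s₀ by linarith)] with x hx
    exact h0 x hx
  refine eq_zero_of_volterra (s₀ := a) (S := s) (w := fun s => Q s * y s) hyc hQ.continuousOn
    (ae_of_all _ fun _ _ => rfl) (fun x hx => ?_) ⟨by linarith, le_rfl⟩
  have hsub : ∀ z ∈ Set.Ioc a s, Set.uIcc a z ⊆ Set.Icc a s := fun z hz => by
    rw [Set.uIcc_of_le hz.1.le]
    exact Set.Icc_subset_Icc_right hz.2
  have e1 : ∀ z ∈ Set.Ioc a s, ∫ x in a..z, Q x * y x = y₁ z := fun z hz => by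
    rw [intervalIntegral.integral_eq_sub_of_hasDerivAt
      (fun x hx => hy₁ x (lt_of_le_of_lt (hsub z hz hx).2 hs))
      ((hQ.continuousOn.mul hyc).mono (hsub z hz)).intervalIntegrable, hy₁a, sub_zero]
  rw [secondPrimitive, intervalIntegral.integral_of_le hx.1.le,
    setIntegral_congr_fun (g := y₁) measurableSet_Ioc (fun z hz => e1 z ⟨hz.1, hz.2.trans hx.2⟩),
    ← intervalIntegral.integral_of_le hx.1.le, intervalIntegral.integral_eq_sub_of_hasDerivAt
      (fun z hz => hy z (lt_of_le_of_lt (hsub x hx hz).2 hs))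
      (hy₁c.mono (hsub x hx)).intervalIntegrable, hya, sub_zero]

/-- Decay towards `-∞` of the solutions of `y'' = Q y` with `Re Q ≥ L²` that are integrable with
weight `e^{2 s}`: solutions that do not decay grow at least like `e^{-L s / 2}`, and for `L ≥ 4`
the weight does not make this integrable. -/
theorem norm_le_exp_mul_norm_of_ode {S L : ℝ} (hL : 4 ≤ L) {y y₁ Q : ℝ → ℂ}
    (hy : ∀ s < S, HasDerivAt y (y₁ s) s) (hy₁ : ∀ s < S, HasDerivAt y₁ (Q s * y s) s)
    (hQ : ∀ s < S, L ^ 2 ≤ (Q s).re)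
    (hint : IntegrableOn (fun s => Real.exp (2 * s) * ‖y s‖) (Set.Iio S)) {s σ : ℝ}
    (hsσ : s ≤ σ) (hσ : σ < S) : ‖y s‖ ≤ Real.exp (-(L / 2) * (σ - s)) * ‖y σ‖ := by
  have hL0 : 0 < L := by linarith
  set N : ℝ → ℝ := fun s => ‖y s‖ ^ 2 with hN
  set N₁ : ℝ → ℝ := fun s => 2 * inner ℝ (y s) (y₁ s) with hN₁
  set N₂ : ℝ → ℝ := fun s => 2 * ((Q s).re * ‖y s‖ ^ 2 + ‖y₁ s‖ ^ 2) with hN₂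
  have d1 : ∀ s < S, HasDerivAt N (N₁ s) s := fun s hs =>
    (hasDerivAt_norm_sq_of_ode (hy s hs) (hy₁ s hs)).1
  have d2 : ∀ s < S, HasDerivAt N₁ (N₂ s) s := fun s hs =>
    (hasDerivAt_norm_sq_of_ode (hy s hs) (hy₁ s hs)).2
  have d3 : ∀ s < S, L ^ 2 * N s ≤ N₂ s := fun s hs => by
    have := mul_le_mul_of_nonneg_right (hQ s hs) (sq_nonneg ‖y s‖)
    have h0 : 0 ≤ L ^ 2 * ‖y s‖ ^ 2 := by positivity
    simp only [hN, hN₂]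
    nlinarith [sq_nonneg ‖y₁ s‖]
  -- Otherwise `x ↦ N(-x)` grows exponentially.
  have key : ∀ s < S, 0 ≤ N₁ s - L * N s := by
    intro s hs
    by_contra hneg
    obtain ⟨c, hc, hev⟩ := eventually_exp_le_of_deriv_deriv_ge (N := fun x => N (-x))
      (N₁ := fun x => -N₁ (-x)) (N₂ := fun x => N₂ (-x)) (x₀ := -s) hL0
      (fun x hx => by
        have := (d1 (-x) (by linarith)).comp x (hasDerivAt_neg x)
        rwa [mul_neg_one] at this)
      (fun x hx => by
        have := ((d2 (-x) (by linarith)).comp x (hasDerivAt_neg x)).neg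
        rwa [mul_neg_one, neg_neg] at this)
      (fun x hx => d3 (-x) (by linarith)) (by rw [neg_neg]; linarith)
    obtain ⟨X, hX⟩ := Filter.eventually_atTop.1 hev
    -- Near `-∞` the weighted function is bounded below by a positive constant.
    set T := min (min (-X) 0) (S - 1) with hT
    have hlow : ∀ x ∈ Set.Iic T, Real.sqrt c ≤ Real.exp (2 * x) * ‖y x‖ := by
      intro x hx
      have hx1 : x ≤ -X := hx.trans ((min_le_left _ _).trans (min_le_left _ _))
      have hx0 : x ≤ 0 := hx.trans ((min_le_left _ _).trans (min_le_right _ _))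
      have h1 := hX (-x) (by linarith)
      simp only [neg_neg, hN] at h1
      refine Real.sqrt_le_iff.2 ⟨by positivity, ?_⟩
      rw [mul_pow, ← Real.exp_nat_mul]
      calc c ≤ c * Real.exp ((2 : ℕ) * (2 * x) + L * -x) := by
            refine le_mul_of_one_le_right hc.le (Real.one_le_exp ?_)
            push_cast
            nlinarith
        _ = Real.exp ((2 : ℕ) * (2 * x)) * (c * Real.exp (L * -x)) := by
            rw [Real.exp_add]
            ring
        _ ≤ _ := by gcongr
    have hTS : Set.Iic T ⊆ Set.Iio S := fun x hx =>
      lt_of_le_of_lt (le_trans hx (min_le_right _ _)) (sub_one_lt S)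
    have hci : IntegrableOn (fun _ : ℝ => Real.sqrt c) (Set.Iic T) := by
      refine Integrable.mono' (hint.mono_set hTS) aestronglyMeasurable_const ?_
      rw [ae_restrict_iff' measurableSet_Iic]
      refine ae_of_all _ fun x hx => ?_
      rw [Real.norm_of_nonneg (Real.sqrt_nonneg _)]
      exact hlow x hx
    rw [integrableOn_const_iff] at hci
    rcases hci with h | h
    · exact (Real.sqrt_pos.2 hc).ne' (enorm_eq_zero.1 h)
    · simp at h
  have hmono : MonotoneOn (fun s => Real.exp (-L * s) * N s) (Set.Iio S) := by
    have hd : ∀ x < S, HasDerivAt (fun s => Real.exp (-L * s) * N s)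
        (Real.exp (-L * x) * (-L) * N x + Real.exp (-L * x) * N₁ x) x := fun x hx => by
      have h1 : HasDerivAt (fun x => Real.exp (-L * x)) (Real.exp (-L * x) * (-L)) x := by
        simpa using ((hasDerivAt_id x).const_mul (-L)).exp
      exact h1.mul (d1 x hx)
    refine monotoneOn_of_deriv_nonneg (convex_Iio _)
      (fun x hx => (hd x hx).continuousAt.continuousWithinAt)
      (fun x hx => ((hd x (by simpa using hx))).differentiableAt.differentiableWithinAt)
      (fun x hx => ?_)
    have hxS : x < S := by simpa using hx
    rw [(hd x hxS).deriv]
    have e : Real.exp (-L * x) * (-L) * N x + Real.exp (-L * x) * N₁ x =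
      Real.exp (-L * x) * (N₁ x - L * N x) := by ring
    rw [e]
    exact mul_nonneg (Real.exp_pos _).le (key x hxS)
  have h1 := hmono (lt_of_le_of_lt hsσ hσ) hσ hsσ
  simp only [hN] at h1
  have h2 : ‖y s‖ ^ 2 ≤ (Real.exp (-(L / 2) * (σ - s)) * ‖y σ‖) ^ 2 := by
    rw [mul_pow, ← Real.exp_nat_mul]
    calc ‖y s‖ ^ 2 = Real.exp (L * s) * (Real.exp (-L * s) * ‖y s‖ ^ 2) := by
          rw [← mul_assoc, ← Real.exp_add]
          simp
      _ ≤ Real.exp (L * s) * (Real.exp (-L * σ) * ‖y σ‖ ^ 2) := by gcongr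
      _ = _ := by
          rw [← mul_assoc, ← Real.exp_add]
          congr 2
          push_cast
          ring
  exact (sq_le_sq₀ (norm_nonneg _) (by positivity)).1 h2

/-- The pointwise decay estimate averaged over `σ ∈ (S - 1, S)`. -/
theorem norm_le_exp_mul_integral_of_ode {S L : ℝ} (hL : 4 ≤ L) {y y₁ Q : ℝ → ℂ}
    (hy : ∀ s < S, HasDerivAt y (y₁ s) s) (hy₁ : ∀ s < S, HasDerivAt y₁ (Q s * y s) s)
    (hQ : ∀ s < S, L ^ 2 ≤ (Q s).re)
    (hint : IntegrableOn (fun s => Real.exp (2 * s) * ‖y s‖) (Set.Iio S)) {s : ℝ}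
    (hs : s ≤ S - 2) :
    ‖y s‖ ≤ Real.exp (-(L / 2)) * Real.exp (2 - 2 * S) *
      ∫ σ in Set.Iio S, Real.exp (2 * σ) * ‖y σ‖ := by
  have h1 : ∀ σ ∈ Set.Ioo (S - 1) S,
      ‖y s‖ ≤ Real.exp (-(L / 2)) * Real.exp (2 - 2 * S) * (Real.exp (2 * σ) * ‖y σ‖) := by
    intro σ hσ
    refine (norm_le_exp_mul_norm_of_ode hL hy hy₁ hQ hint (s := s) (σ := σ)
      (by linarith [hσ.1]) hσ.2).trans ?_
    rw [← mul_assoc, ← Real.exp_add, ← Real.exp_add]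
    gcongr
    nlinarith [hσ.1]
  have hsub : Set.Ioo (S - 1) S ⊆ Set.Iio S := fun x hx => hx.2
  calc ‖y s‖ = ∫ σ in Set.Ioo (S - 1) S, ‖y s‖ := by simp
    _ ≤ ∫ σ in Set.Ioo (S - 1) S,
        Real.exp (-(L / 2)) * Real.exp (2 - 2 * S) * (Real.exp (2 * σ) * ‖y σ‖) :=
      setIntegral_mono_on (by simp) ((hint.mono_set hsub).const_mul _) measurableSet_Ioo h1
    _ ≤ ∫ σ in Set.Iio S,
        Real.exp (-(L / 2)) * Real.exp (2 - 2 * S) * (Real.exp (2 * σ) * ‖y σ‖) :=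
      setIntegral_mono_set (hint.const_mul _) (ae_of_all _ fun x => by positivity)
        hsub.eventuallyLE
    _ = _ := integral_const_mul _ _

/-- A nonzero solution of `y'' = Q y` with `y(p) = 0` grows faster than every exponential when
`Re Q` is nonnegative and tends to infinity. -/
theorem eventually_exp_le_norm_sq_of_ode {p : ℝ} {y y₁ Q : ℝ → ℂ}
    (hy : ∀ s ≥ p, HasDerivAt y (y₁ s) s) (hy₁ : ∀ s ≥ p, HasDerivAt y₁ (Q s * y s) s)
    (hQ : ∀ s ≥ p, 0 ≤ (Q s).re) (hQ' : Filter.Tendsto (fun s => (Q s).re) Filter.atTop Filter.atTop)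
    (h0 : y p = 0) (h1 : y₁ p ≠ 0) {L : ℝ} (hL : 0 < L) :
    ∃ c > 0, ∀ᶠ s in Filter.atTop, c * Real.exp (L * s) ≤ ‖y s‖ ^ 2 := by
  set N₁ : ℝ → ℝ := fun s => 2 * inner ℝ (y s) (y₁ s) with hN₁
  set N₂ : ℝ → ℝ := fun s => 2 * ((Q s).re * ‖y s‖ ^ 2 + ‖y₁ s‖ ^ 2) with hN₂
  have d1 : ∀ s ≥ p, HasDerivAt (fun s => ‖y s‖ ^ 2) (N₁ s) s := fun s hs =>
    (hasDerivAt_norm_sq_of_ode (hy s hs) (hy₁ s hs)).1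
  have d2 : ∀ s ≥ p, HasDerivAt N₁ (N₂ s) s := fun s hs =>
    (hasDerivAt_norm_sq_of_ode (hy s hs) (hy₁ s hs)).2
  have hmono : MonotoneOn N₁ (Set.Ici p) := by
    refine monotoneOn_of_deriv_nonneg (convex_Ici _)
      (fun x hx => (d2 x hx).continuousAt.continuousWithinAt)
      (fun x hx => (d2 x (interior_subset hx)).differentiableAt.differentiableWithinAt)
      (fun x hx => ?_)
    rw [(d2 x (interior_subset hx)).deriv]
    have := mul_nonneg (hQ x (interior_subset hx)) (sq_nonneg ‖y x‖)
    simp only [hN₂]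
    positivity
  have hN₁p : N₁ p = 0 := by simp [hN₁, h0]
  -- `(‖y‖²)'` vanishes at `p` but its derivative there is `2 ‖y'(p)‖² > 0`.
  obtain ⟨x₁, hx₁p, hx₁⟩ : ∃ x > p, 0 < N₁ x := by
    by_contra hcon
    push Not at hcon
    have hzero : ∀ x ≥ p, N₁ x = 0 := fun x hx => by
      rcases eq_or_lt_of_le hx with rfl | hlt
      · exact hN₁p
      · exact le_antisymm (hcon x hlt) (hN₁p ▸ hmono Set.self_mem_Ici hx hx)
    have h2 : HasDerivWithinAt N₁ 0 (Set.Ici p) p :=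
      (hasDerivWithinAt_const p (Set.Ici p) (0 : ℝ)).congr hzero (hzero p le_rfl)
    have h3 := (uniqueDiffOn_Ici p p Set.self_mem_Ici).eq_deriv _
      (d2 p le_rfl).hasDerivWithinAt h2
    simp only [hN₂, h0, norm_zero] at h3
    have : 0 < ‖y₁ p‖ ^ 2 := by positivity
    linarith
  obtain ⟨X, hX⟩ := Filter.eventually_atTop.1 (hQ'.eventually_ge_atTop (L ^ 2))
  refine eventually_exp_le_of_deriv_deriv_ge (x₀ := max x₁ X) hL
    (fun x hx => d1 x ?_) (fun x hx => d2 x ?_) (fun x hx => ?_) ?_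
  · exact hx₁p.le.trans ((le_max_left _ _).trans hx)
  · exact hx₁p.le.trans ((le_max_left _ _).trans hx)
  · have := mul_le_mul_of_nonneg_right (hX x ((le_max_right _ _).trans hx)) (sq_nonneg ‖y x‖)
    have h0 : 0 ≤ L ^ 2 * ‖y x‖ ^ 2 := by positivity
    simp only [hN₂]
    nlinarith [sq_nonneg ‖y₁ x‖]
  · have h2 := hmono hx₁p.le (hx₁p.le.trans (le_max_left x₁ X)) (le_max_left x₁ X)
    positivity [hx₁.trans_le h2]

/-! ### Fourier transforms of integrable functions -/

open scoped FourierTransform in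
theorem integral_fourier_mul_eq_flip {f g : ℝ → ℂ} (hf : Integrable f) (hg : Integrable g) :
    ∫ ξ, 𝓕 f ξ * g ξ = ∫ x, f x * 𝓕 g x := by
  simpa using! (VectorFourier.integral_fourierIntegral_smul_eq_flip (L := innerₗ ℝ)
    Real.continuous_fourierChar continuous_inner hf hg)

open scoped FourierTransform in
theorem continuous_fourier_of_integrable {f : ℝ → ℂ} (hf : Integrable f) : Continuous (𝓕 f) := by
  have := VectorFourier.fourierIntegral_continuous (L := innerₗ ℝ) (μ := volume)
      Real.continuous_fourierChar (by simpa using! continuous_inner) hf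
  exact this

open scoped FourierTransform in
/-- Fourier inversion almost everywhere. -/
theorem ae_eq_fourierInv_fourier {f : ℝ → ℂ} (hf : Integrable f) (hf' : Integrable (𝓕 f)) :
    f =ᵐ[volume] 𝓕⁻ (𝓕 f) := by
  have hcont : Continuous (𝓕⁻ (𝓕 f)) := by
    have : 𝓕⁻ (𝓕 f) = fun x => 𝓕 (𝓕 f) (-x) :=
      funext fun x => Real.fourierInv_eq_fourier_neg _ x
    rw [this]
    exact (continuous_fourier_of_integrable hf').comp continuous_neg
  have hl : LocallyIntegrable (fun x => f x - 𝓕⁻ (𝓕 f) x) :=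
    hf.locallyIntegrable.sub hcont.locallyIntegrable
  -- Both sides have the same integral against every test function `ψ = 𝓕 Φ`, by moving the Fourier
  -- transform from one factor to the other.
  have key := ae_eq_zero_of_integral_contDiff_smul_eq_zero hl ?_
  · filter_upwards [key] with x hx
    exact sub_eq_zero.1 hx
  intro ψ hψ hψc
  have hψ2 : ContDiff ℝ ∞ (fun x => (ψ x : ℂ)) := Complex.ofRealCLM.contDiff.comp hψ
  have hψc2 : HasCompactSupport (fun x => (ψ x : ℂ)) := hψc.comp_left Complex.ofReal_zero
  obtain ⟨Ψ, hΨx⟩ : ∃ Ψ : SchwartzMap ℝ ℂ, ∀ x, Ψ x = ψ x :=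
    ⟨hψc2.toSchwartzMap hψ2, fun x => rfl⟩
  obtain ⟨Φ, hΦ⟩ : ∃ Φ : SchwartzMap ℝ ℂ, Φ = 𝓕⁻ Ψ := ⟨_, rfl⟩
  have hΦΨ : ∀ x, 𝓕 (Φ : ℝ → ℂ) x = ψ x := fun x => by
    rw [← SchwartzMap.fourier_coe, hΦ, FourierTransform.fourier_fourierInv_eq, hΨx]
  have e1 : ∫ x, ψ x • f x = ∫ x, Φ x * 𝓕 f x := by
    have := integral_fourier_mul_eq_flip Φ.integrable hf
    simp only [hΦΨ] at this
    rw [← this]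
    simp only [Complex.real_smul]
  have hneg : Integrable (fun x => (ψ (-x) : ℂ)) := by
    have h1 := Ψ.integrable (μ := volume)
    rw [show (Ψ : ℝ → ℂ) = fun x => (ψ x : ℂ) from funext hΨx] at h1
    exact h1.comp_neg
  have hΦξ : ∀ ξ, 𝓕 (fun x => (ψ (-x) : ℂ)) ξ = Φ ξ := fun ξ => by
    have h1 : (fun x => (ψ (-x) : ℂ)) = fun x => Ψ (-x) := funext fun x => (hΨx (-x)).symm
    rw [hΦ, SchwartzMap.fourierInv_coe, Real.fourierInv_eq_fourier_comp_neg, h1]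
  have e2 : ∫ x, ψ x • 𝓕⁻ (𝓕 f) x = ∫ x, Φ x * 𝓕 f x := by
    have h1 := integral_fourier_mul_eq_flip hneg hf'
    simp only [hΦξ] at h1
    rw [h1, ← integral_neg_eq_self]
    refine integral_congr_ae (ae_of_all _ fun x => ?_)
    simp only [Real.fourierInv_eq_fourier_neg, neg_neg, Complex.real_smul]
  simp only [smul_sub]
  rw [integral_sub, e1, e2, sub_self]
  · exact hf.locallyIntegrable.integrable_smul_left_of_hasCompactSupport hψ.continuous hψc
  · exact hcont.locallyIntegrable.integrable_smul_left_of_hasCompactSupport hψ.continuous hψc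

open scoped FourierTransform in
theorem ae_eq_zero_of_fourier_eq_zero {f : ℝ → ℂ} (hf : Integrable f) (h : ∀ τ, 𝓕 f τ = 0) :
    f =ᵐ[volume] 0 := by
  have h0 : 𝓕 f = fun _ => 0 := funext h
  have := ae_eq_fourierInv_fourier hf (by rw [h0]; exact integrable_zero _ _ _)
  filter_upwards [this] with x hx
  rw [hx, h0, Real.fourierInv_eq]
  simp

theorem integrable_exp_neg_mul_abs {ε : ℝ} (hε : 0 < ε) :
    Integrable fun τ : ℝ => Real.exp (-ε * |τ|) := by
  have h1 : IntegrableOn (fun τ : ℝ => Real.exp (-ε * τ)) (Set.Ioi 0) :=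
    integrableOn_exp_mul_Ioi (by linarith) 0
  have h2 : IntegrableOn (fun τ : ℝ => Real.exp (-ε * |τ|)) (Set.Ioi 0) :=
    h1.congr_fun (fun x hx => by simp only [abs_of_pos (Set.mem_Ioi.1 hx)]) measurableSet_Ioi
  have h3 : IntegrableOn (fun τ : ℝ => Real.exp (ε * τ)) (Set.Iic 0) :=
    integrableOn_exp_mul_Iic hε 0
  have h4 : IntegrableOn (fun τ : ℝ => Real.exp (-ε * |τ|)) (Set.Iic 0) :=
    h3.congr_fun (fun x hx => by simp only [abs_of_nonpos (Set.mem_Iic.1 hx), neg_mul_neg])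
      measurableSet_Iic
  rw [← integrableOn_univ, ← Set.Iic_union_Ioi (a := (0 : ℝ))]
  exact h4.union h2

/-- The Fourier integral of an exponentially decaying function is holomorphic in a strip. -/
theorem differentiableOn_integral_cexp_mul {g : ℝ → ℂ} {C ε : ℝ} (hε : 0 < ε)
    (hg : AEStronglyMeasurable g) (hgC : ∀ τ, ‖g τ‖ ≤ C * Real.exp (-ε * |τ|)) :
    DifferentiableOn ℂ (fun z : ℂ => ∫ τ : ℝ, Complex.exp (Complex.I * τ * z) * g τ)
      {z | |z.im| < ε / 2} := by
  intro z hz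
  have hopen : IsOpen {z : ℂ | |z.im| < ε / 2} :=
    isOpen_lt (Complex.continuous_im.abs) continuous_const
  have hnorm : ∀ (τ : ℝ) (w : ℂ), |w.im| < ε / 2 →
      ‖Complex.exp (Complex.I * τ * w) * g τ‖ ≤ C * Real.exp (-(ε / 2) * |τ|) := by
    intro τ w hw
    rw [norm_mul, Complex.norm_exp]
    have e : (Complex.I * τ * w).re = -(τ * w.im) := by simp
    have hle : -(τ * w.im) ≤ ε / 2 * |τ| := by
      calc -(τ * w.im) ≤ |τ * w.im| := neg_le_abs _
        _ = |τ| * |w.im| := abs_mul _ _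
        _ ≤ |τ| * (ε / 2) := by gcongr
        _ = _ := mul_comm _ _
    rw [e]
    calc Real.exp (-(τ * w.im)) * ‖g τ‖
        ≤ Real.exp (ε / 2 * |τ|) * (C * Real.exp (-ε * |τ|)) := by
          gcongr
          exact hgC τ
      _ = C * (Real.exp (ε / 2 * |τ|) * Real.exp (-ε * |τ|)) := by ring
      _ = _ := by
          rw [← Real.exp_add]
          congr 2
          ring
  have hmeas : ∀ w : ℂ, AEStronglyMeasurable (fun τ : ℝ => Complex.exp (Complex.I * τ * w) * g τ) :=
    fun w => ((by fun_prop :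
      Continuous fun τ : ℝ => Complex.exp (Complex.I * τ * w))).aestronglyMeasurable.mul hg
  have hmeas' : AEStronglyMeasurable
      (fun τ : ℝ => Complex.I * τ * (Complex.exp (Complex.I * τ * z) * g τ)) :=
    ((by fun_prop : Continuous fun τ : ℝ => Complex.I * (τ : ℂ))).aestronglyMeasurable.mul (hmeas z)
  have hC : 0 ≤ C := by
    have := (norm_nonneg _).trans (hgC 0)
    simpa using this
  have hbound : Integrable fun τ : ℝ => C * (4 / ε) * Real.exp (-(ε / 4) * |τ|) :=
    (integrable_exp_neg_mul_abs (by positivity)).const_mul _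
  have key := hasDerivAt_integral_of_dominated_loc_of_deriv_le (μ := volume) (x₀ := z)
    (F := fun (w : ℂ) (τ : ℝ) => Complex.exp (Complex.I * τ * w) * g τ)
    (F' := fun (w : ℂ) (τ : ℝ) => Complex.I * τ * (Complex.exp (Complex.I * τ * w) * g τ))
    (bound := fun τ => C * (4 / ε) * Real.exp (-(ε / 4) * |τ|))
    (hopen.mem_nhds hz) (Filter.Eventually.of_forall hmeas)
    (Integrable.mono' ((integrable_exp_neg_mul_abs (half_pos hε)).const_mul C) (hmeas z)
      (ae_of_all _ fun τ => hnorm τ z hz)) hmeas'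
    (ae_of_all _ fun τ w hw => by
      rw [norm_mul]
      have h1 : ‖Complex.I * (τ : ℂ)‖ = |τ| := by simp
      have h2 : |τ| ≤ 4 / ε * Real.exp (ε / 4 * |τ|) := by
        have := Real.add_one_le_exp (ε / 4 * |τ|)
        rw [div_mul_eq_mul_div, le_div_iff₀ hε]
        nlinarith
      rw [h1]
      calc |τ| * ‖Complex.exp (Complex.I * τ * w) * g τ‖
          ≤ (4 / ε * Real.exp (ε / 4 * |τ|)) * (C * Real.exp (-(ε / 2) * |τ|)) :=
            mul_le_mul h2 (hnorm τ w hw) (norm_nonneg _) (by positivity)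
        _ = C * (4 / ε) * (Real.exp (ε / 4 * |τ|) * Real.exp (-(ε / 2) * |τ|)) := by ring
        _ = _ := by
          rw [← Real.exp_add]
          congr 2
          ring)
    hbound
    (ae_of_all _ fun τ w hw => by
      have h1 : HasDerivAt (fun w : ℂ => Complex.I * τ * w) (Complex.I * τ) w := by
        simpa using (hasDerivAt_id w).const_mul (Complex.I * (τ : ℂ))
      have := h1.cexp.mul_const (g τ)
      refine this.congr_deriv ?_
      ring)
  exact key.2.differentiableAt.differentiableWithinAt

open scoped FourierTransform in
/-- A compactly supported function whose Fourier transform decays exponentially vanishes: it is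
the restriction to the line of a function holomorphic in a strip. -/
theorem ae_eq_zero_of_norm_fourier_le_exp {f : ℝ → ℂ} (hf : Integrable f) {T : ℝ}
    (hT : ∀ᵐ t, T < t → f t = 0) {C ε : ℝ} (hε : 0 < ε)
    (hC : ∀ τ, ‖𝓕 f τ‖ ≤ C * Real.exp (-ε * |τ|)) : f =ᵐ[volume] 0 := by
  have hc : Continuous (𝓕 f) := continuous_fourier_of_integrable hf
  have hi : Integrable (𝓕 f) := Integrable.mono' ((integrable_exp_neg_mul_abs hε).const_mul C)
    hc.aestronglyMeasurable (ae_of_all _ hC)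
  have hinv := ae_eq_fourierInv_fourier hf hi
  set F : ℂ → ℂ := fun z => ∫ τ : ℝ, Complex.exp (Complex.I * τ * z) * 𝓕 f τ with hF
  set U : Set ℂ := {z | |z.im| < ε / 2} with hU
  have hopen : IsOpen U := isOpen_lt (Complex.continuous_im.abs) continuous_const
  have hconv : Convex ℝ U := by
    have : U = Complex.imLm ⁻¹' (Set.Ioo (-(ε / 2)) (ε / 2)) := by
      ext z
      simp [hU, abs_lt]
    rw [this]
    exact (convex_Ioo _ _).linear_preimage _
  have hdiff : DifferentiableOn ℂ F U :=
    differentiableOn_integral_cexp_mul hε hc.aestronglyMeasurable hC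
  have hreal : ∀ x : ℝ, F ((2 * Real.pi * x : ℝ)) = 𝓕⁻ (𝓕 f) x := fun x => by
    rw [Real.fourierInv_eq', hF]
    refine integral_congr_ae (ae_of_all _ fun τ => ?_)
    simp only [smul_eq_mul]
    congr 2
    simp
    ring
  have hmem : ∀ x : ℝ, (x : ℂ) ∈ U := fun x => by simp [hU, hε]
  have hcr : Continuous fun x : ℝ => F ((2 * Real.pi * x : ℝ)) := by
    have h1 : ContinuousOn F U := hdiff.continuousOn
    exact h1.comp_continuous (by fun_prop) (fun x => hmem _)
  -- The holomorphic extension `F` vanishes on a half-line, hence identically.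
  have hzero : ∀ x ∈ Set.Ioi T, F ((2 * Real.pi * x : ℝ)) = 0 := by
    have := Measure.eqOn_open_of_ae_eq (μ := volume) (f := fun x : ℝ => F ((2 * Real.pi * x : ℝ)))
      (g := fun _ => 0) (U := Set.Ioi T)
      ((ae_restrict_iff' measurableSet_Ioi).2 (by
        filter_upwards [hinv, hT] with x h1 h2 hx
        rw [hreal, ← h1, h2 hx])) isOpen_Ioi hcr.continuousOn continuousOn_const
    exact fun x hx => this hx
  have hall : Set.EqOn F 0 U := by
    refine (hdiff.analyticOnNhd hopen).eqOn_zero_of_preconnected_of_frequently_eq_zero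
      hconv.isPreconnected (z₀ := ((2 * Real.pi * (T + 1) : ℝ) : ℂ)) (hmem _) ?_
    have htend : Filter.Tendsto (fun x : ℝ => ((2 * Real.pi * x : ℝ) : ℂ))
        (nhdsWithin (T + 1) {T + 1}ᶜ) (nhdsWithin ((2 * Real.pi * (T + 1) : ℝ) : ℂ)
          {((2 * Real.pi * (T + 1) : ℝ) : ℂ)}ᶜ) := by
      refine tendsto_nhdsWithin_iff.2 ⟨?_, ?_⟩
      · exact ((by fun_prop : Continuous fun x : ℝ => ((2 * Real.pi * x : ℝ) : ℂ)).tendsto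
          (T + 1)).mono_left nhdsWithin_le_nhds
      · filter_upwards [self_mem_nhdsWithin] with x hx hcon
        refine hx ?_
        have h1 := Complex.ofReal_injective hcon
        exact mul_left_cancel₀ (by positivity) h1
    refine htend.frequently (Filter.Eventually.frequently ?_)
    filter_upwards [mem_nhdsWithin_of_mem_nhds (Ioi_mem_nhds (show T < T + 1 by linarith))]
      with x hx
    exact hzero x hx
  filter_upwards [hinv] with x hx
  rw [hx, ← hreal x]
  exact hall (hmem _)

open scoped FourierTransform in
/-- A function on the plane whose partial Fourier transform satisfies, frequency by frequency, an
estimate for almost every value of the parameter, satisfies it for almost every parameter and all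
frequencies. -/
theorem ae_forall_fourier_le {c : ℝ → ℝ → ℂ} {A : Set ℝ}
    (hc : ∀ᵐ s, s ∈ A → Integrable (c s)) {B : ℝ → ℝ → ℝ} (hB : ∀ s, Continuous (B s))
    (h : ∀ τ, ∀ᵐ s, s ∈ A → ‖𝓕 (c s) τ‖ ≤ B s τ) :
    ∀ᵐ s, s ∈ A → ∀ τ, ‖𝓕 (c s) τ‖ ≤ B s τ := by
  have h1 : ∀ᵐ s, ∀ q : ℚ, s ∈ A → ‖𝓕 (c s) q‖ ≤ B s q := ae_all_iff.2 fun q => h q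
  filter_upwards [hc, h1] with s hcs hs hsA τ
  have hcl : IsClosed {τ : ℝ | ‖𝓕 (c s) τ‖ ≤ B s τ} :=
    isClosed_le (continuous_fourier_of_integrable (hcs hsA)).norm (hB s)
  have hd : Dense {τ : ℝ | ‖𝓕 (c s) τ‖ ≤ B s τ} := by
    refine Rat.denseRange_cast.mono ?_
    rintro _ ⟨q, rfl⟩
    exact hs q hsA
  exact (hcl.closure_eq ▸ hd.closure_eq ▸ Set.mem_univ τ : τ ∈ {τ : ℝ | ‖𝓕 (c s) τ‖ ≤ B s τ})

/-! ### Modulated Gaussians -/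

/-- The entire function `z ↦ exp(-z²/2 - 2πiτz)`. -/
def gaussianWave (τ : ℝ) (z : ℂ) : ℂ :=
  Complex.exp (-z ^ 2 / 2 - 2 * Real.pi * Complex.I * τ * z)

/-- The restriction to the line of the `n`-th derivative of `gaussianWave τ`. -/
def gaussianWaveDeriv (τ : ℝ) (n : ℕ) (t : ℝ) : ℂ := iteratedDeriv n (gaussianWave τ) t

theorem contDiff_gaussianWave (τ : ℝ) : ContDiff ℂ ∞ (gaussianWave τ) := by
  unfold gaussianWave
  fun_prop

theorem hasDerivAt_gaussianWaveDeriv (τ : ℝ) (n : ℕ) (t : ℝ) :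
    HasDerivAt (gaussianWaveDeriv τ n) (gaussianWaveDeriv τ (n + 1) t) t := by
  have h1 : HasDerivAt (iteratedDeriv n (gaussianWave τ))
      (iteratedDeriv (n + 1) (gaussianWave τ) t) (t : ℂ) := by
    rw [iteratedDeriv_succ]
    exact ((contDiff_gaussianWave τ).differentiable_iteratedDeriv n
      (by exact_mod_cast WithTop.coe_lt_top _) _).hasDerivAt
  exact h1.comp_ofReal

theorem contDiff_gaussianWaveDeriv (τ : ℝ) (n : ℕ) : ContDiff ℝ ∞ (gaussianWaveDeriv τ n) := by
  have h : ∀ m : ℕ, ∀ n, ContDiff ℝ m (gaussianWaveDeriv τ n) := by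
    intro m
    induction m with
    | zero =>
      intro n
      exact contDiff_zero.2 (continuous_iff_continuousAt.2 fun t =>
        (hasDerivAt_gaussianWaveDeriv τ n t).continuousAt)
    | succ m ih =>
      intro n
      have : deriv (gaussianWaveDeriv τ n) = gaussianWaveDeriv τ (n + 1) :=
        funext fun t => (hasDerivAt_gaussianWaveDeriv τ n t).deriv
      rw [Nat.cast_succ, contDiff_succ_iff_deriv]
      refine ⟨fun t => (hasDerivAt_gaussianWaveDeriv τ n t).differentiableAt, by simp, ?_⟩
      rw [this]
      exact ih (n + 1)
  exact contDiff_infty.2 fun m => h m n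

/-- The constant in the bound for the `n`-th derivative of `gaussianWave τ`: up to geometric factors
it is `√n!`, small enough to be absorbed by the `1 / n!` of a Volterra iteration. -/
def gaussianBound (τ : ℝ) (n : ℕ) : ℝ :=
  Real.exp (2 + (Real.pi * τ) ^ 2) * Real.exp 2 ^ n * Real.sqrt n.factorial

theorem norm_gaussianWaveDeriv_le (τ : ℝ) (n : ℕ) (t : ℝ) :
    ‖gaussianWaveDeriv τ n t‖ ≤ gaussianBound τ n * Real.exp (-t ^ 2 / 4) := by
  -- Cauchy's estimate on the circle of radius `√(n + 1)`, nearly optimal for a Gaussian.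
  set ρ : ℝ := Real.sqrt (n + 1) with hρ
  have hρ0 : 0 < ρ := Real.sqrt_pos.2 (by positivity)
  have hρ2 : ρ ^ 2 = n + 1 := Real.sq_sqrt (by positivity)
  have hsph : ∀ z ∈ Metric.sphere (t : ℂ) ρ, ‖gaussianWave τ z‖ ≤
      Real.exp (2 * ρ ^ 2 + (Real.pi * τ) ^ 2) * Real.exp (-t ^ 2 / 4) := by
    intro z hz
    obtain ⟨w, rfl⟩ : ∃ w, z = t + w := ⟨z - t, by ring⟩
    have hw : ‖w‖ = ρ := by simpa using hz
    have hab : w.re ^ 2 + w.im ^ 2 = ρ ^ 2 := by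
      rw [← hw, Complex.sq_norm, Complex.normSq_apply]
      ring
    rw [gaussianWave, Complex.norm_exp, ← Real.exp_add]
    have e : (-((t : ℂ) + w) ^ 2 / 2 - 2 * Real.pi * Complex.I * τ * (t + w)).re =
        -((t + w.re) ^ 2 - w.im ^ 2) / 2 + 2 * (Real.pi * τ) * w.im := by
      simp [pow_two]
      left
      ring
    rw [e]
    refine Real.exp_le_exp.2 ?_
    nlinarith [sq_nonneg (t + 2 * w.re), sq_nonneg (Real.pi * τ - w.im), sq_nonneg w.im,
      sq_nonneg w.re]
  have h1 := Complex.norm_iteratedDeriv_le_of_forall_mem_sphere_norm_le n hρ0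
    (((contDiff_gaussianWave τ).differentiable (by simp)).diffContOnCl) hsph
  have hfac : (n.factorial : ℝ) / ρ ^ n ≤ Real.sqrt n.factorial := by
    rw [div_le_iff₀ (by positivity)]
    have h2 : Real.sqrt n.factorial ≤ ρ ^ n := by
      refine Real.sqrt_le_iff.2 ⟨by positivity, ?_⟩
      rw [← pow_mul, mul_comm, pow_mul, hρ2]
      calc (n.factorial : ℝ) ≤ (n : ℝ) ^ n := by exact_mod_cast Nat.factorial_le_pow n
        _ ≤ _ := by gcongr; linarith
    calc (n.factorial : ℝ) = Real.sqrt n.factorial * Real.sqrt n.factorial :=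
          (Real.mul_self_sqrt (by positivity)).symm
      _ ≤ _ := by gcongr
  refine h1.trans ?_
  rw [hρ2, gaussianBound]
  calc (n.factorial : ℝ) * (Real.exp (2 * (n + 1) + (Real.pi * τ) ^ 2) * Real.exp (-t ^ 2 / 4)) /
        ρ ^ n = Real.exp (2 * (n + 1) + (Real.pi * τ) ^ 2) * (n.factorial / ρ ^ n) *
          Real.exp (-t ^ 2 / 4) := by ring
    _ ≤ Real.exp (2 * (n + 1) + (Real.pi * τ) ^ 2) * Real.sqrt n.factorial *
          Real.exp (-t ^ 2 / 4) := by gcongr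
    _ = _ := by
      rw [← Real.exp_nat_mul, ← Real.exp_add]
      congr 3
      ring

theorem gaussianBound_nonneg (τ : ℝ) (n : ℕ) : 0 ≤ gaussianBound τ n := by
  unfold gaussianBound
  positivity

theorem monotone_gaussianBound (τ : ℝ) : Monotone (gaussianBound τ) := by
  intro m n hmn
  unfold gaussianBound
  gcongr
  · exact Real.one_le_exp (by norm_num)

theorem tendsto_gaussianBound (τ x : ℝ) :
    Filter.Tendsto (fun j : ℕ => x ^ j * gaussianBound τ (2 * j + 2) / (2 * j).factorial)
      Filter.atTop (nhds 0) := by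
  set A := Real.exp (2 + (Real.pi * τ) ^ 2) with hA
  set E := Real.exp 2 with hE
  have h1 := (FloorSemiring.tendsto_pow_div_factorial_atTop (2 * |x| * E ^ 2)).const_mul
    (2 * A * E ^ 2)
  rw [mul_zero] at h1
  refine squeeze_zero_norm (fun j => ?_) h1
  have hj0 : (0 : ℝ) < j.factorial := by positivity
  have h2j0 : (0 : ℝ) < (2 * j).factorial := by positivity
  have hs : (j.factorial : ℝ) ≤ Real.sqrt (2 * j).factorial := by
    refine Real.le_sqrt_of_sq_le ?_
    have := Nat.le_of_dvd (Nat.factorial_pos _) (Nat.factorial_mul_factorial_dvd_factorial_add j j)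
    rw [← two_mul] at this
    rw [pow_two]
    exact_mod_cast this
  have hs2 : Real.sqrt (2 * j + 2).factorial ≤ (2 * j + 2) * Real.sqrt (2 * j).factorial := by
    refine Real.sqrt_le_iff.2 ⟨by positivity, ?_⟩
    rw [mul_pow, Real.sq_sqrt (by positivity), show 2 * j + 2 = (2 * j + 1) + 1 by ring,
      Nat.factorial_succ, Nat.factorial_succ]
    push_cast
    have : (0 : ℝ) ≤ (2 * j).factorial := by positivity
    nlinarith [mul_nonneg (show (0 : ℝ) ≤ 2 * j + 2 by positivity) this]
  have hs3 : (2 * j + 2 : ℝ) ≤ 2 * 2 ^ j := by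
    have := Nat.lt_two_pow_self (n := j)
    have : (j : ℝ) + 1 ≤ 2 ^ j := by exact_mod_cast this
    linarith
  rw [norm_div, norm_mul, norm_pow, Real.norm_eq_abs, Real.norm_of_nonneg (gaussianBound_nonneg _ _),
    Real.norm_of_nonneg h2j0.le, gaussianBound]
  rw [div_le_iff₀ h2j0]
  calc |x| ^ j * (A * E ^ (2 * j + 2) * Real.sqrt (2 * j + 2).factorial)
      ≤ |x| ^ j * (A * E ^ (2 * j + 2) * ((2 * 2 ^ j) * Real.sqrt (2 * j).factorial)) := by
        gcongr
        exact hs2.trans (by gcongr)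
    _ = 2 * A * E ^ 2 * ((2 * |x| * E ^ 2) ^ j) * Real.sqrt (2 * j).factorial := by
        rw [mul_pow, mul_pow, ← pow_mul, pow_add]
        ring
    _ ≤ 2 * A * E ^ 2 * ((2 * |x| * E ^ 2) ^ j / j.factorial) * (2 * j).factorial := by
        have : Real.sqrt (2 * j).factorial ≤ (2 * j).factorial / j.factorial := by
          rw [le_div_iff₀ hj0]
          calc Real.sqrt (2 * j).factorial * j.factorial
              ≤ Real.sqrt (2 * j).factorial * Real.sqrt (2 * j).factorial := by gcongr
            _ = _ := Real.mul_self_sqrt (by positivity)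
        calc 2 * A * E ^ 2 * ((2 * |x| * E ^ 2) ^ j) * Real.sqrt (2 * j).factorial
            ≤ 2 * A * E ^ 2 * ((2 * |x| * E ^ 2) ^ j) * ((2 * j).factorial / j.factorial) := by
              gcongr
          _ = _ := by ring

/-! ### Logarithmic cylindrical coordinates -/

/-- Cylindrical coordinates with logarithmic radius: `((t, s), θ) ↦ (t, e^s cos θ, e^s sin θ)`. -/
def cyl (q : (ℝ × ℝ) × ℝ) : Spacetime :=
  (q.1.1, Real.exp q.1.2 * Real.cos q.2, Real.exp q.1.2 * Real.sin q.2)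

/-- The measure `e^{2 s} dt ds`, that is `r dt dr`. -/
def cylMeasure : Measure (ℝ × ℝ) :=
  volume.withDensity fun p => ENNReal.ofReal (Real.exp (2 * p.2))

instance : SFinite cylMeasure := by
  unfold cylMeasure
  infer_instance

theorem continuous_cyl : Continuous cyl := by
  unfold cyl
  fun_prop

theorem rad_cyl (q : (ℝ × ℝ) × ℝ) : rad (cyl q) = Real.exp q.1.2 := by
  rw [rad, cyl, mul_pow, mul_pow, ← mul_add, Real.cos_sq_add_sin_sq, mul_one,
    Real.sqrt_sq (Real.exp_pos _).le]

theorem continuous_rad : Continuous rad := by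
  unfold rad
  fun_prop

theorem exists_cyl_eq {z : Spacetime} (hz : 0 < rad z) :
    ∃ θ ∈ Set.Icc (-Real.pi) Real.pi, cyl ((z.1, Real.log (rad z)), θ) = z := by
  set w : ℂ := ⟨z.2.1, z.2.2⟩ with hw
  have hn : ‖w‖ = rad z := by
    rw [Complex.norm_def, Complex.normSq_apply, rad]
    congr 1
    ring
  refine ⟨w.arg, ⟨(Complex.neg_pi_lt_arg w).le, Complex.arg_le_pi w⟩, ?_⟩
  simp only [cyl, Real.exp_log hz]
  rw [← hn, Complex.norm_mul_cos_arg, Complex.norm_mul_sin_arg]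

/-- Integration in cylindrical coordinates. -/
theorem measurePreserving_cyl :
    MeasurePreserving cyl
      (cylMeasure.prod (volume.restrict (Set.Ioo (-Real.pi) Real.pi))) volume := by
  refine ⟨continuous_cyl.measurable, Measure.ext_of_lintegral _ fun f hf => ?_⟩
  have hfc : Measurable fun q => f (cyl q) := hf.comp continuous_cyl.measurable
  have hdens : Measurable fun p : ℝ × ℝ => ENNReal.ofReal (Real.exp (2 * p.2)) := by fun_prop
  have hint : Measurable fun p : ℝ × ℝ =>
      ∫⁻ θ in Set.Ioo (-Real.pi) Real.pi, f (cyl (p, θ)) := hfc.lintegral_prod_right'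
  rw [lintegral_map hf continuous_cyl.measurable, lintegral_prod _ hfc.aemeasurable, cylMeasure,
    lintegral_withDensity_eq_lintegral_mul _ hdens hint]
  simp only [Pi.mul_apply]
  have hmul : Measurable fun p : ℝ × ℝ => ENNReal.ofReal (Real.exp (2 * p.2)) *
      ∫⁻ θ in Set.Ioo (-Real.pi) Real.pi, f (cyl (p, θ)) := hdens.mul hint
  rw [Measure.volume_eq_prod, lintegral_prod _ hmul.aemeasurable,
    Measure.volume_eq_prod, lintegral_prod _ hf.aemeasurable]
  refine lintegral_congr fun t => ?_
  have hft : Measurable fun x : ℝ × ℝ => f (t, x) := hf.comp (by fun_prop)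
  rw [← lintegral_comp_polarCoord_symm (fun x => f (t, x)),
    polarCoord_target, Measure.volume_eq_prod, ← Measure.prod_restrict]
  have hm : Measurable fun p : ℝ × ℝ => ENNReal.ofReal p.1 • f (t, polarCoord.symm p) := by
    have : Measurable fun p : ℝ × ℝ => polarCoord.symm p :=
      continuous_polarCoord_symm.measurable
    exact (by fun_prop : Measurable fun p : ℝ × ℝ => ENNReal.ofReal p.1).smul (hft.comp this)
  rw [lintegral_prod _ hm.aemeasurable, ← Real.range_exp, ← Set.image_univ,
    lintegral_image_eq_lintegral_abs_deriv_mul MeasurableSet.univ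
      (fun x _ => (Real.hasDerivAt_exp x).hasDerivWithinAt) Real.exp_injective.injOn,
    Measure.restrict_univ]
  refine lintegral_congr fun s => ?_
  simp only [smul_eq_mul]
  have hc : Measurable fun θ => f (t, polarCoord.symm (Real.exp s, θ)) :=
    hft.comp (continuous_polarCoord_symm.measurable.comp (by fun_prop))
  rw [lintegral_const_mul _ hc, abs_of_pos (Real.exp_pos s), ← mul_assoc,
    ← ENNReal.ofReal_mul (Real.exp_pos s).le, ← Real.exp_add, ← two_mul]
  rfl

theorem ae_cylMeasure_iff {p : ℝ × ℝ → Prop} : (∀ᵐ x ∂cylMeasure, p x) ↔ ∀ᵐ x, p x := by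
  rw [cylMeasure, ae_withDensity_iff (by fun_prop)]
  refine Filter.eventually_congr (ae_of_all _ fun x => ?_)
  have : ENNReal.ofReal (Real.exp (2 * x.2)) ≠ 0 := by simp [Real.exp_pos]
  simp [this]

theorem integral_cylMeasure (f : ℝ × ℝ → ℂ) :
    ∫ p, f p ∂cylMeasure = ∫ p : ℝ × ℝ, Real.exp (2 * p.2) • f p := by
  rw [cylMeasure, integral_withDensity_eq_integral_toReal_smul₀ (by fun_prop) (by simp)]
  simp [ENNReal.toReal_ofReal, Real.exp_nonneg]

theorem integrable_cylMeasure_iff {f : ℝ × ℝ → ℂ} :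
    Integrable f cylMeasure ↔ Integrable fun p : ℝ × ℝ => Real.exp (2 * p.2) • f p := by
  rw [cylMeasure, integrable_withDensity_iff_integrable_smul' (by fun_prop) (by simp)]
  simp [ENNReal.toReal_ofReal, Real.exp_nonneg]

/-! ### Functions of a single angular mode -/

/-- The function `b(t, log r) e^{i j θ}` on spacetime, extended by zero to the axis. -/
def modeLift (j : ℤ) (b : ℝ × ℝ → ℂ) (z : Spacetime) : ℂ :=
  if rad z = 0 then 0 else
    b (z.1, Real.log (rad z)) * (((z.2.1 : ℂ) + z.2.2 * Complex.I) / rad z) ^ j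

theorem modeLift_of_rad_eq_zero (j : ℤ) (b : ℝ × ℝ → ℂ) {z : Spacetime} (hz : rad z = 0) :
    modeLift j b z = 0 := by
  simp [modeLift, hz]

theorem modeLift_cyl (j : ℤ) (b : ℝ × ℝ → ℂ) (p : ℝ × ℝ) (θ : ℝ) :
    modeLift j b (cyl (p, θ)) = b p * Complex.exp (Complex.I * j * θ) := by
  have hr := rad_cyl (p, θ)
  have h0 : (Real.exp p.2 : ℂ) ≠ 0 := by exact_mod_cast (Real.exp_pos _).ne'
  rw [modeLift, hr, if_neg (Real.exp_pos _).ne', Real.log_exp]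
  congr 1
  have : (((cyl (p, θ)).2.1 : ℂ) + (cyl (p, θ)).2.2 * Complex.I) / (Real.exp p.2 : ℝ) =
      Complex.exp (θ * Complex.I) := by
    rw [Complex.exp_mul_I, div_eq_iff h0]
    simp only [cyl]
    push_cast
    ring
  rw [this, ← Complex.exp_int_mul]
  congr 1
  ring

theorem norm_modeLift_unit {z : Spacetime} (hz : 0 < rad z) (j : ℤ) :
    ‖(((z.2.1 : ℂ) + z.2.2 * Complex.I) / rad z) ^ j‖ = 1 := by
  have h1 : ‖(z.2.1 : ℂ) + z.2.2 * Complex.I‖ = rad z := by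
    rw [Complex.norm_add_mul_I, rad]
  rw [norm_zpow, norm_div, h1, Complex.norm_real, Real.norm_of_nonneg hz.le, div_self hz.ne',
    one_zpow]

theorem contDiffAt_modeLift {n : WithTop ℕ∞} (j : ℤ) {b : ℝ × ℝ → ℂ} (hb : ContDiff ℝ n b)
    {z : Spacetime} (hz : 0 < rad z) : ContDiffAt ℝ n (modeLift j b) z := by
  have hpos : 0 < z.2.1 ^ 2 + z.2.2 ^ 2 := Real.sqrt_pos.1 hz
  have hrad : ContDiffAt ℝ n rad z := by
    unfold rad
    exact ContDiffAt.sqrt (by fun_prop) hpos.ne'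
  have hrad' : ContDiffAt ℝ n (fun z => (rad z : ℂ)) z :=
    Complex.ofRealCLM.contDiff.contDiffAt.comp z hrad
  have hx : ContDiffAt ℝ n (fun z : Spacetime => (z.2.1 : ℂ)) z :=
    Complex.ofRealCLM.contDiff.contDiffAt.comp z
      (by fun_prop : ContDiffAt ℝ n (fun z : Spacetime => z.2.1) z)
  have hy : ContDiffAt ℝ n (fun z : Spacetime => (z.2.2 : ℂ)) z :=
    Complex.ofRealCLM.contDiff.contDiffAt.comp z
      (by fun_prop : ContDiffAt ℝ n (fun z : Spacetime => z.2.2) z)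
  have hr0 : (rad z : ℂ) ≠ 0 := by exact_mod_cast hz.ne'
  have hE : ContDiffAt ℝ n
      (fun z : Spacetime => ((z.2.1 : ℂ) + z.2.2 * Complex.I) / rad z) z := by
    simp only [div_eq_mul_inv]
    exact (hx.add (hy.mul contDiffAt_const)).mul (hrad'.inv hr0)
  have hE0 : ∀ j : ℤ, (((z.2.1 : ℂ) + z.2.2 * Complex.I) / rad z) ^ j ≠ 0 := fun j h => by
    have := norm_modeLift_unit hz j
    rw [h, norm_zero] at this
    exact zero_ne_one this
  have hEj : ContDiffAt ℝ n
      (fun z : Spacetime => (((z.2.1 : ℂ) + z.2.2 * Complex.I) / rad z) ^ j) z := by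
    rcases Int.eq_nat_or_neg j with ⟨m, rfl | rfl⟩
    · simpa only [zpow_natCast] using hE.pow m
    · simp only [zpow_neg, zpow_natCast]
      refine (hE.pow m).inv ?_
      have := hE0 m
      rwa [zpow_natCast] at this
  have hbc : ContDiffAt ℝ n (fun z : Spacetime => b (z.1, Real.log (rad z))) z := by
    have h1 : ContDiffAt ℝ n (fun z : Spacetime => (z.1, Real.log (rad z))) z :=
      contDiffAt_fst.prodMk (hrad.log hz.ne')
    exact hb.contDiffAt.comp z h1
  refine (hbc.mul hEj).congr_of_eventuallyEq ?_
  filter_upwards [continuous_rad.continuousAt.eventually (lt_mem_nhds hz)] with w hw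
  rw [modeLift, if_neg hw.ne']

/-- The part of spacetime off the axis lying over a set of pairs `(t, log r)`. -/
def cylRegion (A : Set (ℝ × ℝ)) : Set Spacetime :=
  {z | 0 < rad z ∧ (z.1, Real.log (rad z)) ∈ A}

theorem isCompact_cylRegion {A : Set (ℝ × ℝ)} (hA : IsCompact A) : IsCompact (cylRegion A) := by
  have h : cylRegion A = cyl '' (A ×ˢ Set.Icc (-Real.pi) Real.pi) := by
    ext z
    constructor
    · rintro ⟨hz, hzA⟩
      obtain ⟨θ, hθ, he⟩ := exists_cyl_eq hz
      exact ⟨_, ⟨hzA, hθ⟩, he⟩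
    · rintro ⟨⟨p, θ⟩, ⟨hp, _⟩, rfl⟩
      refine ⟨by rw [rad_cyl]; exact Real.exp_pos _, ?_⟩
      rw [rad_cyl, Real.log_exp]
      exact hp
  rw [h]
  exact (hA.prod isCompact_Icc).image continuous_cyl

theorem tsupport_modeLift_subset (j : ℤ) {b : ℝ × ℝ → ℂ} (hb : HasCompactSupport b) :
    tsupport (modeLift j b) ⊆ cylRegion (tsupport b) := by
  refine closure_minimal (fun z hz => ?_) (isCompact_cylRegion hb.isCompact).isClosed
  have hz0 : rad z ≠ 0 := fun h => hz (modeLift_of_rad_eq_zero j b h)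
  refine ⟨lt_of_le_of_ne (Real.sqrt_nonneg _) (Ne.symm hz0), subset_tsupport _ fun h => hz ?_⟩
  rw [modeLift, if_neg hz0, h, zero_mul]

theorem hasCompactSupport_modeLift (j : ℤ) {b : ℝ × ℝ → ℂ} (hb : HasCompactSupport b) :
    HasCompactSupport (modeLift j b) :=
  (isCompact_cylRegion hb.isCompact).of_isClosed_subset (isClosed_tsupport _)
    (tsupport_modeLift_subset j hb)

theorem contDiff_modeLift {n : WithTop ℕ∞} (j : ℤ) {b : ℝ × ℝ → ℂ} (hb : ContDiff ℝ n b)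
    (hbc : HasCompactSupport b) : ContDiff ℝ n (modeLift j b) := by
  rw [contDiff_iff_contDiffAt]
  intro z
  by_cases hz : z ∈ tsupport (modeLift j b)
  · exact contDiffAt_modeLift j hb (tsupport_modeLift_subset j hbc hz).1
  · exact (contDiffAt_const (c := (0 : ℂ))).congr_of_eventuallyEq
      (notMem_tsupport_iff_eventuallyEq.1 hz)

theorem isTest_modeLift (j : ℤ) {b : ℝ × ℝ → ℂ} (hb : ContDiff ℝ ∞ b)
    (hbc : HasCompactSupport b) : IsTest Set.univ (modeLift j b) where
  smooth := contDiff_modeLift j hb hbc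
  compact := hasCompactSupport_modeLift j hbc
  supp := Set.subset_univ _
  off_axis := fun _ hz => (tsupport_modeLift_subset j hbc hz).1

/-- The directional derivative of `b` along `v`. -/
def dirDeriv (v : ℝ × ℝ) (b : ℝ × ℝ → ℂ) (p : ℝ × ℝ) : ℂ := fderiv ℝ b p v

theorem contDiff_dirDeriv {b : ℝ × ℝ → ℂ} (hb : ContDiff ℝ ∞ b) (v : ℝ × ℝ) :
    ContDiff ℝ ∞ (dirDeriv v b) :=
  (hb.fderiv_right (by simp)).clm_apply contDiff_const

theorem tsupport_dirDeriv_subset (v : ℝ × ℝ) (b : ℝ × ℝ → ℂ) :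
    tsupport (dirDeriv v b) ⊆ tsupport b := by
  refine closure_minimal (fun p hp => ?_) (isClosed_tsupport _)
  refine support_fderiv_subset ℝ fun h => hp ?_
  rw [dirDeriv, h]
  rfl

theorem hasCompactSupport_dirDeriv {b : ℝ × ℝ → ℂ} (hb : HasCompactSupport b) (v : ℝ × ℝ) :
    HasCompactSupport (dirDeriv v b) :=
  hb.isCompact.of_isClosed_subset (isClosed_tsupport _) (tsupport_dirDeriv_subset v b)

theorem fderiv_modeLift_of_rad_eq_zero (j : ℤ) {b : ℝ × ℝ → ℂ} (hbc : HasCompactSupport b)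
    {z : Spacetime} (hz : rad z = 0) : fderiv ℝ (modeLift j b) z = 0 := by
  have h1 : z ∉ tsupport (modeLift j b) := fun h =>
    (tsupport_modeLift_subset j hbc h).1.ne' hz
  have h2 := (notMem_tsupport_iff_eventuallyEq.1 h1).fderiv_eq (𝕜 := ℝ)
  rw [h2]
  exact fderiv_const_apply _

/-- Derivatives of `modeLift j b` computed along a curve given in cylindrical coordinates. -/
theorem fderiv_modeLift_of_curve (j : ℤ) {b : ℝ × ℝ → ℂ} (hb : ContDiff ℝ ∞ b)
    (hbc : HasCompactSupport b) {γ : ℝ → (ℝ × ℝ) × ℝ} {z v : Spacetime} {a : ℂ} (hγ : cyl (γ 0) = z)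
    (hv : HasDerivAt (fun ε => cyl (γ ε)) v 0)
    (ha : HasDerivAt (fun ε => b (γ ε).1 * Complex.exp (Complex.I * j * (γ ε).2)) a 0) :
    fderiv ℝ (modeLift j b) z v = a := by
  have hd : DifferentiableAt ℝ (modeLift j b) (cyl (γ 0)) :=
    ((contDiff_modeLift j hb hbc).differentiable (by simp)) _
  have h1 := hd.hasFDerivAt.comp_hasDerivAt 0 hv
  have h2 : (modeLift j b ∘ fun ε => cyl (γ ε)) =
      fun ε => b (γ ε).1 * Complex.exp (Complex.I * j * (γ ε).2) :=
    funext fun ε => modeLift_cyl j b (γ ε).1 (γ ε).2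
  rw [h2] at h1
  rw [← hγ]
  exact h1.unique ha

theorem hasDerivAt_comp_line {b : ℝ × ℝ → ℂ} (hb : ContDiff ℝ ∞ b) (p v : ℝ × ℝ) :
    HasDerivAt (fun ε : ℝ => b (p + ε • v)) (dirDeriv v b p) 0 := by
  have hd : DifferentiableAt ℝ b (p + (0 : ℝ) • v) := (hb.differentiable (by simp)) _
  have h1 : HasDerivAt (fun ε : ℝ => p + ε • v) v 0 := by
    simpa using ((hasDerivAt_id (0 : ℝ)).smul_const v).const_add p
  have := hd.hasFDerivAt.comp_hasDerivAt 0 h1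
  simpa [dirDeriv] using! this

theorem dT_modeLift (j : ℤ) {b : ℝ × ℝ → ℂ} (hb : ContDiff ℝ ∞ b) (hbc : HasCompactSupport b) :
    dT (modeLift j b) = modeLift j (dirDeriv (1, 0) b) := by
  funext z
  rcases (Real.sqrt_nonneg _ : 0 ≤ rad z).eq_or_lt with hz | hz
  · rw [dT, fderiv_modeLift_of_rad_eq_zero j hbc hz.symm, modeLift_of_rad_eq_zero _ _ hz.symm]
    rfl
  obtain ⟨θ, -, hθ⟩ := exists_cyl_eq hz
  set p : ℝ × ℝ := (z.1, Real.log (rad z)) with hp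
  rw [dT, ← hθ, modeLift_cyl]
  refine fderiv_modeLift_of_curve j hb hbc (γ := fun ε => (p + ε • ((1 : ℝ), (0 : ℝ)), θ))
    (by simp) ?_ ((hasDerivAt_comp_line hb p ((1 : ℝ), (0 : ℝ))).mul_const (Complex.exp (Complex.I * j * θ)))
  have h1 : HasDerivAt (fun ε : ℝ => p.1 + ε) 1 0 := by
    simpa using (hasDerivAt_id (0 : ℝ)).const_add p.1
  have h2 := h1.prodMk (hasDerivAt_const (0 : ℝ)
    ((Real.exp p.2 * Real.cos θ, Real.exp p.2 * Real.sin θ) : ℝ × ℝ))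
  simpa [cyl] using! h2

theorem rdR_modeLift (j : ℤ) {b : ℝ × ℝ → ℂ} (hb : ContDiff ℝ ∞ b) (hbc : HasCompactSupport b) :
    rdR (modeLift j b) = modeLift j (dirDeriv (0, 1) b) := by
  funext z
  rcases (Real.sqrt_nonneg _ : 0 ≤ rad z).eq_or_lt with hz | hz
  · rw [rdR, fderiv_modeLift_of_rad_eq_zero j hbc hz.symm, modeLift_of_rad_eq_zero _ _ hz.symm]
    rfl
  obtain ⟨θ, -, hθ⟩ := exists_cyl_eq hz
  set p : ℝ × ℝ := (z.1, Real.log (rad z)) with hp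
  rw [rdR, ← hθ, modeLift_cyl]
  refine fderiv_modeLift_of_curve j hb hbc (γ := fun ε => (p + ε • ((0 : ℝ), (1 : ℝ)), θ))
    (by simp) ?_ ((hasDerivAt_comp_line hb p ((0 : ℝ), (1 : ℝ))).mul_const (Complex.exp (Complex.I * j * θ)))
  have h1 : HasDerivAt (fun ε : ℝ => Real.exp (p.2 + ε)) (Real.exp p.2) 0 := by
    simpa using ((hasDerivAt_id (0 : ℝ)).const_add p.2).exp
  have h2 := (hasDerivAt_const (0 : ℝ) p.1).prodMk
    ((h1.mul_const (Real.cos θ)).prodMk (h1.mul_const (Real.sin θ)))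
  simpa [cyl] using! h2

theorem dAng_modeLift (j : ℤ) {b : ℝ × ℝ → ℂ} (hb : ContDiff ℝ ∞ b) (hbc : HasCompactSupport b)
    (z : Spacetime) : dAng (modeLift j b) z = Complex.I * j * modeLift j b z := by
  rcases (Real.sqrt_nonneg _ : 0 ≤ rad z).eq_or_lt with hz | hz
  · rw [dAng, fderiv_modeLift_of_rad_eq_zero j hbc hz.symm, modeLift_of_rad_eq_zero _ _ hz.symm]
    simp
  obtain ⟨θ, -, hθ⟩ := exists_cyl_eq hz
  set p : ℝ × ℝ := (z.1, Real.log (rad z)) with hp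
  rw [dAng, ← hθ, modeLift_cyl]
  refine fderiv_modeLift_of_curve j hb hbc (γ := fun ε => (p, θ + ε)) (by simp) ?_ ?_
  · have h0 : HasDerivAt (fun ε : ℝ => θ + ε) 1 0 := by
      simpa using (hasDerivAt_id (0 : ℝ)).const_add θ
    have h1 : HasDerivAt (fun ε : ℝ => Real.cos (θ + ε)) (-Real.sin θ) 0 := by
      simpa using h0.cos
    have h1' : HasDerivAt (fun ε : ℝ => Real.sin (θ + ε)) (Real.cos θ) 0 := by
      simpa using h0.sin
    have h2 := (hasDerivAt_const (0 : ℝ) p.1).prodMk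
      ((h1.const_mul (Real.exp p.2)).prodMk (h1'.const_mul (Real.exp p.2)))
    simpa [cyl] using! h2
  · have h0 : HasDerivAt (fun ε : ℝ => Complex.I * j * ((θ + ε : ℝ) : ℂ)) (Complex.I * j) 0 := by
      have : HasDerivAt (fun ε : ℝ => ((θ + ε : ℝ) : ℂ)) 1 0 := by
        simpa using ((hasDerivAt_id (0 : ℝ)).const_add θ).ofReal_comp
      simpa using this.const_mul (Complex.I * (j : ℂ))
    have h1 := h0.cexp.const_mul (b p)
    refine h1.congr_deriv ?_
    simp
    ring

theorem isTestMode_modeLift (j : ℤ) {b : ℝ × ℝ → ℂ} (hb : ContDiff ℝ ∞ b)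
    (hbc : HasCompactSupport b) : IsTestMode j Set.univ (modeLift j b) :=
  { isTest_modeLift j hb hbc with mode := fun z => dAng_modeLift j hb hbc z }

theorem conj_modeLift (j : ℤ) (b : ℝ × ℝ → ℂ) (z : Spacetime) :
    conj (modeLift j b z) = modeLift (-j) (fun p => conj (b p)) z := by
  rcases (Real.sqrt_nonneg _ : 0 ≤ rad z).eq_or_lt with hz | hz
  · rw [modeLift_of_rad_eq_zero _ _ hz.symm, modeLift_of_rad_eq_zero _ _ hz.symm, map_zero]
  obtain ⟨θ, -, hθ⟩ := exists_cyl_eq hz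
  rw [← hθ, modeLift_cyl, modeLift_cyl, map_mul, ← Complex.exp_conj]
  congr 2
  simp

/-- The transpose of `r² (□_k + m²)` on functions of `(t, s)`, `s = log r`: it acts on the
coefficients of `e^{-i k θ}`, whence the sign of the first order term. -/
def reducedOp (ℓ m : ℝ) (k : ℤ) (b : ℝ × ℝ → ℂ) (p : ℝ × ℝ) : ℂ :=
  ((Real.exp (2 * p.2) - ℓ ^ 2 : ℝ) : ℂ) * dirDeriv (1, 0) (dirDeriv (1, 0) b) p
    - dirDeriv (0, 1) (dirDeriv (0, 1) b) p
    + 2 * Complex.I * ℓ * k * dirDeriv (1, 0) b p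
    + ((k ^ 2 + m ^ 2 * Real.exp (2 * p.2) : ℝ) : ℂ) * b p

theorem dirDeriv_conj (v : ℝ × ℝ) (b : ℝ × ℝ → ℂ) :
    dirDeriv v (fun p => conj (b p)) = fun p => conj (dirDeriv v b p) := by
  funext p
  have := Complex.conjCLE.comp_fderiv (f := b) (x := p)
  rw [dirDeriv, dirDeriv]
  have h2 : (fun p => conj (b p)) = Complex.conjCLE ∘ b := rfl
  rw [h2, this]
  rfl

/-- The conjugate that enters the weak formulation turns `□_k + m²` into its transpose. -/
theorem conj_boxMass_modeLift (ℓ m : ℝ) (k : ℤ) {b : ℝ × ℝ → ℂ} (hb : ContDiff ℝ ∞ b)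
    (hbc : HasCompactSupport b) (z : Spacetime) :
    conj (boxMass ℓ m k (modeLift k fun p => conj (b p)) z) =
      modeLift (-k) (fun p => Real.exp (-(2 * p.2)) • reducedOp ℓ m k b p) z := by
  have hb' : ContDiff ℝ ∞ (fun p => conj (b p)) := Complex.conjCLE.contDiff.comp hb
  have hbc' : HasCompactSupport (fun p => conj (b p)) := hbc.comp_left (map_zero _)
  have h1 := contDiff_dirDeriv hb'
  have h2 := hasCompactSupport_dirDeriv hbc'
  rw [boxMass, dT_modeLift k hb' hbc', dT_modeLift k (h1 _) (h2 _), rdR_modeLift k hb' hbc',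
    rdR_modeLift k (h1 _) (h2 _)]
  simp only [dirDeriv_conj]
  rcases (Real.sqrt_nonneg _ : 0 ≤ rad z).eq_or_lt with hz | hz
  · simp [modeLift_of_rad_eq_zero _ _ hz.symm]
  obtain ⟨θ, -, hθ⟩ := exists_cyl_eq hz
  rw [← hθ]
  simp only [modeLift_cyl, rad_cyl]
  set p : ℝ × ℝ := (z.1, Real.log (rad z)) with hp
  have he : Complex.exp (Complex.I * ((-k : ℤ) : ℂ) * θ) =
      conj (Complex.exp (Complex.I * (k : ℂ) * θ)) := by
    rw [← Complex.exp_conj]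
    simp
  rw [he, reducedOp, Complex.real_smul, Real.exp_neg, mul_comm (2 : ℝ) p.2, Real.exp_mul]
  have hr : (Real.exp p.2 : ℂ) ≠ 0 := by exact_mod_cast (Real.exp_pos p.2).ne'
  simp only [map_add, map_sub, map_mul, map_div₀, map_pow, Complex.conj_ofReal, Complex.conj_I,
    Complex.conj_conj, map_one, map_intCast, map_ofNat, Real.rpow_ofNat]
  push_cast
  field_simp
  ring

/-! ### Angular Fourier coefficients -/

/-- The angular Fourier coefficient `∫ u e^{-i j θ} dθ`, a function of `(t, log r)`. -/
def angCoeff (j : ℤ) (u : Spacetime → ℂ) (p : ℝ × ℝ) : ℂ :=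
  ∫ θ in Set.Ioo (-Real.pi) Real.pi, u (cyl (p, θ)) * Complex.exp (Complex.I * (-j : ℤ) * θ)

/-- Integrating over the angle first reduces pairings with functions of a single mode to the
`(t, s)`-plane. -/
theorem integral_mul_modeLift {u : Spacetime → ℂ} (hu : LocallyIntegrable u) (j : ℤ)
    {b : ℝ × ℝ → ℂ} (hb : Continuous b) (hbc : HasCompactSupport b) :
    ∫ z, u z * modeLift (-j) b z =
      ∫ p : ℝ × ℝ, Real.exp (2 * p.2) • (angCoeff j u p * b p) := by
  have hcont : Continuous (modeLift (-j) b) :=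
    contDiff_zero.1 (contDiff_modeLift (-j) (contDiff_zero.2 hb) hbc)
  have hint : Integrable fun z => u z * modeLift (-j) b z :=
    hu.integrable_smul_right_of_hasCompactSupport hcont (hasCompactSupport_modeLift _ hbc)
  have hint' : Integrable (fun q => u (cyl q) * modeLift (-j) b (cyl q))
      (cylMeasure.prod (volume.restrict (Set.Ioo (-Real.pi) Real.pi))) :=
    measurePreserving_cyl.integrable_comp_of_integrable hint
  have h1 := integral_map measurePreserving_cyl.measurable.aemeasurable
    (f := fun z => u z * modeLift (-j) b z)
    (by rw [measurePreserving_cyl.map_eq]; exact hint.aestronglyMeasurable)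
  rw [measurePreserving_cyl.map_eq] at h1
  rw [h1, integral_prod _ hint', integral_cylMeasure]
  refine integral_congr_ae (ae_of_all _ fun p => ?_)
  simp only [angCoeff]
  rw [← integral_mul_const]
  congr 1
  refine integral_congr_ae (ae_of_all _ fun θ => ?_)
  simp only [modeLift_cyl]
  ring

/-- The weight `(1 + |t|)^M (1 + e^s)^M`. -/
def cylWeight (M : ℕ) (p : ℝ × ℝ) : ℝ := (1 + |p.1|) ^ M * (1 + Real.exp p.2) ^ M

theorem cylWeight_pos (M : ℕ) (p : ℝ × ℝ) : 0 < cylWeight M p := by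
  unfold cylWeight
  positivity

theorem continuous_cylWeight (M : ℕ) : Continuous (cylWeight M) := by
  unfold cylWeight
  fun_prop

theorem one_add_norm_cyl_pow_le (M : ℕ) (p : ℝ × ℝ) (θ : ℝ) :
    (1 + ‖cyl (p, θ)‖) ^ M ≤ cylWeight M p := by
  have h : ‖cyl (p, θ)‖ ≤ |p.1| + Real.exp p.2 := by
    simp only [cyl, Prod.norm_def, Real.norm_eq_abs]
    have he := Real.exp_pos p.2
    have h0 := abs_nonneg p.1
    refine max_le (by linarith) (max_le ?_ ?_)
    · rw [abs_mul, abs_of_pos he]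
      have := Real.abs_cos_le_one θ
      nlinarith
    · rw [abs_mul, abs_of_pos he]
      have := Real.abs_sin_le_one θ
      nlinarith
  rw [cylWeight, ← mul_pow]
  refine pow_le_pow_left₀ (by positivity) ?_ M
  have := mul_nonneg (abs_nonneg p.1) (Real.exp_pos p.2).le
  linarith

/-- A function of `(t, s)` that is integrable for the measure `e^{2 s} dt ds` after division by
the weight `cylWeight M`. -/
def IsTemperedOnPlane (M : ℕ) (c : ℝ × ℝ → ℂ) : Prop :=
  Integrable fun p : ℝ × ℝ => ((cylWeight M p)⁻¹ * Real.exp (2 * p.2)) • c p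

theorem IsTemperedOnPlane.locallyIntegrable {M : ℕ} {c : ℝ × ℝ → ℂ}
    (hc : IsTemperedOnPlane M c) : LocallyIntegrable c := by
  have h1 : LocallyIntegrable fun p : ℝ × ℝ =>
      (cylWeight M p * (Real.exp (2 * p.2))⁻¹) •
        (((cylWeight M p)⁻¹ * Real.exp (2 * p.2)) • c p) := by
    refine locallyIntegrableOn_univ.1 (LocallyIntegrableOn.continuousOn_smul
      isOpen_univ.isLocallyClosed ((Integrable.locallyIntegrable hc).locallyIntegrableOn _) ?_)
    refine ((continuous_cylWeight M).mul (Continuous.inv₀ (by fun_prop) ?_)).continuousOn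
    exact fun p => (Real.exp_pos _).ne'
  refine h1.congr (ae_of_all _ fun p => ?_)
  have := (cylWeight_pos M p).ne'
  have := (Real.exp_pos (2 * p.2)).ne'
  simp only
  rw [smul_smul]
  have e : cylWeight M p * (Real.exp (2 * p.2))⁻¹ * ((cylWeight M p)⁻¹ * Real.exp (2 * p.2)) = 1 := by
    field_simp
  rw [e, one_smul]

theorem aestronglyMeasurable_of_tempered {k : ℤ} {u : Spacetime → ℂ} (hu : IsTemperedL2Mode k u) :
    AEStronglyMeasurable u := by
  obtain ⟨N, hN⟩ := hu.memLp
  have h1 : AEStronglyMeasurable (fun z : Spacetime => (((1 + ‖z‖) ^ N : ℝ) : ℂ)) :=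
    (by fun_prop : Continuous fun z : Spacetime => (((1 + ‖z‖) ^ N : ℝ) : ℂ)).aestronglyMeasurable
  refine (h1.mul hN.aestronglyMeasurable).congr (ae_of_all _ fun z => ?_)
  have h0 : (((1 + ‖z‖) ^ N : ℝ) : ℂ) ≠ 0 := by
    exact_mod_cast (by positivity : (0 : ℝ) < (1 + ‖z‖) ^ N).ne'
  simp only [Pi.mul_apply]
  rw [← mul_assoc, Complex.ofReal_inv, mul_inv_cancel₀ h0, one_mul]

/-- Tempered square integrable functions are integrable against a larger power weight. -/
theorem exists_integrable_weight_of_tempered {k : ℤ} {u : Spacetime → ℂ}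
    (hu : IsTemperedL2Mode k u) :
    ∃ M : ℕ, Integrable fun z => (((1 + ‖z‖) ^ M)⁻¹ : ℝ) • u z := by
  obtain ⟨N, hN⟩ := hu.memLp
  -- In dimension three `(1 + ‖z‖)^{-4}` is square integrable.
  refine ⟨N + 4, ?_⟩
  have h2 : MemLp (fun z : Spacetime => ((((1 + ‖z‖) ^ 4)⁻¹ : ℝ) : ℂ)) 2 := by
    have hc : Continuous fun z : Spacetime => ((((1 + ‖z‖) ^ 4)⁻¹ : ℝ) : ℂ) := by
      refine Complex.continuous_ofReal.comp (Continuous.inv₀ (by fun_prop) fun z => ?_)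
      positivity
    rw [memLp_two_iff_integrable_sq_norm hc.aestronglyMeasurable]
    have : (volume : Measure (ℝ × ℝ)).IsAddHaarMeasure :=
      Measure.prod.instIsAddHaarMeasure volume volume
    have : (volume : Measure Spacetime).IsAddHaarMeasure :=
      Measure.prod.instIsAddHaarMeasure volume volume
    have h3 := integrable_one_add_norm (E := Spacetime) (μ := volume) (r := 8)
      (by simp [Spacetime]; norm_num)
    refine h3.congr (ae_of_all _ fun z => ?_)
    have h0 : (0 : ℝ) < 1 + ‖z‖ := by positivity
    simp only [Complex.norm_real]
    rw [Real.norm_of_nonneg (by positivity), Real.rpow_neg h0.le, ← inv_pow, ← pow_mul,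
      inv_pow]
    norm_cast
  have h3 := MemLp.integrable_mul h2 hN
  refine h3.congr (ae_of_all _ fun z => ?_)
  simp only [Pi.mul_apply, Complex.real_smul, pow_add, mul_inv]
  push_cast
  ring

theorem locallyIntegrable_of_integrable_weight {u : Spacetime → ℂ} {M : ℕ}
    (hu : Integrable fun z => (((1 + ‖z‖) ^ M)⁻¹ : ℝ) • u z) : LocallyIntegrable u := by
  have h1 : LocallyIntegrable fun z : Spacetime =>
      ((1 + ‖z‖) ^ M : ℝ) • ((((1 + ‖z‖) ^ M)⁻¹ : ℝ) • u z) :=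
    locallyIntegrableOn_univ.1 (LocallyIntegrableOn.continuousOn_smul
      isOpen_univ.isLocallyClosed (hu.locallyIntegrable.locallyIntegrableOn _)
        (by fun_prop))
  refine h1.congr (ae_of_all _ fun z => ?_)
  have : ((1 + ‖z‖) ^ M : ℝ) ≠ 0 := by positivity
  simp only
  rw [smul_smul, mul_inv_cancel₀ this, one_smul]

theorem isTemperedOnPlane_angCoeff {u : Spacetime → ℂ} {M : ℕ} (hum : AEStronglyMeasurable u)
    (hu : Integrable fun z => (((1 + ‖z‖) ^ M)⁻¹ : ℝ) • u z) (j : ℤ) :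
    IsTemperedOnPlane M (angCoeff j u) := by
  have h1 := measurePreserving_cyl.integrable_comp_of_integrable hu
  have hum' := hum.comp_measurePreserving measurePreserving_cyl
  have h2 : Integrable (fun q : (ℝ × ℝ) × ℝ => (cylWeight M q.1)⁻¹ •
      (u (cyl q) * Complex.exp (Complex.I * (-j : ℤ) * q.2)))
      (cylMeasure.prod (volume.restrict (Set.Ioo (-Real.pi) Real.pi))) := by
    refine h1.mono ?_ (ae_of_all _ fun q => ?_)
    · have c1 : Continuous fun q : (ℝ × ℝ) × ℝ => (cylWeight M q.1)⁻¹ :=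
        ((continuous_cylWeight M).comp continuous_fst).inv₀ fun q => (cylWeight_pos M q.1).ne'
      have c2 : Continuous fun q : (ℝ × ℝ) × ℝ =>
        Complex.exp (Complex.I * (-j : ℤ) * q.2) := by fun_prop
      exact c1.aestronglyMeasurable.smul (hum'.mul c2.aestronglyMeasurable)
    · have e : ‖Complex.exp (Complex.I * ((-j : ℤ) : ℂ) * q.2)‖ = 1 := by
        have := Complex.norm_exp_ofReal_mul_I ((-j : ℤ) * q.2 : ℝ)
        rw [← this]
        congr 2
        push_cast
        ring
      simp only [Function.comp]
      rw [norm_smul, norm_smul, norm_mul, e, mul_one,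
        Real.norm_of_nonneg (inv_nonneg.2 (cylWeight_pos M q.1).le),
        Real.norm_of_nonneg (by positivity)]
      gcongr
      exact one_add_norm_cyl_pow_le M q.1 q.2
  have h3 := integrable_cylMeasure_iff.1 h2.integral_prod_left
  refine h3.congr (ae_of_all _ fun p => ?_)
  simp only
  rw [integral_smul, smul_smul, mul_comm]
  rfl

/-- The angular Fourier coefficients of a function of mode `k` vanish except for the `k`-th. -/
theorem angCoeff_ae_eq_zero {u : Spacetime → ℂ} (hu : LocallyIntegrable u) {M : ℕ} {j k : ℤ}
    (hmode : IsMode k u) (hjk : j ≠ k) (hc : IsTemperedOnPlane M (angCoeff j u)) :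
    ∀ᵐ p, angCoeff j u p = 0 := by
  refine ae_eq_zero_of_integral_contDiff_smul_eq_zero hc.locallyIntegrable fun g hg hgc => ?_
  -- The factor `e^{-2 s}` cancels the density of the cylindrical measure.
  set b : ℝ × ℝ → ℂ := fun p => ((Real.exp (-(2 * p.2)) * g p : ℝ) : ℂ) with hb
  have hbs : ContDiff ℝ ∞ b :=
    Complex.ofRealCLM.contDiff.comp ((by fun_prop : ContDiff ℝ ∞ fun p : ℝ × ℝ =>
      Real.exp (-(2 * p.2))).mul hg)
  have hbc : HasCompactSupport b := by
    have : HasCompactSupport fun p : ℝ × ℝ => Real.exp (-(2 * p.2)) * g p := hgc.mul_left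
    exact this.comp_left Complex.ofReal_zero
  have h1 := hmode _ (isTest_modeLift (-j) hbs hbc)
  simp only [dAng_modeLift (-j) hbs hbc] at h1
  have h2 : ∀ z, u z * (Complex.I * ((-j : ℤ) : ℂ) * modeLift (-j) b z +
      Complex.I * k * modeLift (-j) b z) =
        (Complex.I * ((k : ℂ) - j)) * (u z * modeLift (-j) b z) := fun z => by
    push_cast
    ring
  simp only [h2] at h1
  rw [integral_const_mul, integral_mul_modeLift hu j hbs.continuous hbc, mul_eq_zero] at h1
  rcases h1 with h1 | h1
  · exfalso
    rw [mul_eq_zero, sub_eq_zero] at h1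
    rcases h1 with h1 | h1
    · exact Complex.I_ne_zero h1
    · exact hjk (by exact_mod_cast h1.symm)
  · rw [← h1]
    refine integral_congr_ae (ae_of_all _ fun p => ?_)
    simp only [hb, Complex.real_smul]
    rw [Real.exp_neg]
    have : (Real.exp (2 * p.2) : ℂ) ≠ 0 := by exact_mod_cast (Real.exp_pos _).ne'
    push_cast
    field_simp

/-- A square integrable function on `(-π, π)` with vanishing Fourier coefficients vanishes. -/
theorem ae_eq_zero_of_fourier_coeff_eq_zero {f : ℝ → ℂ}
    (hf : MemLp f 2 (volume.restrict (Set.Ioo (-Real.pi) Real.pi)))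
    (h : ∀ j : ℤ, ∫ θ in Set.Ioo (-Real.pi) Real.pi,
      f θ * Complex.exp (Complex.I * (-j : ℤ) * θ) = 0) :
    ∀ᵐ θ ∂volume.restrict (Set.Ioo (-Real.pi) Real.pi), f θ = 0 := by
  have hlt : -Real.pi < Real.pi := by linarith [Real.pi_pos]
  rw [restrict_Ioo_eq_restrict_Ioc] at hf h ⊢
  have h1 := hasSum_sq_fourierCoeffOn hlt hf
  have h2 : ∀ j, fourierCoeffOn hlt f j = 0 := fun j => by
    rw [fourierCoeffOn_eq_integral, intervalIntegral.integral_of_le hlt.le]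
    rw [← h j]
    have : ∀ θ : ℝ, (fourier (-j) (θ : AddCircle (Real.pi - -Real.pi))) • f θ =
        f θ * Complex.exp (Complex.I * (-j : ℤ) * θ) := fun θ => by
      rw [fourier_coe_apply, smul_eq_mul, mul_comm]
      congr 2
      have : (Real.pi : ℂ) ≠ 0 := by exact_mod_cast Real.pi_ne_zero
      push_cast
      field_simp
      ring
    simp only [this, h j, smul_zero]
  simp only [h2, norm_zero, ne_eq, OfNat.ofNat_ne_zero, not_false_eq_true, zero_pow] at h1
  have h3 := h1.unique hasSum_zero
  have h4 : ∫ x in (-Real.pi)..Real.pi, ‖f x‖ ^ 2 = 0 := by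
    rcases smul_eq_zero.1 h3 with h | h
    · have : (0 : ℝ) < (Real.pi - -Real.pi)⁻¹ := inv_pos.2 (by linarith)
      exact absurd h this.ne'
    · exact h
  rw [intervalIntegral.integral_of_le hlt.le, integral_eq_zero_iff_of_nonneg
    (fun x => by positivity) hf.integrable_norm_pow'] at h4
  filter_upwards [h4] with x hx
  simpa using hx

theorem memLp_section_of_tempered {k : ℤ} {u : Spacetime → ℂ} (hu : IsTemperedL2Mode k u) :
    ∀ᵐ p : ℝ × ℝ, MemLp (fun θ => u (cyl (p, θ))) 2
      (volume.restrict (Set.Ioo (-Real.pi) Real.pi)) := by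
  have hum' := (aestronglyMeasurable_of_tempered hu).comp_measurePreserving measurePreserving_cyl
  obtain ⟨N, hN⟩ := hu.memLp
  have h1 := hN.comp_measurePreserving measurePreserving_cyl
  have h2 := (memLp_two_iff_integrable_sq_norm h1.aestronglyMeasurable).1 h1
  rw [← ae_cylMeasure_iff]
  filter_upwards [h2.prod_right_ae, hum'.prodMk_left, h1.aestronglyMeasurable.prodMk_left]
    with p hp hpm hpm1
  have h3 := (memLp_two_iff_integrable_sq_norm hpm1).2 hp
  refine MemLp.of_le_mul (c := cylWeight N p) h3 hpm (ae_of_all _ fun θ => ?_)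
  simp only [Function.comp]
  have h0 : (0 : ℝ) < (1 + ‖cyl (p, θ)‖) ^ N := by positivity
  rw [norm_mul, Complex.norm_real, Real.norm_of_nonneg (by positivity), ← mul_assoc]
  refine le_mul_of_one_le_left (norm_nonneg _) ?_
  rw [← div_eq_mul_inv, one_le_div h0]
  exact one_add_norm_cyl_pow_le N p θ

/-- A function of mode `k` vanishes where its `k`-th angular Fourier coefficient does. -/
theorem ae_eq_zero_of_angCoeff_eq_zero {k : ℤ} {u : Spacetime → ℂ} (hu : IsTemperedL2Mode k u)
    {A : Set (ℝ × ℝ)} (hA : MeasurableSet A) (h : ∀ᵐ p, p ∈ A → angCoeff k u p = 0) :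
    ∀ᵐ z, (z.1, Real.log (rad z)) ∈ A → u z = 0 := by
  have hum := aestronglyMeasurable_of_tempered hu
  obtain ⟨M, hM⟩ := exists_integrable_weight_of_tempered hu
  have hul := locallyIntegrable_of_integrable_weight hM
  have hall : ∀ᵐ p, ∀ j, p ∈ A → angCoeff j u p = 0 := by
    refine ae_all_iff.2 fun j => ?_
    by_cases hj : j = k
    · rw [hj]
      exact h
    · filter_upwards [angCoeff_ae_eq_zero hul hu.mode hj (isTemperedOnPlane_angCoeff hum hM j)]
        with p hp _
      exact hp
  have hsec : ∀ᵐ p ∂cylMeasure, ∀ᵐ θ ∂volume.restrict (Set.Ioo (-Real.pi) Real.pi),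
      p ∈ A → u (cyl (p, θ)) = 0 := by
    rw [ae_cylMeasure_iff]
    filter_upwards [hall, memLp_section_of_tempered hu] with p hp hp2
    by_cases hpA : p ∈ A
    · filter_upwards [ae_eq_zero_of_fourier_coeff_eq_zero hp2 fun j => hp j hpA] with θ hθ _
      exact hθ
    · exact ae_of_all _ fun θ hcon => absurd hcon hpA
  obtain ⟨u', hu'm, hu'⟩ := hum
  have hmeas : MeasurableSet {z : Spacetime | (z.1, Real.log (rad z)) ∈ A → u' z = 0} := by
    have h1 : MeasurableSet {z : Spacetime | (z.1, Real.log (rad z)) ∈ A} := by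
      have : Measurable fun z : Spacetime => (z.1, Real.log (rad z)) :=
        measurable_fst.prodMk (Real.measurable_log.comp continuous_rad.measurable)
      exact this hA
    have h2 : MeasurableSet {z : Spacetime | u' z = 0} :=
      hu'm.measurable (measurableSet_singleton 0)
    exact h1.imp h2
  have hpull : ∀ᵐ q ∂cylMeasure.prod (volume.restrict (Set.Ioo (-Real.pi) Real.pi)),
      u (cyl q) = u' (cyl q) := measurePreserving_cyl.quasiMeasurePreserving.ae hu'
  have hset : ∀ᵐ z, (z.1, Real.log (rad z)) ∈ A → u' z = 0 := by
    rw [← measurePreserving_cyl.map_eq,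
      ae_map_iff measurePreserving_cyl.measurable.aemeasurable hmeas]
    refine (Measure.ae_prod_iff_ae_ae (measurePreserving_cyl.measurable hmeas)).2 ?_
    filter_upwards [hsec, Measure.ae_ae_of_ae_prod hpull] with p h1 h2
    filter_upwards [h1, h2] with θ h3 h4 hA'
    rw [rad_cyl, Real.log_exp] at hA'
    rw [← h4]
    exact h3 hA'
  filter_upwards [hu', hset] with z h1 h2 hz
  rw [h1, h2 hz]

theorem angCoeff_ae_eq_zero_of_ae_eq_zero {u : Spacetime → ℂ} (j : ℤ) {A : Set (ℝ × ℝ)}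
    (h : ∀ᵐ z, (z.1, Real.log (rad z)) ∈ A → u z = 0) : ∀ᵐ p, p ∈ A → angCoeff j u p = 0 := by
  have hpull := measurePreserving_cyl.quasiMeasurePreserving.ae h
  rw [← ae_cylMeasure_iff]
  filter_upwards [Measure.ae_ae_of_ae_prod hpull] with p hp hpA
  rw [angCoeff]
  refine integral_eq_zero_of_ae ?_
  filter_upwards [hp] with θ hθ
  rw [rad_cyl, Real.log_exp] at hθ
  simp [hθ hpA]

theorem ae_eq_zero_off_essSupp (u : Spacetime → ℂ) : ∀ᵐ z, z ∉ essSupp u → u z = 0 := by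
  have h : volume {z | ¬(z ∉ essSupp u → u z = 0)} = 0 := by
    refine measure_null_of_locally_null _ fun z hz => ?_
    have hz1 : z ∉ essSupp u := by
      by_contra hcon
      exact hz fun h => absurd hcon h
    simp only [essSupp, Set.mem_ofPred_eq, not_forall, not_not] at hz1
    obtain ⟨U, hU, hzU, hUu⟩ := hz1
    refine ⟨{w | ¬(w ∉ essSupp u → u w = 0)} ∩ U,
      Filter.inter_mem self_mem_nhdsWithin (mem_nhdsWithin_of_mem_nhds (hU.mem_nhds hzU)), ?_⟩
    rw [Filter.EventuallyEq, ae_restrict_iff' hU.measurableSet] at hUu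
    refine measure_mono_null (fun w hw => ?_) hUu
    intro hcon
    exact hw.1 fun _ => hcon hw.2
  exact h

theorem IsCompactL2Mode.isTemperedL2Mode {k : ℤ} {u : Spacetime → ℂ} (hu : IsCompactL2Mode k u) :
    IsTemperedL2Mode k u where
  memLp := ⟨0, by simpa using hu.memLp⟩
  mode := hu.mode

/-- The weak form of `L c = κ δ_q` on `ℝ_t × A`, where `L = r² (□_k + m²)` in the variables
`(t, s)` and `reducedOp` is its transpose. -/
def IsReducedSol (ℓ m : ℝ) (k : ℤ) (A : Set ℝ) (κ : ℂ) (q : ℝ × ℝ) (c : ℝ × ℝ → ℂ) : Prop :=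
  ∀ b : ℝ × ℝ → ℂ, ContDiff ℝ ∞ b → HasCompactSupport b → (∀ p ∈ tsupport b, p.2 ∈ A) →
    ∫ p, c p * reducedOp ℓ m k b p = κ * b q

theorem contDiff_reducedOp (ℓ m : ℝ) (k : ℤ) {b : ℝ × ℝ → ℂ} (hb : ContDiff ℝ ∞ b) :
    ContDiff ℝ ∞ (reducedOp ℓ m k b) := by
  have h1 := contDiff_dirDeriv hb (1, 0)
  have h2 := contDiff_dirDeriv h1 (1, 0)
  have h3 := contDiff_dirDeriv (contDiff_dirDeriv hb (0, 1)) (0, 1)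
  have hA : ContDiff ℝ ∞ fun p : ℝ × ℝ => ((Real.exp (2 * p.2) - ℓ ^ 2 : ℝ) : ℂ) :=
    Complex.ofRealCLM.contDiff.comp
      (by fun_prop : ContDiff ℝ ∞ fun p : ℝ × ℝ => Real.exp (2 * p.2) - ℓ ^ 2)
  have hC : ContDiff ℝ ∞ fun p : ℝ × ℝ => ((k ^ 2 + m ^ 2 * Real.exp (2 * p.2) : ℝ) : ℂ) :=
    Complex.ofRealCLM.contDiff.comp
      (by fun_prop : ContDiff ℝ ∞ fun p : ℝ × ℝ => (k : ℝ) ^ 2 + m ^ 2 * Real.exp (2 * p.2))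
  exact (((hA.mul h2).sub h3).add (contDiff_const.mul h1)).add (hC.mul hb)

theorem reducedOp_eq_zero (ℓ m : ℝ) (k : ℤ) {b : ℝ × ℝ → ℂ} {p : ℝ × ℝ} (hp : p ∉ tsupport b) :
    reducedOp ℓ m k b p = 0 := by
  have h : ∀ v, p ∉ tsupport (dirDeriv v b) := fun v hv => hp (tsupport_dirDeriv_subset v b hv)
  have h2 : ∀ v w, p ∉ tsupport (dirDeriv v (dirDeriv w b)) := fun v w hv =>
    h w (tsupport_dirDeriv_subset v _ hv)
  rw [reducedOp, image_eq_zero_of_notMem_tsupport hp, image_eq_zero_of_notMem_tsupport (h _),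
    image_eq_zero_of_notMem_tsupport (h2 _ _), image_eq_zero_of_notMem_tsupport (h2 _ _)]
  simp

/-- Passage from spacetime to the `(t, s)`-plane. -/
theorem isReducedSol_of_boxMass {ℓ m : ℝ} {k : ℤ} {A : Set ℝ} {u : Spacetime → ℂ}
    (hu : LocallyIntegrable u) {κ : ℂ} {q : ℝ × ℝ}
    (h : ∀ b : ℝ × ℝ → ℂ, ContDiff ℝ ∞ b → HasCompactSupport b → (∀ p ∈ tsupport b, p.2 ∈ A) →
      ∫ z, u z * conj (boxMass ℓ m k (modeLift k fun p => conj (b p)) z) = κ * b q) :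
    IsReducedSol ℓ m k A κ q (angCoeff k u) := by
  intro b hb hbc hbA
  rw [← h b hb hbc hbA]
  rw [integral_congr_ae (ae_of_all _ fun z =>
    congrArg (u z * ·) (conj_boxMass_modeLift ℓ m k hb hbc z))]
  have hc : Continuous fun p : ℝ × ℝ => Real.exp (-(2 * p.2)) • reducedOp ℓ m k b p :=
    (by fun_prop : Continuous fun p : ℝ × ℝ => Real.exp (-(2 * p.2))).smul
      (contDiff_reducedOp ℓ m k hb).continuous
  have hs : HasCompactSupport fun p : ℝ × ℝ => Real.exp (-(2 * p.2)) • reducedOp ℓ m k b p :=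
    HasCompactSupport.intro hbc.isCompact fun p hp => by
      rw [reducedOp_eq_zero ℓ m k hp, smul_zero]
  rw [integral_mul_modeLift hu k hc hs]
  refine integral_congr_ae (ae_of_all _ fun p => ?_)
  have : (Real.exp (2 * p.2) : ℂ) ≠ 0 := by exact_mod_cast (Real.exp_pos _).ne'
  simp only [Complex.real_smul]
  rw [Real.exp_neg]
  push_cast
  field_simp

/-! ### Separation of variables -/

/-- The pairing in `t` of a function `c(t, s)` with `g(t)`. -/
def slice (c : ℝ × ℝ → ℂ) (g : ℝ → ℂ) (s : ℝ) : ℂ := ∫ t, c (t, s) * g t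

/-- `g` is continuous and, on `E`, bounded by a multiple of `(1 + |t|)^{-M}`. -/
structure DecaysOn (M : ℕ) (E : Set ℝ) (g : ℝ → ℂ) : Prop where
  continuous : Continuous g
  bound : ∃ C, ∀ t ∈ E, ‖g t‖ * (1 + |t|) ^ M ≤ C

/-- `c(t, s)` is tempered and vanishes for `t` outside `E`. -/
structure IsTemperedOn (M : ℕ) (E : Set ℝ) (c : ℝ × ℝ → ℂ) : Prop where
  tempered : IsTemperedOnPlane M c
  support : ∀ᵐ p : ℝ × ℝ, p.1 ∉ E → c p = 0

variable {M : ℕ} {E : Set ℝ} {c : ℝ × ℝ → ℂ}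

/-- The weight `e^{2 s} (1 + e^s)^{-M}` in the variable `s = log r`. -/
def radialWeight (M : ℕ) (s : ℝ) : ℝ := Real.exp (2 * s) / (1 + Real.exp s) ^ M

theorem radialWeight_pos (M : ℕ) (s : ℝ) : 0 < radialWeight M s := by
  unfold radialWeight
  positivity

theorem continuous_radialWeight (M : ℕ) : Continuous (radialWeight M) := by
  unfold radialWeight
  refine Continuous.div (by fun_prop) (by fun_prop) fun s => ?_
  positivity

theorem IsTemperedOn.aestronglyMeasurable (hc : IsTemperedOn M E c) : AEStronglyMeasurable c :=
  hc.tempered.locallyIntegrable.aestronglyMeasurable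

/-- The basic majorant: `|c(t, s)| (1 + |t|)^{-M} e^{2 s} (1 + e^s)^{-M}` is integrable. -/
theorem IsTemperedOn.integrable_norm (hc : IsTemperedOn M E c) :
    Integrable fun p : ℝ × ℝ => ‖c p‖ * ((1 + |p.1|) ^ M)⁻¹ * radialWeight M p.2 := by
  refine hc.tempered.norm.congr (ae_of_all _ fun p => ?_)
  simp only
  rw [norm_smul, Real.norm_of_nonneg (by have := cylWeight_pos M p; positivity), cylWeight,
    radialWeight, mul_inv]
  ring

theorem IsTemperedOn.norm_mul_le (hc : IsTemperedOn M E c) {g : ℝ → ℂ} {C : ℝ}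
    (hg : ∀ t ∈ E, ‖g t‖ * (1 + |t|) ^ M ≤ C) :
    ∀ᵐ p : ℝ × ℝ, ‖c p * g p.1‖ ≤ C * (‖c p‖ * ((1 + |p.1|) ^ M)⁻¹) := by
  filter_upwards [hc.support] with p hp
  by_cases hpE : p.1 ∈ E
  · have h0 : (0 : ℝ) < (1 + |p.1|) ^ M := by positivity
    have h1 : ‖g p.1‖ ≤ C * ((1 + |p.1|) ^ M)⁻¹ := by
      rw [← div_eq_mul_inv, le_div_iff₀ h0]
      exact hg _ hpE
    rw [norm_mul]
    calc ‖c p‖ * ‖g p.1‖ ≤ ‖c p‖ * (C * ((1 + |p.1|) ^ M)⁻¹) := by gcongr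
      _ = _ := by ring
  · simp [hp hpE]

theorem IsTemperedOn.integrable_radialWeight (hc : IsTemperedOn M E c) {g : ℝ → ℂ}
    (hg : DecaysOn M E g) :
    Integrable fun p : ℝ × ℝ => radialWeight M p.2 • (c p * g p.1) := by
  obtain ⟨C, hC⟩ := hg.bound
  refine Integrable.mono' (hc.integrable_norm.const_mul C) ?_ ?_
  · exact ((continuous_radialWeight M).comp continuous_snd).aestronglyMeasurable.smul
      (hc.aestronglyMeasurable.mul (hg.continuous.comp continuous_fst).aestronglyMeasurable)
  · filter_upwards [hc.norm_mul_le hC] with p hp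
    rw [norm_smul, Real.norm_of_nonneg (radialWeight_pos M _).le]
    calc radialWeight M p.2 * ‖c p * g p.1‖
        ≤ radialWeight M p.2 * (C * (‖c p‖ * ((1 + |p.1|) ^ M)⁻¹)) :=
          mul_le_mul_of_nonneg_left hp (radialWeight_pos M _).le
      _ = _ := by ring

theorem IsTemperedOn.ae_integrable (hc : IsTemperedOn M E c) {g : ℝ → ℂ}
    (hg : DecaysOn M E g) : ∀ᵐ s, Integrable fun t => c (t, s) * g t := by
  filter_upwards [(hc.integrable_radialWeight hg).prod_left_ae] with s hs
  have := hs.smul (radialWeight M s)⁻¹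
  refine this.congr (ae_of_all _ fun t => ?_)
  simp only [Pi.smul_apply]
  rw [smul_smul, inv_mul_cancel₀ (radialWeight_pos M s).ne', one_smul]

theorem IsTemperedOn.integrable_slice (hc : IsTemperedOn M E c) {g : ℝ → ℂ}
    (hg : DecaysOn M E g) : Integrable fun s => radialWeight M s • slice c g s := by
  refine (hc.integrable_radialWeight hg).integral_prod_right.congr (ae_of_all _ fun s => ?_)
  simp only [integral_smul, slice]

theorem locallyIntegrable_of_radialWeight {F : Type*} [NormedAddCommGroup F] [NormedSpace ℝ F]
    {f : ℝ → F} (hf : Integrable fun s => radialWeight M s • f s) : LocallyIntegrable f := by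
  have h1 : LocallyIntegrable fun s => (radialWeight M s)⁻¹ • (radialWeight M s • f s) := by
    refine locallyIntegrableOn_univ.1 (LocallyIntegrableOn.continuousOn_smul
      isOpen_univ.isLocallyClosed (hf.locallyIntegrable.locallyIntegrableOn _) ?_)
    exact ((continuous_radialWeight M).inv₀ fun s => (radialWeight_pos M s).ne').continuousOn
  refine h1.congr (ae_of_all _ fun s => ?_)
  simp only
  rw [smul_smul, inv_mul_cancel₀ (radialWeight_pos M s).ne', one_smul]

theorem IsTemperedOn.locallyIntegrable_slice (hc : IsTemperedOn M E c) {g : ℝ → ℂ}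
    (hg : DecaysOn M E g) : LocallyIntegrable (slice c g) :=
  locallyIntegrable_of_radialWeight (hc.integrable_slice hg)

theorem IsTemperedOn.integrable_integral_norm (hc : IsTemperedOn M E c) {g : ℝ → ℂ}
    (hg : DecaysOn M E g) :
    Integrable fun s => radialWeight M s • ∫ t, ‖c (t, s) * g t‖ := by
  refine (hc.integrable_radialWeight hg).norm.integral_prod_right.congr (ae_of_all _ fun s => ?_)
  simp only
  rw [← integral_smul]
  refine integral_congr_ae (ae_of_all _ fun t => ?_)
  simp only
  rw [norm_smul, Real.norm_of_nonneg (radialWeight_pos M s).le, smul_eq_mul]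

theorem IsTemperedOn.integrable_mul_prod (hc : IsTemperedOn M E c) {g H : ℝ → ℂ}
    (hg : DecaysOn M E g) (hH : Continuous H) (hHc : HasCompactSupport H) :
    Integrable fun p : ℝ × ℝ => c p * (g p.1 * H p.2) := by
  have hK : Continuous fun s => ((radialWeight M s)⁻¹ : ℂ) * H s := by
    refine Continuous.mul (Continuous.inv₀ (Complex.continuous_ofReal.comp
      (continuous_radialWeight M)) fun s => ?_) hH
    exact_mod_cast (radialWeight_pos M s).ne'
  have hKc : HasCompactSupport fun s => ((radialWeight M s)⁻¹ : ℂ) * H s := hHc.mul_left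
  obtain ⟨B, hB⟩ := hK.bounded_above_of_compact_support hKc
  have h1 := (hc.integrable_radialWeight hg).bdd_mul (c := B)
    (f := fun p : ℝ × ℝ => ((radialWeight M p.2)⁻¹ : ℂ) * H p.2)
    (hK.comp continuous_snd).aestronglyMeasurable (ae_of_all _ fun p => hB p.2)
  refine h1.congr (ae_of_all _ fun p => ?_)
  have : (radialWeight M p.2 : ℂ) ≠ 0 := by exact_mod_cast (radialWeight_pos M p.2).ne'
  simp only [Complex.real_smul]
  field_simp

theorem IsTemperedOn.integral_mul_prod (hc : IsTemperedOn M E c) {g H : ℝ → ℂ}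
    (hg : DecaysOn M E g) (hH : Continuous H) (hHc : HasCompactSupport H) :
    ∫ p : ℝ × ℝ, c p * (g p.1 * H p.2) = ∫ s, H s * slice c g s := by
  rw [Measure.volume_eq_prod, integral_prod_symm _ (hc.integrable_mul_prod hg hH hHc)]
  refine integral_congr_ae (ae_of_all _ fun s => ?_)
  simp only [slice]
  rw [← integral_const_mul]
  refine integral_congr_ae (ae_of_all _ fun t => ?_)
  simp only
  ring

theorem IsTemperedOn.tendsto_integral_mul_prod (hc : IsTemperedOn M E c) {g H : ℝ → ℂ}
    {G : ℕ → ℝ → ℂ} {C : ℝ} (hG : ∀ n, Continuous (G n))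
    (hGC : ∀ n, ∀ t ∈ E, ‖G n t‖ * (1 + |t|) ^ M ≤ C)
    (hlim : ∀ t, Filter.Tendsto (fun n => G n t) Filter.atTop (nhds (g t)))
    (hH : Continuous H) (hHc : HasCompactSupport H) :
    Filter.Tendsto (fun n => ∫ p : ℝ × ℝ, c p * (G n p.1 * H p.2)) Filter.atTop
      (nhds (∫ p : ℝ × ℝ, c p * (g p.1 * H p.2))) := by
  have hK : Continuous fun s => ((radialWeight M s)⁻¹ : ℂ) * H s := by
    refine Continuous.mul (Continuous.inv₀ (Complex.continuous_ofReal.comp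
      (continuous_radialWeight M)) fun s => ?_) hH
    exact_mod_cast (radialWeight_pos M s).ne'
  have hKc : HasCompactSupport fun s => ((radialWeight M s)⁻¹ : ℂ) * H s := hHc.mul_left
  obtain ⟨B, hB⟩ := hK.bounded_above_of_compact_support hKc
  refine tendsto_integral_of_dominated_convergence
    (fun p => B * C * (‖c p‖ * ((1 + |p.1|) ^ M)⁻¹ * radialWeight M p.2)) (fun n => ?_)
    (hc.integrable_norm.const_mul _) (fun n => ?_) (ae_of_all _ fun p => ?_)
  · exact hc.aestronglyMeasurable.mul (((hG n).comp continuous_fst).mul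
      (hH.comp continuous_snd)).aestronglyMeasurable
  · filter_upwards [hc.norm_mul_le (hGC n)] with p hp
    have h1 := hB p.2
    have h0 := radialWeight_pos M p.2
    have h2 : ‖H p.2‖ ≤ B * radialWeight M p.2 := by
      rw [norm_mul, norm_inv, Complex.norm_real, Real.norm_of_nonneg h0.le, inv_mul_le_iff₀ h0]
        at h1
      linarith
    rw [← mul_assoc, norm_mul]
    calc ‖c p * G n p.1‖ * ‖H p.2‖
        ≤ (C * (‖c p‖ * ((1 + |p.1|) ^ M)⁻¹)) * (B * radialWeight M p.2) :=
          mul_le_mul hp h2 (norm_nonneg _) ((norm_nonneg _).trans hp)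
      _ = _ := by ring
  · exact ((hlim p.1).mul_const _).const_mul _

theorem dirDeriv_prod {G : ℝ → ℂ} {h : ℝ → ℝ} (hG : ContDiff ℝ ∞ G) (hh : ContDiff ℝ ∞ h) :
    dirDeriv (1, 0) (fun p : ℝ × ℝ => G p.1 * (h p.2 : ℂ)) =
      (fun p : ℝ × ℝ => deriv G p.1 * (h p.2 : ℂ)) ∧
    dirDeriv (0, 1) (fun p : ℝ × ℝ => G p.1 * (h p.2 : ℂ)) =
      (fun p : ℝ × ℝ => G p.1 * ((deriv h p.2 : ℝ) : ℂ)) := by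
  have hb : ContDiff ℝ ∞ (fun p : ℝ × ℝ => G p.1 * (h p.2 : ℂ)) :=
    (hG.comp contDiff_fst).mul (Complex.ofRealCLM.contDiff.comp (hh.comp contDiff_snd))
  have hline : ∀ x : ℝ, HasDerivAt (fun ε : ℝ => x + ε) 1 0 := fun x => by
    simpa using (hasDerivAt_id (0 : ℝ)).const_add x
  constructor
  · funext p
    refine (hasDerivAt_comp_line hb p (1, 0)).unique ?_
    have h1 : HasDerivAt G (deriv G p.1) (p.1 + 0) := by
      rw [add_zero]
      exact (hG.differentiable (by simp) _).hasDerivAt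
    have h2 := (h1.scomp (0 : ℝ) (hline p.1)).mul_const (h p.2 : ℂ)
    simpa [Function.comp_def] using! h2
  · funext p
    refine (hasDerivAt_comp_line hb p (0, 1)).unique ?_
    have h1 : HasDerivAt h (deriv h p.2) (p.2 + 0) := by
      rw [add_zero]
      exact (hh.differentiable (by simp) _).hasDerivAt
    have h2 := ((h1.comp (0 : ℝ) (hline p.2)).ofReal_comp).const_mul (G p.1)
    simpa [Function.comp_def] using! h2

theorem contDiff_deriv {G : ℝ → ℂ} (hG : ContDiff ℝ ∞ G) : ContDiff ℝ ∞ (deriv G) :=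
  (contDiff_infty_iff_deriv.1 hG).2

theorem reducedOp_prod (ℓ m : ℝ) (k : ℤ) {G : ℝ → ℂ} {h : ℝ → ℝ} (hG : ContDiff ℝ ∞ G)
    (hh : ContDiff ℝ ∞ h) (p : ℝ × ℝ) :
    reducedOp ℓ m k (fun p : ℝ × ℝ => G p.1 * (h p.2 : ℂ)) p =
      deriv (deriv G) p.1 * ((h p.2 * (Real.exp (2 * p.2) - ℓ ^ 2) : ℝ) : ℂ)
      - G p.1 * ((deriv (deriv h) p.2 : ℝ) : ℂ)
      + deriv G p.1 * (2 * Complex.I * ℓ * k * h p.2)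
      + G p.1 * ((h p.2 * (k ^ 2 + m ^ 2 * Real.exp (2 * p.2)) : ℝ) : ℂ) := by
  have hG' := contDiff_deriv hG
  have hh' : ContDiff ℝ ∞ (deriv h) := (contDiff_infty_iff_deriv.1 hh).2
  rw [reducedOp, (dirDeriv_prod hG hh).1, (dirDeriv_prod hG hh).2, (dirDeriv_prod hG' hh).1,
    (dirDeriv_prod hG hh').2]
  push_cast
  ring

/-- A smooth cutoff on the line with its first two derivatives bounded. -/
theorem exists_cutoff : ∃ (θ : ℝ → ℝ) (B : ℝ), ContDiff ℝ ∞ θ ∧ HasCompactSupport θ ∧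
    (∀ t ∈ Set.Ioo (-1 : ℝ) 1, θ t = 1) ∧
    (∀ t, |θ t| ≤ B) ∧ (∀ t, |deriv θ t| ≤ B) ∧ ∀ t, |deriv (deriv θ) t| ≤ B := by
  let f : ContDiffBump (0 : ℝ) := ⟨1, 2, by norm_num, by norm_num⟩
  have h0 : ContDiff ℝ ∞ f := f.contDiff
  have h1 : ContDiff ℝ ∞ (deriv f) := (contDiff_infty_iff_deriv.1 h0).2
  have h2 : ContDiff ℝ ∞ (deriv (deriv f)) := (contDiff_infty_iff_deriv.1 h1).2
  obtain ⟨B0, hB0⟩ := h0.continuous.bounded_above_of_compact_support f.hasCompactSupport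
  obtain ⟨B1, hB1⟩ := h1.continuous.bounded_above_of_compact_support f.hasCompactSupport.deriv
  obtain ⟨B2, hB2⟩ := h2.continuous.bounded_above_of_compact_support
    f.hasCompactSupport.deriv.deriv
  refine ⟨f, max B0 (max B1 B2), h0, f.hasCompactSupport, fun t ht => ?_, fun t => ?_,
    fun t => ?_, fun t => ?_⟩
  · refine f.one_of_mem_closedBall ?_
    rw [Metric.mem_closedBall, Real.dist_eq, sub_zero]
    exact (abs_lt.2 ⟨by linarith [ht.1], ht.2⟩).le
  · exact (hB0 t).trans (le_max_left _ _)
  · exact (hB1 t).trans ((le_max_left _ _).trans (le_max_right _ _))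
  · exact (hB2 t).trans ((le_max_right _ _).trans (le_max_right _ _))

/-- Separation of variables: pairing a weak solution `c(t, s)` of the reduced equation with
`g(t)` gives a weak solution of a differential equation in `s`.  Since `g` need not have compact
support, it is approximated by cutting it off; the growth of `c` is compensated by the decay of `g`
and its derivatives. -/
theorem IsReducedSol.weak_ode {ℓ m : ℝ} {k : ℤ} {A : Set ℝ} {κ : ℂ} {q : ℝ × ℝ}
    (hsol : IsReducedSol ℓ m k A κ q c) (hc : IsTemperedOn M E c) {g g₁ g₂ : ℝ → ℂ}
    (hgs : ContDiff ℝ ∞ g) (hg1 : ∀ t, HasDerivAt g (g₁ t) t) (hg2 : ∀ t, HasDerivAt g₁ (g₂ t) t)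
    (hd : DecaysOn M E g) (hd1 : DecaysOn M E g₁) (hd2 : DecaysOn M E g₂)
    {h : ℝ → ℝ} (hh : IsLineTest A h) :
    ∫ s, deriv (deriv h) s • slice c g s =
      (∫ s, h s • (((Real.exp (2 * s) - ℓ ^ 2 : ℝ) : ℂ) * slice c g₂ s
        + 2 * Complex.I * ℓ * k * slice c g₁ s
        + ((k ^ 2 + m ^ 2 * Real.exp (2 * s) : ℝ) : ℂ) * slice c g s))
      - h q.2 • (κ * g q.1) := by
  obtain ⟨θ, B, hθ, hθc, hθ1, hB0, hB1, hB2⟩ := exists_cutoff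
  obtain ⟨C0, hC0⟩ := hd.bound
  obtain ⟨C1, hC1⟩ := hd1.bound
  obtain ⟨C2, hC2⟩ := hd2.bound
  have hθ' : ContDiff ℝ ∞ (deriv θ) := (contDiff_infty_iff_deriv.1 hθ).2
  have hBnn : 0 ≤ B := (abs_nonneg _).trans (hB0 0)
  -- The cutoffs `θ(t / (n + 1))`, with the factor `a = 1 / (n + 1)`.
  set a : ℕ → ℝ := fun n => 1 / ((n : ℝ) + 1) with ha
  have ha0 : ∀ n, 0 < a n := fun n => by simp only [ha]; positivity
  have ha1 : ∀ n, a n ≤ 1 := fun n => by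
    simp only [ha]
    rw [div_le_one (by positivity)]
    linarith [(Nat.cast_nonneg n : (0 : ℝ) ≤ n)]
  have halim : Filter.Tendsto a Filter.atTop (nhds 0) := tendsto_one_div_add_atTop_nhds_zero_nat
  have hat : ∀ t, ∀ᶠ n in Filter.atTop, a n * t ∈ Set.Ioo (-1 : ℝ) 1 := fun t => by
    have h1 : Filter.Tendsto (fun n => a n * t) Filter.atTop (nhds (0 * t)) := halim.mul_const t
    rw [zero_mul] at h1
    exact h1.eventually (Ioo_mem_nhds (by norm_num) (by norm_num))
  set G : ℕ → ℝ → ℂ := fun n t => (θ (a n * t) : ℂ) * g t with hG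
  set G₁ : ℕ → ℝ → ℂ := fun n t =>
    ((a n * deriv θ (a n * t) : ℝ) : ℂ) * g t + (θ (a n * t) : ℂ) * g₁ t with hG₁
  set G₂ : ℕ → ℝ → ℂ := fun n t =>
    ((a n * (a n * deriv (deriv θ) (a n * t)) : ℝ) : ℂ) * g t +
      2 * (((a n * deriv θ (a n * t) : ℝ) : ℂ) * g₁ t) + (θ (a n * t) : ℂ) * g₂ t with hG₂
  have hscale : ∀ n t, HasDerivAt (fun t => a n * t) (a n) t := fun n t => by
    simpa using (hasDerivAt_id t).const_mul (a n)
  have hθd : ∀ n t, HasDerivAt (fun t => (θ (a n * t) : ℂ))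
      ((a n * deriv θ (a n * t) : ℝ) : ℂ) t := fun n t => by
    have h1 : HasDerivAt θ (deriv θ (a n * t)) (a n * t) :=
      (hθ.differentiable (by simp) _).hasDerivAt
    have h2 := (h1.comp t (hscale n t)).ofReal_comp
    rw [mul_comm] at h2
    exact h2
  have hθd' : ∀ n t, HasDerivAt (fun t => ((a n * deriv θ (a n * t) : ℝ) : ℂ))
      ((a n * (a n * deriv (deriv θ) (a n * t)) : ℝ) : ℂ) t := fun n t => by
    have h1 : HasDerivAt (deriv θ) (deriv (deriv θ) (a n * t)) (a n * t) :=
      (hθ'.differentiable (by simp) _).hasDerivAt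
    have h2 := ((h1.comp t (hscale n t)).const_mul (a n)).ofReal_comp
    rw [mul_comm (deriv (deriv θ) (a n * t))] at h2
    exact h2
  have hGd : ∀ n t, HasDerivAt (G n) (G₁ n t) t := fun n t => (hθd n t).mul (hg1 t)
  have hGd1 : ∀ n t, HasDerivAt (G₁ n) (G₂ n t) t := fun n t => by
    refine (((hθd' n t).mul (hg1 t)).add ((hθd n t).mul (hg2 t))).congr_deriv ?_
    simp only [hG₂]
    ring
  have hGs : ∀ n, ContDiff ℝ ∞ (G n) := fun n => by
    refine ContDiff.mul ?_ hgs
    exact Complex.ofRealCLM.contDiff.comp (hθ.comp (contDiff_const.mul contDiff_id))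
  have hGc : ∀ n, HasCompactSupport (G n) := fun n => by
    have h1 : HasCompactSupport fun t => θ (a n * t) :=
      hθc.comp_homeomorph (Homeomorph.mulLeft₀ (a n) (ha0 n).ne')
    have h2 : HasCompactSupport fun t => (θ (a n * t) : ℂ) := h1.comp_left Complex.ofReal_zero
    exact h2.mul_right
  have eG1 : ∀ n, deriv (G n) = G₁ n := fun n => funext fun t => (hGd n t).deriv
  have eG2 : ∀ n, deriv (G₁ n) = G₂ n := fun n => funext fun t => (hGd1 n t).deriv
  have hG1c : ∀ n, Continuous (G₁ n) := fun n => by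
    rw [← eG1 n]
    exact (contDiff_deriv (hGs n)).continuous
  have hG2c : ∀ n, Continuous (G₂ n) := fun n => by
    rw [← eG2 n, ← eG1 n]
    exact (contDiff_deriv (contDiff_deriv (hGs n))).continuous
  -- Uniform bounds and pointwise convergence.
  have hsc : ∀ (r : ℝ) (z : ℂ) (t : ℝ) (D : ℝ), |r| ≤ B → ‖z‖ * (1 + |t|) ^ M ≤ D →
      ‖(r : ℂ) * z‖ * (1 + |t|) ^ M ≤ B * D := fun r z t D hr hz => by
    rw [norm_mul, Complex.norm_real, Real.norm_eq_abs, mul_assoc]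
    exact mul_le_mul hr hz (by positivity) hBnn
  have hab1 : ∀ n t, |a n * deriv θ (a n * t)| ≤ B := fun n t => by
    rw [abs_mul, abs_of_pos (ha0 n)]
    calc a n * |deriv θ (a n * t)| ≤ 1 * B :=
          mul_le_mul (ha1 n) (hB1 _) (abs_nonneg _) zero_le_one
      _ = B := one_mul B
  have hab2 : ∀ n t, |a n * (a n * deriv (deriv θ) (a n * t))| ≤ B := fun n t => by
    rw [abs_mul, abs_mul, abs_of_pos (ha0 n)]
    have h1 : a n * |deriv (deriv θ) (a n * t)| ≤ 1 * B :=
      mul_le_mul (ha1 n) (hB2 _) (abs_nonneg _) zero_le_one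
    calc a n * (a n * |deriv (deriv θ) (a n * t)|) ≤ 1 * (1 * B) :=
          mul_le_mul (ha1 n) h1 (mul_nonneg (ha0 n).le (abs_nonneg _)) zero_le_one
      _ = B := by ring
  have bG : ∀ n, ∀ t ∈ E, ‖G n t‖ * (1 + |t|) ^ M ≤ B * C0 := fun n t ht =>
    hsc _ _ t C0 (hB0 _) (hC0 t ht)
  have bG1 : ∀ n, ∀ t ∈ E, ‖G₁ n t‖ * (1 + |t|) ^ M ≤ B * C0 + B * C1 := fun n t ht => by
    refine (mul_le_mul_of_nonneg_right (norm_add_le _ _) (by positivity)).trans ?_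
    rw [add_mul]
    exact add_le_add (hsc _ _ t C0 (hab1 n t) (hC0 t ht)) (hsc _ _ t C1 (hB0 _) (hC1 t ht))
  have bG2 : ∀ n, ∀ t ∈ E, ‖G₂ n t‖ * (1 + |t|) ^ M ≤ B * C0 + 2 * (B * C1) + B * C2 :=
    fun n t ht => by
    refine (mul_le_mul_of_nonneg_right ((norm_add_le _ _).trans
      (add_le_add_left (norm_add_le _ _) _)) (by positivity)).trans ?_
    rw [add_mul, add_mul, norm_mul 2, Complex.norm_ofNat, mul_assoc 2]
    have e1 := hsc _ _ t C0 (hab2 n t) (hC0 t ht)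
    have e2 := hsc _ _ t C1 (hab1 n t) (hC1 t ht)
    have e3 := hsc _ _ t C2 (hB0 (a n * t)) (hC2 t ht)
    linarith
  have lθ : ∀ t, Filter.Tendsto (fun n => (θ (a n * t) : ℂ)) Filter.atTop (nhds 1) := fun t => by
    refine tendsto_const_nhds.congr' ?_
    filter_upwards [hat t] with n hn
    rw [hθ1 _ hn, Complex.ofReal_one]
  have l1 : ∀ t, Filter.Tendsto (fun n => ((a n * deriv θ (a n * t) : ℝ) : ℂ)) Filter.atTop
      (nhds 0) := fun t => by
    have : Filter.Tendsto (fun n => a n * deriv θ (a n * t)) Filter.atTop (nhds 0) := by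
      have hb : Filter.Tendsto (fun n => a n * B) Filter.atTop (nhds 0) := by
        simpa using halim.mul_const B
      refine squeeze_zero_norm (fun n => ?_) hb
      rw [norm_mul, Real.norm_of_nonneg (ha0 n).le]
      exact mul_le_mul_of_nonneg_left (hB1 _) (ha0 n).le
    have h0 := (Complex.continuous_ofReal.tendsto 0).comp this
    rw [Complex.ofReal_zero] at h0
    exact h0
  have l2 : ∀ t, Filter.Tendsto (fun n => ((a n * (a n * deriv (deriv θ) (a n * t)) : ℝ) : ℂ))
      Filter.atTop (nhds 0) := fun t => by
    have : Filter.Tendsto (fun n => a n * (a n * deriv (deriv θ) (a n * t))) Filter.atTop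
        (nhds 0) := by
      have hb : Filter.Tendsto (fun n => a n * (1 * B)) Filter.atTop (nhds 0) := by
        simpa using halim.mul_const B
      refine squeeze_zero_norm (fun n => ?_) hb
      rw [norm_mul, norm_mul, Real.norm_of_nonneg (ha0 n).le]
      exact mul_le_mul_of_nonneg_left
        (mul_le_mul (ha1 n) (hB2 _) (norm_nonneg _) zero_le_one) (ha0 n).le
    have h0 := (Complex.continuous_ofReal.tendsto 0).comp this
    rw [Complex.ofReal_zero] at h0
    exact h0
  have lG : ∀ t, Filter.Tendsto (fun n => G n t) Filter.atTop (nhds (g t)) := fun t => by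
    have h0 := (lθ t).mul_const (g t)
    rw [one_mul] at h0
    exact h0
  have lG1 : ∀ t, Filter.Tendsto (fun n => G₁ n t) Filter.atTop (nhds (g₁ t)) := fun t => by
    have h0 := ((l1 t).mul_const (g t)).add ((lθ t).mul_const (g₁ t))
    rw [zero_mul, one_mul, zero_add] at h0
    exact h0
  have lG2 : ∀ t, Filter.Tendsto (fun n => G₂ n t) Filter.atTop (nhds (g₂ t)) := fun t => by
    have h0 := (((l2 t).mul_const (g t)).add (((l1 t).mul_const (g₁ t)).const_mul 2)).add
      ((lθ t).mul_const (g₂ t))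
    rw [zero_mul, zero_mul, mul_zero, one_mul, zero_add, zero_add] at h0
    exact h0
  -- The four coefficient functions of `s`.
  clear_value G G₁ G₂ a
  have hhc : Continuous h := hh.smooth.continuous
  have hhs : ∀ f : ℝ → ℝ, HasCompactSupport fun s => ((h s * f s : ℝ) : ℂ) := fun f => by
    refine hh.compact.mono fun s hs h0 => hs ?_
    simp only [h0, zero_mul, Complex.ofReal_zero]
  have c0 : Continuous fun s => (h s : ℂ) := Complex.continuous_ofReal.comp hhc
  have c1 : Continuous fun s => ((h s * (Real.exp (2 * s) - ℓ ^ 2) : ℝ) : ℂ) :=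
    Complex.continuous_ofReal.comp (by fun_prop)
  have s1 : HasCompactSupport fun s => ((h s * (Real.exp (2 * s) - ℓ ^ 2) : ℝ) : ℂ) := hhs _
  have c2 : Continuous fun s => ((deriv (deriv h) s : ℝ) : ℂ) :=
    Complex.continuous_ofReal.comp hh.deriv.deriv.smooth.continuous
  have s2 : HasCompactSupport fun s => ((deriv (deriv h) s : ℝ) : ℂ) :=
    hh.deriv.deriv.compact.mono fun s hs h0 => hs (by simp only [h0, Complex.ofReal_zero])
  have c4 : Continuous fun s => ((h s * (k ^ 2 + m ^ 2 * Real.exp (2 * s)) : ℝ) : ℂ) :=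
    Complex.continuous_ofReal.comp (by fun_prop)
  have s4 : HasCompactSupport fun s =>
      ((h s * (k ^ 2 + m ^ 2 * Real.exp (2 * s)) : ℝ) : ℂ) := hhs _
  have c3 : Continuous fun s => 2 * Complex.I * ℓ * k * (h s : ℂ) := continuous_const.mul c0
  have s3 : HasCompactSupport fun s => 2 * Complex.I * ℓ * k * (h s : ℂ) :=
    hh.compact.mono fun s hs h0 => hs (by simp only [h0, Complex.ofReal_zero, mul_zero])
  have dG : ∀ n, DecaysOn M E (G n) := fun n => ⟨(hGs n).continuous, _, bG n⟩
  have dG1 : ∀ n, DecaysOn M E (G₁ n) := fun n => ⟨hG1c n, _, bG1 n⟩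
  have dG2 : ∀ n, DecaysOn M E (G₂ n) := fun n => ⟨hG2c n, _, bG2 n⟩
  have heq : ∀ n,
      (∫ p : ℝ × ℝ, c p * (G₂ n p.1 * ((h p.2 * (Real.exp (2 * p.2) - ℓ ^ 2) : ℝ) : ℂ)))
      - (∫ p : ℝ × ℝ, c p * (G n p.1 * ((deriv (deriv h) p.2 : ℝ) : ℂ)))
      + (∫ p : ℝ × ℝ, c p * (G₁ n p.1 * (2 * Complex.I * ℓ * k * (h p.2 : ℂ))))
      + (∫ p : ℝ × ℝ, c p * (G n p.1 * ((h p.2 * (k ^ 2 + m ^ 2 * Real.exp (2 * p.2)) : ℝ) : ℂ)))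
      = κ * (G n q.1 * (h q.2 : ℂ)) := fun n => by
    have hsupp : ∀ p : ℝ × ℝ, p ∈ tsupport (fun p : ℝ × ℝ => G n p.1 * (h p.2 : ℂ)) →
        p.1 ∈ tsupport (G n) ∧ p.2 ∈ tsupport h := fun p hp => by
      have hcl : IsClosed {p : ℝ × ℝ | p.1 ∈ tsupport (G n) ∧ p.2 ∈ tsupport h} :=
        ((isClosed_tsupport _).preimage continuous_fst).inter
          ((isClosed_tsupport _).preimage continuous_snd)
      refine closure_minimal (fun p hp => ?_) hcl hp
      exact ⟨subset_tsupport _ (left_ne_zero_of_mul hp), subset_tsupport _ fun h0 =>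
        right_ne_zero_of_mul hp (by rw [h0, Complex.ofReal_zero])⟩
    rw [← hsol (fun p : ℝ × ℝ => G n p.1 * (h p.2 : ℂ))
      (((hGs n).comp contDiff_fst).mul
        (Complex.ofRealCLM.contDiff.comp (hh.smooth.comp contDiff_snd)))
      (((hGc n).isCompact.prod hh.compact.isCompact).of_isClosed_subset (isClosed_tsupport _)
        fun p hp => hsupp p hp)
      (fun p hp => hh.supp (hsupp p hp).2)]
    have j1 := hc.integrable_mul_prod (dG2 n) c1 s1
    have j2 := hc.integrable_mul_prod (dG n) c2 s2
    have j3 := hc.integrable_mul_prod (dG1 n) c3 s3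
    have j4 := hc.integrable_mul_prod (dG n) c4 s4
    rw [← integral_sub' j1 j2, ← integral_add' (j1.sub j2) j3,
      ← integral_add' ((j1.sub j2).add j3) j4]
    refine integral_congr_ae (ae_of_all _ fun p => ?_)
    simp only [Pi.add_apply, Pi.sub_apply]
    rw [reducedOp_prod ℓ m k (hGs n) hh.smooth, eG1, eG2]
    ring
  have t1 := hc.tendsto_integral_mul_prod (g := g₂) (G := G₂) hG2c bG2 lG2 c1 s1
  have t2 := hc.tendsto_integral_mul_prod (g := g) (G := G) (fun n => (hGs n).continuous) bG lG
    c2 s2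
  have t3 := hc.tendsto_integral_mul_prod (g := g₁) (G := G₁) hG1c bG1 lG1 c3 s3
  have t4 := hc.tendsto_integral_mul_prod (g := g) (G := G) (fun n => (hGs n).continuous) bG lG
    c4 s4
  have L := ((t1.sub t2).add t3).add t4
  have L2 := ((lG q.1).mul_const (h q.2 : ℂ)).const_mul κ
  -- Pass to the limit in the weak equation.
  have hfinal := tendsto_nhds_unique (L.congr heq) L2
  rw [hc.integral_mul_prod hd2 c1 s1, hc.integral_mul_prod hd c2 s2, hc.integral_mul_prod hd1 c3 s3,
    hc.integral_mul_prod hd c4 s4] at hfinal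
  have i1 : Integrable fun s => ((h s * (Real.exp (2 * s) - ℓ ^ 2) : ℝ) : ℂ) * slice c g₂ s :=
    (hc.locallyIntegrable_slice hd2).integrable_smul_left_of_hasCompactSupport c1 s1
  have i3 : Integrable fun s => (2 * Complex.I * ℓ * k * (h s : ℂ)) * slice c g₁ s :=
    (hc.locallyIntegrable_slice hd1).integrable_smul_left_of_hasCompactSupport c3 s3
  have i4 : Integrable fun s =>
      ((h s * (k ^ 2 + m ^ 2 * Real.exp (2 * s)) : ℝ) : ℂ) * slice c g s :=
    (hc.locallyIntegrable_slice hd).integrable_smul_left_of_hasCompactSupport c4 s4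
  have hsum : ∫ s, h s • (((Real.exp (2 * s) - ℓ ^ 2 : ℝ) : ℂ) * slice c g₂ s
        + 2 * Complex.I * ℓ * k * slice c g₁ s
        + ((k ^ 2 + m ^ 2 * Real.exp (2 * s) : ℝ) : ℂ) * slice c g s) =
      (∫ s, ((h s * (Real.exp (2 * s) - ℓ ^ 2) : ℝ) : ℂ) * slice c g₂ s) +
      (∫ s, (2 * Complex.I * ℓ * k * (h s : ℂ)) * slice c g₁ s) +
      ∫ s, ((h s * (k ^ 2 + m ^ 2 * Real.exp (2 * s)) : ℝ) : ℂ) * slice c g s := by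
    rw [← integral_add' i1 i3, ← integral_add' (i1.add i3) i4]
    refine integral_congr_ae (ae_of_all _ fun s => ?_)
    simp only [Pi.add_apply, Complex.real_smul]
    push_cast
    ring
  rw [hsum]
  simp only [Complex.real_smul]
  linear_combination -hfinal

/-! ### Modal equations and vanishing of slices -/


theorem slice_const_mul (c : ℝ × ℝ → ℂ) (a : ℂ) (g : ℝ → ℂ) (s : ℝ) :
    slice c (fun t => a * g t) s = a * slice c g s := by
  rw [slice, slice, ← integral_const_mul]
  refine integral_congr_ae (ae_of_all _ fun t => ?_)
  simp only
  ring

theorem DecaysOn.const_mul {g : ℝ → ℂ} (hg : DecaysOn M E g) (a : ℂ) :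
    DecaysOn M E fun t => a * g t := by
  obtain ⟨C, hC⟩ := hg.bound
  refine ⟨continuous_const.mul hg.continuous, ‖a‖ * C, fun t ht => ?_⟩
  rw [norm_mul, mul_assoc]
  exact mul_le_mul_of_nonneg_left (hC t ht) (norm_nonneg _)

/-- The coefficient of the equation `v'' = Q v` satisfied by `v(s) = ∫ c(t, s) e^{μ t} dt`. -/
def modalCoeff (ℓ m : ℝ) (k : ℤ) (μ : ℂ) (s : ℝ) : ℂ :=
  ((Real.exp (2 * s) - ℓ ^ 2 : ℝ) : ℂ) * μ ^ 2 + 2 * Complex.I * ℓ * k * μ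
    + ((k ^ 2 + m ^ 2 * Real.exp (2 * s) : ℝ) : ℂ)

theorem continuous_modalCoeff (ℓ m : ℝ) (k : ℤ) (μ : ℂ) : Continuous (modalCoeff ℓ m k μ) := by
  unfold modalCoeff
  refine ((Continuous.mul ?_ continuous_const).add continuous_const).add ?_
  · exact Complex.continuous_ofReal.comp (by fun_prop)
  · exact Complex.continuous_ofReal.comp (by fun_prop)

/-- Pairing with an exponential `g(t) = e^{μ t}` turns the reduced equation into an ordinary
differential equation. -/
theorem IsReducedSol.weak_ode_exp {ℓ m : ℝ} {k : ℤ} {A : Set ℝ} {κ : ℂ} {q : ℝ × ℝ}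
    (hsol : IsReducedSol ℓ m k A κ q c) (hc : IsTemperedOn M E c) (μ : ℂ)
    (hd : DecaysOn M E fun t : ℝ => Complex.exp (μ * t)) {h : ℝ → ℝ} (hh : IsLineTest A h) :
    ∫ s, deriv (deriv h) s • slice c (fun t : ℝ => Complex.exp (μ * t)) s =
      (∫ s, h s • (modalCoeff ℓ m k μ s * slice c (fun t : ℝ => Complex.exp (μ * t)) s))
      - h q.2 • (κ * Complex.exp (μ * q.1)) := by
  have hg : ∀ t : ℝ, HasDerivAt (fun t : ℝ => Complex.exp (μ * t))
      (μ * Complex.exp (μ * t)) t := fun t => by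
    have h1 : HasDerivAt (fun z : ℂ => Complex.exp (μ * z)) (μ * Complex.exp (μ * t)) (t : ℂ) := by
      have := ((hasDerivAt_id (t : ℂ)).const_mul μ).cexp
      simpa [mul_comm] using! this
    exact h1.comp_ofReal
  have hs : ContDiff ℝ ∞ fun t : ℝ => Complex.exp (μ * t) :=
    (contDiff_const.mul Complex.ofRealCLM.contDiff).cexp
  have h1 := hsol.weak_ode hc hs hg (fun t => (hg t).const_mul μ) hd (hd.const_mul μ)
    ((hd.const_mul μ).const_mul μ) hh
  rw [h1]
  congr 1
  refine integral_congr_ae (ae_of_all _ fun s => ?_)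
  simp only [slice_const_mul]
  congr 1
  rw [modalCoeff]
  ring

/-- Unique continuation from the left for weak solutions of `v'' = Q v`. -/
theorem ae_eq_zero_of_weak_ode_of_ae_eq_zero_left {S s₀ : ℝ} {v Q : ℝ → ℂ}
    (hv : LocallyIntegrable v) (hQ : Continuous Q)
    (h : ∀ ρ, IsLineTest (Set.Iio S) ρ →
      ∫ s, deriv (deriv ρ) s • v s = ∫ s, ρ s • (Q s * v s))
    (h0 : ∀ᵐ s, s < s₀ → v s = 0) : ∀ᵐ s, s < S → v s = 0 := by
  obtain ⟨y, y₁, hy, hy₁, hvy⟩ := exists_hasDerivAt_of_weak_ode hv hQ h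
  have hU : IsOpen (Set.Iio (min s₀ S)) := isOpen_Iio
  have hae : y =ᵐ[volume.restrict (Set.Iio (min s₀ S))] 0 := by
    rw [Filter.EventuallyEq, ae_restrict_iff' measurableSet_Iio]
    filter_upwards [h0, hvy] with s h1 h2 hs
    rw [← h2 (lt_of_lt_of_le hs (min_le_right _ _)), h1 (lt_of_lt_of_le hs (min_le_left _ _))]
    rfl
  have hEq := Measure.eqOn_open_of_ae_eq hae hU
    (fun s hs => (hy s (lt_of_lt_of_le hs (min_le_right _ _))).continuousAt.continuousWithinAt)
    continuousOn_const
  filter_upwards [hvy] with s hs hsS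
  rw [hs hsS]
  exact eq_zero_of_ode_of_eq_zero_left hQ hy hy₁ (fun s hs => hEq hs) hsS

theorem ae_ae_of_ae_plane {p : ℝ × ℝ → Prop} (h : ∀ᵐ x, p x) : ∀ᵐ s, ∀ᵐ t, p (t, s) := by
  have h1 : ∀ᵐ x : ℝ × ℝ ∂(volume.prod volume), p x.swap :=
    (Measure.measurePreserving_swap (μ := volume) (ν := volume)).quasiMeasurePreserving.ae h
  exact Measure.ae_ae_of_ae_prod h1

theorem ae_eq_zero_of_ae_ae_eq_zero (hcm : AEStronglyMeasurable c) {A : Set ℝ}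
    (hA : MeasurableSet A) (h : ∀ᵐ s, s ∈ A → ∀ᵐ t, c (t, s) = 0) :
    ∀ᵐ p : ℝ × ℝ, p.2 ∈ A → c p = 0 := by
  obtain ⟨c', hc'm, hc'⟩ := hcm
  have hmeas : MeasurableSet {p : ℝ × ℝ | p.2 ∈ A → c' p = 0} :=
    (measurable_snd hA).imp (hc'm.measurable (measurableSet_singleton 0))
  have h1 : ∀ᵐ s, ∀ᵐ t, s ∈ A → c' (t, s) = 0 := by
    filter_upwards [h, ae_ae_of_ae_plane hc'] with s hs hs'
    by_cases hsA : s ∈ A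
    · filter_upwards [hs hsA, hs'] with t h1 h2 _
      rw [← h2, h1]
    · exact ae_of_all _ fun t hcon => absurd hcon hsA
  have h2 : ∀ᵐ p : ℝ × ℝ ∂(volume.prod volume), p.2 ∈ A → c' p = 0 :=
    (Measure.ae_prod_iff_ae_ae hmeas).2 ((Measure.ae_ae_comm (p := fun t s => s ∈ A → c' (t, s) = 0)
      hmeas).2 h1)
  filter_upwards [hc', h2] with p h3 h4 hp
  rw [h3, h4 hp]

open scoped FourierTransform in
theorem fourier_mul_eq_slice (c : ℝ × ℝ → ℂ) (g : ℝ → ℂ) (s τ : ℝ) :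
    𝓕 (fun t => c (t, s) * g t) τ =
      slice c (fun t : ℝ => g t * Complex.exp (-(2 * Real.pi * τ * Complex.I) * t)) s := by
  rw [Real.fourier_real_eq_integral_exp_smul, slice]
  refine integral_congr_ae (ae_of_all _ fun t => ?_)
  simp only [smul_eq_mul]
  rw [show ((-2 * Real.pi * t * τ : ℝ) : ℂ) * Complex.I = -(2 * Real.pi * τ * Complex.I) * t by
    push_cast; ring]
  ring

open scoped FourierTransform in
/-- A function of `(t, s)` vanishes if its weighted Fourier transforms in `t` do. -/
theorem ae_eq_zero_of_slice_eq_zero (hcm : AEStronglyMeasurable c) {g : ℝ → ℂ}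
    (hg : ∀ t, g t ≠ 0) {A : Set ℝ} (hA : MeasurableSet A)
    (hi : ∀ᵐ s, Integrable fun t => c (t, s) * g t)
    (h : ∀ τ : ℝ, ∀ᵐ s, s ∈ A →
      slice c (fun t : ℝ => g t * Complex.exp (-(2 * Real.pi * τ * Complex.I) * t)) s = 0) :
    ∀ᵐ p : ℝ × ℝ, p.2 ∈ A → c p = 0 := by
  have h1 : ∀ᵐ s, s ∈ A → ∀ τ, ‖𝓕 (fun t => c (t, s) * g t) τ‖ ≤ 0 := by
    refine ae_forall_fourier_le (B := fun _ _ => 0) ?_ (fun _ => continuous_const) fun τ => ?_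
    · filter_upwards [hi] with s hs _
      exact hs
    · filter_upwards [h τ] with s hs hsA
      rw [fourier_mul_eq_slice, hs hsA, norm_zero]
  refine ae_eq_zero_of_ae_ae_eq_zero hcm hA ?_
  filter_upwards [hi, h1] with s his hs hsA
  filter_upwards [ae_eq_zero_of_fourier_eq_zero his fun τ => norm_le_zero_iff.1 (hs hsA τ)]
    with t ht
  exact (mul_eq_zero.1 ht).resolve_right (hg t)

theorem one_add_abs_pow_le (M : ℕ) (t : ℝ) :
    (1 + |t|) ^ M ≤ M.factorial * Real.exp (1 + |t|) := by
  have h := Real.pow_div_factorial_le_exp (1 + |t|) (by positivity) M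
  rwa [div_le_iff₀' (by positivity)] at h

theorem IsReducedSol.mono {ℓ m : ℝ} {k : ℤ} {A : Set ℝ} {κ : ℂ} {q : ℝ × ℝ}
    (hsol : IsReducedSol ℓ m k Set.univ κ q c) : IsReducedSol ℓ m k A κ q c :=
  fun b hb hbc _ => hsol b hb hbc fun _ _ => Set.mem_univ _

/-! ### Uniqueness for tempered solutions vanishing near the axis -/


theorem gaussian_mul_pow_le (M : ℕ) (t : ℝ) :
    Real.exp (-t ^ 2 / 4) * (1 + |t|) ^ M ≤ M.factorial * Real.exp 2 := by
  calc Real.exp (-t ^ 2 / 4) * (1 + |t|) ^ M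
      ≤ Real.exp (-t ^ 2 / 4) * (M.factorial * Real.exp (1 + |t|)) := by
        gcongr
        exact one_add_abs_pow_le M t
    _ = M.factorial * Real.exp (-t ^ 2 / 4 + (1 + |t|)) := by rw [Real.exp_add (-t ^ 2 / 4)]; ring
    _ ≤ M.factorial * Real.exp 2 := by
        gcongr
        nlinarith [sq_nonneg (|t| / 2 - 1), sq_abs t]

theorem decaysOn_gaussianWaveDeriv (M : ℕ) (τ : ℝ) (n : ℕ) :
    DecaysOn M Set.univ (gaussianWaveDeriv τ n) := by
  refine ⟨(contDiff_gaussianWaveDeriv τ n).continuous,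
    gaussianBound τ n * (M.factorial * Real.exp 2), fun t _ => ?_⟩
  calc ‖gaussianWaveDeriv τ n t‖ * (1 + |t|) ^ M
      ≤ gaussianBound τ n * Real.exp (-t ^ 2 / 4) * (1 + |t|) ^ M := by
        gcongr
        exact norm_gaussianWaveDeriv_le τ n t
    _ = gaussianBound τ n * (Real.exp (-t ^ 2 / 4) * (1 + |t|) ^ M) := by ring
    _ ≤ _ := mul_le_mul_of_nonneg_left (gaussian_mul_pow_le M t) (gaussianBound_nonneg τ n)

theorem decaysOn_gaussian (M : ℕ) :
    DecaysOn M Set.univ fun t => ((Real.exp (-t ^ 2 / 4) : ℝ) : ℂ) := by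
  refine ⟨Complex.continuous_ofReal.comp (by fun_prop), M.factorial * Real.exp 2, fun t _ => ?_⟩
  rw [Complex.norm_real, Real.norm_of_nonneg (Real.exp_pos _).le]
  exact gaussian_mul_pow_le M t

theorem gaussianWaveDeriv_zero (τ t : ℝ) : gaussianWaveDeriv τ 0 t =
    ((Real.exp (-t ^ 2 / 2) : ℝ) : ℂ) * Complex.exp (-(2 * Real.pi * τ * Complex.I) * t) := by
  rw [gaussianWaveDeriv, iteratedDeriv_zero, gaussianWave, Complex.ofReal_exp, ← Complex.exp_add]
  congr 1
  push_cast
  ring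

/-- The pairings of `c(t, s)` with the derivatives of modulated Gaussians satisfy a hierarchy of
equations in `s`, in which initial data propagate. -/
theorem slice_gaussianWave_ae_eq_zero {ℓ m : ℝ} {k : ℤ} {q : ℝ × ℝ}
    (hsol : IsReducedSol ℓ m k Set.univ 0 q c) (hc : IsTemperedOn M Set.univ c) {s₀ : ℝ}
    (h0 : ∀ᵐ p : ℝ × ℝ, p.2 < s₀ → c p = 0) (τ : ℝ) {S : ℝ} (hS : s₀ < S) :
    ∀ᵐ s, s < S → slice c (gaussianWaveDeriv τ 0) s = 0 := by
  set v : ℕ → ℝ → ℂ := fun n => slice c (gaussianWaveDeriv τ n) with hv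
  set w : ℕ → ℝ → ℂ := fun n s => ((Real.exp (2 * s) - ℓ ^ 2 : ℝ) : ℂ) * v (n + 2) s
    + 2 * Complex.I * ℓ * k * v (n + 1) s
    + ((k ^ 2 + m ^ 2 * Real.exp (2 * s) : ℝ) : ℂ) * v n s with hw
  have hd := decaysOn_gaussianWaveDeriv M τ
  have hvl : ∀ n, LocallyIntegrable (v n) := fun n => hc.locallyIntegrable_slice (hd n)
  have hmul : ∀ (f : ℝ → ℂ) (n : ℕ), Continuous f → LocallyIntegrable fun s => f s * v n s :=
    fun f n hf => locallyIntegrableOn_univ.1 (((hvl n).locallyIntegrableOn Set.univ).continuousOn_mul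
      hf.continuousOn isOpen_univ.isLocallyClosed)
  have cA : Continuous fun s : ℝ => ((Real.exp (2 * s) - ℓ ^ 2 : ℝ) : ℂ) :=
    Complex.continuous_ofReal.comp (by fun_prop)
  have cC : Continuous fun s : ℝ => ((k ^ 2 + m ^ 2 * Real.exp (2 * s) : ℝ) : ℂ) :=
    Complex.continuous_ofReal.comp (by fun_prop)
  have hwl : ∀ n, LocallyIntegrable (w n) := fun n =>
    ((hmul _ (n + 2) cA).add (hmul _ (n + 1) continuous_const)).add (hmul _ n cC)
  have hv0 : ∀ n, ∀ᵐ s, s < s₀ → v n s = 0 := fun n => by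
    filter_upwards [ae_ae_of_ae_plane h0] with s hs hs0
    refine integral_eq_zero_of_ae ?_
    filter_upwards [hs] with t ht
    simp [ht hs0]
  have hw0 : ∀ n, ∀ᵐ s, s < s₀ → w n s = 0 := fun n => by
    filter_upwards [hv0 n, hv0 (n + 1), hv0 (n + 2)] with s h1 h2 h3 hs
    simp only [hw]
    rw [h1 hs, h2 hs, h3 hs]
    simp
  have hvw : ∀ n, ∀ᵐ s, s < S → v n s = secondPrimitive s₀ (w n) s := fun n => by
    have h1 := ae_eq_of_weak_deriv_deriv_of_eq_zero (S := S) (p := s₀) (s₀ := s₀) (κ := 0)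
      (hvl n) (hwl n) (fun ρ hρ => by
        have h2 := (hsol.mono (A := Set.Iio S)).weak_ode hc (contDiff_gaussianWaveDeriv τ n)
          (hasDerivAt_gaussianWaveDeriv τ n) (hasDerivAt_gaussianWaveDeriv τ (n + 1))
          (hd n) (hd (n + 1)) (hd (n + 2)) hρ
        rw [zero_mul, smul_zero] at h2
        rw [smul_zero]
        exact h2) (hv0 n) (hw0 n) le_rfl hS
    filter_upwards [h1] with s hs hsS
    rw [hs hsS, smul_zero, neg_zero, zero_add]
  -- All `v_n` are bounded by constants times one integrable function.
  set B : ℝ → ℝ := fun s => ∫ t, ‖c (t, s) * ((Real.exp (-t ^ 2 / 4) : ℝ) : ℂ)‖ with hB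
  have hBl : LocallyIntegrable B :=
    locallyIntegrable_of_radialWeight (hc.integrable_integral_norm (decaysOn_gaussian M))
  have hvB : ∀ n, ∀ᵐ s, ‖v n s‖ ≤ gaussianBound τ n * B s := fun n => by
    filter_upwards [hc.ae_integrable (decaysOn_gaussian M)] with s hs
    rw [hB, ← integral_const_mul]
    refine norm_integral_le_of_norm_le (hs.norm.const_mul _) (ae_of_all _ fun t => ?_)
    rw [norm_mul, norm_mul, Complex.norm_real, Real.norm_of_nonneg (Real.exp_pos _).le]
    calc ‖c (t, s)‖ * ‖gaussianWaveDeriv τ n t‖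
        ≤ ‖c (t, s)‖ * (gaussianBound τ n * Real.exp (-t ^ 2 / 4)) := by
          gcongr
          exact norm_gaussianWaveDeriv_le τ n t
      _ = _ := by ring
  set K : ℝ := (Real.exp (2 * S) + ℓ ^ 2) + 2 * |ℓ| * |(k : ℝ)|
    + (k ^ 2 + m ^ 2 * Real.exp (2 * S)) with hK
  have hK0 : 0 ≤ K := by positivity
  have hwK : ∀ n, ∀ᵐ s, s ∈ Set.Ioc s₀ S →
      ‖w n s‖ ≤ K * (‖v n s‖ + ‖v (n + 1) s‖ + ‖v (n + 2) s‖) := fun n =>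
    ae_of_all _ fun s hs => by
      have he : Real.exp (2 * s) ≤ Real.exp (2 * S) := Real.exp_le_exp.2 (by linarith [hs.2])
      have hp := Real.exp_pos (2 * s)
      have hpS := Real.exp_pos (2 * S)
      have a1 : ‖((Real.exp (2 * s) - ℓ ^ 2 : ℝ) : ℂ)‖ ≤ K := by
        rw [Complex.norm_real, Real.norm_eq_abs, abs_le]
        have : 0 ≤ 2 * |ℓ| * |(k : ℝ)| + (k ^ 2 + m ^ 2 * Real.exp (2 * S)) := by positivity
        constructor <;> nlinarith [sq_nonneg ℓ]
      have a2 : ‖2 * Complex.I * ℓ * k‖ ≤ K := by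
        have : ‖2 * Complex.I * (ℓ : ℂ) * k‖ = 2 * |ℓ| * |(k : ℝ)| := by
          simp [Complex.norm_real, Complex.norm_intCast]
        rw [this, hK]
        have : 0 ≤ (Real.exp (2 * S) + ℓ ^ 2) + (k ^ 2 + m ^ 2 * Real.exp (2 * S)) := by positivity
        linarith
      have a3 : ‖((k ^ 2 + m ^ 2 * Real.exp (2 * s) : ℝ) : ℂ)‖ ≤ K := by
        rw [Complex.norm_real, Real.norm_of_nonneg (by positivity)]
        have : 0 ≤ (Real.exp (2 * S) + ℓ ^ 2) + 2 * |ℓ| * |(k : ℝ)| := by positivity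
        nlinarith [mul_le_mul_of_nonneg_left he (sq_nonneg m)]
      refine (norm_add₃_le).trans ?_
      rw [norm_mul, norm_mul _ (v (n + 1) s), norm_mul _ (v n s)]
      have b1 := mul_le_mul_of_nonneg_right a1 (norm_nonneg (v (n + 2) s))
      have b2 := mul_le_mul_of_nonneg_right a2 (norm_nonneg (v (n + 1) s))
      have b3 := mul_le_mul_of_nonneg_right a3 (norm_nonneg (v n s))
      linarith
  have hne : ∀ᵐ s : ℝ, s ≠ S := Measure.ae_ne volume S
  have hzero : ∀ s ∈ Set.Icc s₀ S, secondPrimitive s₀ (w 0) s = 0 := fun s hs => by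
    refine secondPrimitive_eq_zero_of_hierarchy hK0 (v := v) (b := gaussianBound τ) (M := B)
      (fun n => ?_) hwK (monotone_gaussianBound τ) ?_
      (fun s => integral_nonneg fun t => norm_nonneg _) (fun n => ?_)
      (tendsto_gaussianBound τ) hs
    · filter_upwards [hvw n, hne] with s h1 h2 h3
      exact h1 (lt_of_le_of_ne h3.2 h2)
    · exact (hBl.integrableOn_isCompact isCompact_Icc).mono_set Set.Ioc_subset_Icc_self
    · filter_upwards [hvB n] with s h1 _
      exact h1
  filter_upwards [hv0 0, hvw 0] with s h1 h2 hs
  rcases lt_or_ge s s₀ with h | h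
  · exact h1 h
  · rw [← hzero s ⟨h, hs.le⟩]
    exact h2 hs

/-- A tempered solution on the whole plane that vanishes for `s < s₀` is zero. -/
theorem ae_eq_zero_of_isReducedSol_of_vanishing {ℓ m : ℝ} {k : ℤ} {q : ℝ × ℝ}
    (hsol : IsReducedSol ℓ m k Set.univ 0 q c) (hc : IsTemperedOn M Set.univ c) {s₀ : ℝ}
    (h0 : ∀ᵐ p : ℝ × ℝ, p.2 < s₀ → c p = 0) : ∀ᵐ p, c p = 0 := by
  have hg : DecaysOn M Set.univ fun t => ((Real.exp (-t ^ 2 / 2) : ℝ) : ℂ) := by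
    refine ⟨Complex.continuous_ofReal.comp (by fun_prop), M.factorial * Real.exp 2, fun t _ => ?_⟩
    rw [Complex.norm_real, Real.norm_of_nonneg (Real.exp_pos _).le]
    refine le_trans ?_ (gaussian_mul_pow_le M t)
    exact mul_le_mul_of_nonneg_right (Real.exp_le_exp.2 (by nlinarith [sq_nonneg t]))
      (by positivity)
  have h := ae_eq_zero_of_slice_eq_zero hc.aestronglyMeasurable
    (g := fun t => ((Real.exp (-t ^ 2 / 2) : ℝ) : ℂ)) (A := Set.univ)
    (fun t => by exact_mod_cast (Real.exp_pos _).ne') MeasurableSet.univ (hc.ae_integrable hg)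
    fun τ => by
      have h1 : ∀ᵐ s, ∀ n : ℕ, s < s₀ + 1 + n → slice c (gaussianWaveDeriv τ 0) s = 0 :=
        ae_all_iff.2 fun n => slice_gaussianWave_ae_eq_zero hsol hc h0 τ (by
          have : (0 : ℝ) ≤ n := n.cast_nonneg
          linarith)
      filter_upwards [h1] with s hs _
      obtain ⟨n, hn⟩ := exists_nat_gt (s - s₀ - 1)
      have := hs n (by linarith)
      rw [show gaussianWaveDeriv τ 0 = _ from funext fun t => gaussianWaveDeriv_zero τ t] at this
      exact this
  filter_upwards [h] with p hp
  exact hp (Set.mem_univ _)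

/-! ### Growth of retarded solutions -/


theorem decaysOn_exp_neg (M : ℕ) (a : ℝ) :
    DecaysOn M (Set.Ici a) fun t : ℝ => Complex.exp ((-1 : ℂ) * t) := by
  refine ⟨by fun_prop, M.factorial * Real.exp (1 + 2 * |a|), fun t ht => ?_⟩
  have hn : ‖Complex.exp ((-1 : ℂ) * t)‖ = Real.exp (-t) := by
    rw [Complex.norm_exp]
    simp
  rw [hn]
  calc Real.exp (-t) * (1 + |t|) ^ M ≤ Real.exp (-t) * (M.factorial * Real.exp (1 + |t|)) := by
        gcongr
        exact one_add_abs_pow_le M t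
    _ = M.factorial * Real.exp (-t + (1 + |t|)) := by rw [Real.exp_add (-t)]; ring
    _ ≤ _ := by
        refine mul_le_mul_of_nonneg_left (Real.exp_le_exp.2 ?_) (by positivity)
        have h1 : a ≤ t := ht
        have h2 := neg_abs_le a
        have h3 := abs_nonneg a
        rcases abs_cases t with ⟨h, -⟩ | ⟨h, -⟩ <;> rw [h] <;> linarith

theorem not_integrable_of_eventually_ge {f : ℝ → ℝ} {δ : ℝ} (hδ : 0 < δ)
    (h : ∃ a, ∀ᵐ s, a < s → δ ≤ ‖f s‖) : ¬ Integrable f := by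
  intro hf
  obtain ⟨a, ha⟩ := h
  have h1 := hf.measure_norm_ge_lt_top hδ
  have h2 : volume (Set.Ioi a) ≤ volume {s | δ ≤ ‖f s‖} := measure_mono_ae ha
  rw [Real.volume_Ioi] at h2
  exact absurd (lt_of_le_of_lt h2 h1) (lt_irrefl _)

theorem le_radialWeight (M : ℕ) {s : ℝ} (hs : 0 ≤ s) :
    Real.exp (-(M * s)) / 2 ^ M ≤ radialWeight M s := by
  have h1 : (1 + Real.exp s) ^ M ≤ 2 ^ M * Real.exp (M * s) := by
    rw [Real.exp_nat_mul, ← mul_pow]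
    have := Real.one_le_exp hs
    gcongr
    linarith
  rw [radialWeight, div_le_div_iff₀ (by positivity) (by positivity)]
  calc Real.exp (-(M * s)) * (1 + Real.exp s) ^ M
      ≤ Real.exp (-(M * s)) * (2 ^ M * Real.exp (M * s)) := by gcongr
    _ = 1 * 2 ^ M := by
        rw [mul_left_comm, ← Real.exp_add]
        simp
    _ ≤ Real.exp (2 * s) * 2 ^ M := by
        gcongr
        exact Real.one_le_exp (by linarith)

/-- A tempered solution of `L c = κ δ_q` supported in `t ≥ a` and vanishing for `s < s₀`, where
the reduced operator is hyperbolic for `s > s₀`, exists only for `κ = 0`: its Laplace transform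
in `t` grows faster than any power of `e^s`. -/
theorem eq_zero_of_isReducedSol_of_retarded {ℓ m : ℝ} {k : ℤ} {q : ℝ × ℝ} {κ : ℂ} {a s₀ : ℝ}
    (hsol : IsReducedSol ℓ m k Set.univ κ q c) (hc : IsTemperedOn M (Set.Ici a) c)
    (hs₀ : ℓ ^ 2 ≤ Real.exp (2 * s₀)) (hq : s₀ ≤ q.2)
    (h0 : ∀ᵐ p : ℝ × ℝ, p.2 < s₀ → c p = 0) : κ = 0 := by
  set v : ℝ → ℂ := slice c fun t : ℝ => Complex.exp ((-1 : ℂ) * t) with hv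
  set Q : ℝ → ℂ := modalCoeff ℓ m k (-1) with hQ
  set κ' : ℂ := κ * Complex.exp ((-1 : ℂ) * q.1) with hκ'
  have hQc : Continuous Q := continuous_modalCoeff ℓ m k _
  have hd := decaysOn_exp_neg M a
  have hvl : LocallyIntegrable v := hc.locallyIntegrable_slice hd
  have hv0 : ∀ᵐ s, s < s₀ → v s = 0 := by
    filter_upwards [ae_ae_of_ae_plane h0] with s hs hs0
    refine integral_eq_zero_of_ae ?_
    filter_upwards [hs] with t ht
    simp [ht hs0]
  have hQvl : LocallyIntegrable fun s => Q s * v s :=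
    locallyIntegrableOn_univ.1 ((hvl.locallyIntegrableOn Set.univ).continuousOn_mul
      hQc.continuousOn isOpen_univ.isLocallyClosed)
  have hweak : ∀ h : ℝ → ℝ, IsLineTest Set.univ h → ∫ s, deriv (deriv h) s • v s =
      (∫ s, h s • (Q s * v s)) - h q.2 • κ' := fun h hh => hsol.weak_ode_exp hc _ hd hh
  -- Left of the source the solution vanishes.
  have hleft : ∀ᵐ s, s < q.2 → v s = 0 :=
    ae_eq_zero_of_weak_ode_of_ae_eq_zero_left hvl hQc (fun ρ hρ => by
      have h1 : ρ q.2 = 0 := image_eq_zero_of_notMem_tsupport fun h => lt_irrefl q.2 (hρ.supp h)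
      have := hweak ρ { hρ with supp := Set.subset_univ _ }
      rwa [h1, zero_smul, sub_zero] at this) hv0
  have hQv0 : ∀ᵐ s, s < q.2 → Q s * v s = 0 := by
    filter_upwards [hleft] with s hs h
    rw [hs h, mul_zero]
  -- To the right of the source it agrees with the classical solution `F` with data `0`, `-κ'`.
  set F : ℝ → ℂ := fun s => -((s - q.2) • κ') + secondPrimitive q.2 (fun s => Q s * v s) s with hF
  have hFc : Continuous F := by
    have := continuous_secondPrimitive hQvl q.2
    exact ((continuous_id.sub continuous_const).smul continuous_const).neg.add this
  have hvF : ∀ᵐ s, q.2 < s → v s = F s := by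
    have h1 : ∀ᵐ s, ∀ n : ℕ, s < q.2 + 1 + n → v s =
        -(max (s - q.2) 0 • κ') + secondPrimitive q.2 (fun s => Q s * v s) s := by
      refine ae_all_iff.2 fun n => ?_
      refine ae_eq_of_weak_deriv_deriv_of_eq_zero hvl hQvl (fun ρ hρ => ?_) hleft hQv0 le_rfl ?_
      · exact hweak ρ { hρ with supp := Set.subset_univ _ }
      · have : (0 : ℝ) ≤ n := n.cast_nonneg
        linarith
    filter_upwards [h1] with s hs hqs
    obtain ⟨n, hn⟩ := exists_nat_gt (s - q.2 - 1)
    rw [hs n (by linarith), max_eq_left (by linarith)]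
  have hQFc : Continuous fun s => Q s * F s := hQc.mul hFc
  set F₁ : ℝ → ℂ := fun s => -κ' + ∫ x in q.2..s, Q x * F x with hF₁
  have hFd : ∀ s ≥ q.2, HasDerivAt F (F₁ s) s := fun s hs => by
    have h1 := hasDerivAt_secondPrimitive hQvl q.2 s
    have h2 : ∫ x in q.2..s, Q x * v x = ∫ x in q.2..s, Q x * F x := by
      refine intervalIntegral.integral_congr_ae ?_
      filter_upwards [hvF] with x hx hxs
      rw [Set.uIoc_of_le hs] at hxs
      rw [hx hxs.1]
    rw [h2] at h1
    have h3 : HasDerivAt (fun s : ℝ => -((s - q.2) • κ')) (-κ') s := by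
      have := (((hasDerivAt_id s).sub_const q.2).smul_const κ').neg
      simpa using! this
    exact h3.add h1
  have hF₁d : ∀ s ≥ q.2, HasDerivAt F₁ (Q s * F s) s := fun s _ =>
    ((hQFc.integral_hasStrictDerivAt q.2 s).hasDerivAt).const_add _
  have hre : ∀ s, (Q s).re = (1 + m ^ 2) * Real.exp (2 * s) - ℓ ^ 2 + k ^ 2 := fun s => by
    have : Q s = (((1 + m ^ 2) * Real.exp (2 * s) - ℓ ^ 2 + k ^ 2 : ℝ) : ℂ)
        + ((-(2 * ℓ * k) : ℝ) : ℂ) * Complex.I := by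
      simp only [hQ, modalCoeff]
      push_cast
      ring
    rw [this, Complex.add_re, Complex.ofReal_re, Complex.re_ofReal_mul, Complex.I_re, mul_zero,
      add_zero]
  by_contra hκ
  have hκ0 : κ' ≠ 0 := mul_ne_zero hκ (Complex.exp_ne_zero _)
  -- The rate `L = 2 M + 1` beats the decay `e^{-M s}` of the weight.
  obtain ⟨δ, hδ, hgrow⟩ := eventually_exp_le_norm_sq_of_ode (L := 2 * M + 1) hFd hF₁d
    (fun s hs => by
      rw [hre]
      have : Real.exp (2 * s₀) ≤ Real.exp (2 * s) := Real.exp_le_exp.2 (by linarith)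
      nlinarith [sq_nonneg (k : ℝ), mul_nonneg (sq_nonneg m) (Real.exp_pos (2 * s)).le])
    (by
      simp only [hre]
      refine Filter.tendsto_atTop_add_const_right _ _ (Filter.tendsto_atTop_add_const_right _ _ ?_)
      refine Filter.Tendsto.const_mul_atTop (by positivity) ?_
      exact Real.tendsto_exp_atTop.comp (Filter.tendsto_id.const_mul_atTop (by norm_num)))
    (by simp [hF, secondPrimitive]) (by simpa [hF₁] using hκ0) (by positivity)
  obtain ⟨a', ha'⟩ := Filter.eventually_atTop.1 hgrow
  refine not_integrable_of_eventually_ge (δ := Real.sqrt δ / 2 ^ M) (by positivity)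
    ⟨max a' (max q.2 0), ?_⟩ (hc.integrable_slice hd).norm
  filter_upwards [hvF] with s hs hmax
  obtain ⟨h1, h2, h3⟩ : a' < s ∧ q.2 < s ∧ 0 < s := by simpa using hmax
  have hsq : Real.sqrt δ * Real.exp (M * s) ≤ ‖F s‖ := by
    refine abs_le_of_sq_le_sq' ?_ (norm_nonneg _) |>.2
    rw [mul_pow, Real.sq_sqrt hδ.le, ← Real.exp_nat_mul]
    refine le_trans ?_ (ha' s h1.le)
    refine mul_le_mul_of_nonneg_left (Real.exp_le_exp.2 ?_) hδ.le
    push_cast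
    nlinarith
  change _ ≤ ‖‖radialWeight M s • v s‖‖
  rw [norm_norm, norm_smul, Real.norm_of_nonneg (radialWeight_pos M s).le, hs h2]
  calc Real.sqrt δ / 2 ^ M
      = Real.exp (-(M * s)) / 2 ^ M * (Real.sqrt δ * Real.exp (M * s)) := by
        rw [Real.exp_neg]
        field_simp
    _ ≤ radialWeight M s * ‖F s‖ :=
        mul_le_mul (le_radialWeight M h3.le) hsq (by positivity) (radialWeight_pos M s).le

/-! ### Decay in the elliptic region -/


theorem integrableOn_exp_mul_of_radialWeight {f : ℝ → ℝ}
    (hf : Integrable fun s => radialWeight M s • f s) (S : ℝ) :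
    IntegrableOn (fun s => Real.exp (2 * s) * f s) (Set.Iio S) := by
  have h1 := hf.restrict (s := Set.Iio S) |>.bdd_mul (c := (1 + Real.exp S) ^ M)
    (f := fun s : ℝ => (1 + Real.exp s) ^ M)
    (by fun_prop : Continuous fun s : ℝ => (1 + Real.exp s) ^ M).aestronglyMeasurable
    (ae_restrict_of_forall_mem measurableSet_Iio fun s hs => by
      rw [Real.norm_of_nonneg (by positivity)]
      have : Real.exp s ≤ Real.exp S := Real.exp_le_exp.2 (le_of_lt hs)
      gcongr)
  refine Integrable.congr h1 (ae_of_all _ fun s => ?_)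
  simp only [smul_eq_mul, radialWeight]
  field_simp

theorem decaysOn_Icc {T : ℝ} {g : ℝ → ℂ} (hg : Continuous g) (M : ℕ) :
    DecaysOn M (Set.Icc (-T) T) g := by
  have hc : Continuous fun t => ‖g t‖ * (1 + |t|) ^ M := by fun_prop
  obtain ⟨C, hC⟩ := (isCompact_Icc (a := -T) (b := T)).bddAbove_image hc.continuousOn
  exact ⟨hg, C, fun t ht => hC ⟨t, ht, rfl⟩⟩

/-- Ellipticity: for large `τ` the coefficient `Q` of the modal equation is bounded below by a
multiple of `τ²` on `r < |ℓ| / 2`. -/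
theorem sq_le_re_modalCoeff {ℓ m : ℝ} {k : ℤ} {s τ : ℝ}
    (hs : Real.exp (2 * s) ≤ ℓ ^ 2 / 4) (hτ : 4 * |(k : ℝ)| ≤ |ℓ * (2 * Real.pi * τ)|) :
    (|ℓ * (2 * Real.pi * τ)| / 4) ^ 2 ≤
      (modalCoeff ℓ m k (-(2 * Real.pi * τ * Complex.I)) s).re := by
  set σ : ℝ := 2 * Real.pi * τ with hσ
  have h1 : modalCoeff ℓ m k (-(2 * Real.pi * τ * Complex.I)) s =
      (((k + ℓ * σ) ^ 2 - Real.exp (2 * s) * (σ ^ 2 - m ^ 2) : ℝ) : ℂ) := by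
    rw [modalCoeff, show (2 * Real.pi * τ * Complex.I : ℂ) = (σ : ℂ) * Complex.I by
      rw [hσ]; push_cast; ring]
    push_cast
    linear_combination (Complex.exp (2 * s) * σ ^ 2 - (ℓ : ℂ) ^ 2 * σ ^ 2
      - 2 * ℓ * k * σ) * Complex.I_sq
  rw [h1, Complex.ofReal_re]
  set x : ℝ := ℓ * σ with hx
  have h2 : (3 / 4 * |x|) ^ 2 ≤ (k + x) ^ 2 := by
    rw [← sq_abs ((k : ℝ) + x)]
    refine pow_le_pow_left₀ (by positivity) ?_ 2
    have := abs_sub_abs_le_abs_sub x (-k)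
    rw [abs_neg, sub_neg_eq_add, add_comm x] at this
    linarith
  have h3 : Real.exp (2 * s) * σ ^ 2 ≤ x ^ 2 / 4 := by
    calc Real.exp (2 * s) * σ ^ 2 ≤ ℓ ^ 2 / 4 * σ ^ 2 := by gcongr
      _ = x ^ 2 / 4 := by rw [hx]; ring
  have h4 : 0 ≤ Real.exp (2 * s) * m ^ 2 := by positivity
  have h5 : |x| ^ 2 = x ^ 2 := sq_abs x
  nlinarith [sq_nonneg x]

/-- A weak solution compactly supported in `t` vanishes in a neighbourhood of the axis, and hence
as far out as it satisfies the equation: ellipticity for `r < |ℓ|` makes its Fourier transform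
in `t` decay exponentially, so that it is analytic in `t`. -/
theorem ae_eq_zero_of_isReducedSol_of_compact {ℓ m S T : ℝ} {k : ℤ} {q : ℝ × ℝ} (hℓ : ℓ ≠ 0)
    (hS : Real.log |ℓ| < S) (hsol : IsReducedSol ℓ m k (Set.Iio S) 0 q c)
    (hc : IsTemperedOn M (Set.Icc (-T) T) c) : ∀ᵐ p : ℝ × ℝ, p.2 < S → c p = 0 := by
  have hℓp : 0 < |ℓ| := abs_pos.2 hℓ
  set S₁ : ℝ := Real.log (|ℓ| / 2) with hS₁
  have hS₁S : S₁ < S := by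
    refine lt_trans (Real.log_lt_log (by positivity) (by linarith)) hS
  have hellip : ∀ s < S₁, Real.exp (2 * s) ≤ ℓ ^ 2 / 4 := fun s hs => by
    have h1 : Real.exp s ≤ |ℓ| / 2 := by
      rw [← Real.exp_log (show 0 < |ℓ| / 2 by positivity)]
      exact Real.exp_le_exp.2 hs.le
    rw [two_mul, Real.exp_add]
    calc Real.exp s * Real.exp s ≤ |ℓ| / 2 * (|ℓ| / 2) :=
          mul_le_mul h1 h1 (Real.exp_pos _).le (by positivity)
      _ = ℓ ^ 2 / 4 := by rw [← sq_abs]; ring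
  set μ : ℝ → ℂ := fun τ => -(2 * Real.pi * τ * Complex.I) with hμ
  set v : ℝ → ℝ → ℂ := fun τ => slice c fun t : ℝ => Complex.exp (μ τ * t) with hv
  have hgc : ∀ τ, Continuous fun t : ℝ => Complex.exp (μ τ * t) := fun τ => by fun_prop
  have hd : ∀ τ, DecaysOn M (Set.Icc (-T) T) fun t : ℝ => Complex.exp (μ τ * t) := fun τ =>
    decaysOn_Icc (hgc τ) M
  have hd1 : DecaysOn M (Set.Icc (-T) T) fun _ => 1 := decaysOn_Icc continuous_const M
  have hvl : ∀ τ, LocallyIntegrable (v τ) := fun τ => hc.locallyIntegrable_slice (hd τ)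
  have hQc : ∀ τ, Continuous (modalCoeff ℓ m k (μ τ)) := fun τ => continuous_modalCoeff _ _ _ _
  have hweak : ∀ τ ρ, IsLineTest (Set.Iio S) ρ → ∫ s, deriv (deriv ρ) s • v τ s =
      ∫ s, ρ s • (modalCoeff ℓ m k (μ τ) s * v τ s) := fun τ ρ hρ => by
    have := hsol.weak_ode_exp hc _ (hd τ) hρ
    rwa [zero_mul, smul_zero, sub_zero] at this
  set n : ℝ → ℝ := fun s => ∫ t, ‖c (t, s) * 1‖ with hn
  have hn0 : ∀ s, 0 ≤ n s := fun s => integral_nonneg fun t => norm_nonneg _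
  have hnorm : ∀ τ t : ℝ, ‖Complex.exp (μ τ * t)‖ = 1 := fun τ t => by
    rw [hμ, Complex.norm_exp]
    simp
  have hvn : ∀ τ s, ‖v τ s‖ ≤ n s := fun τ s => by
    refine (norm_integral_le_integral_norm _).trans_eq ?_
    refine integral_congr_ae (ae_of_all _ fun t => ?_)
    simp only [norm_mul, hnorm, norm_one]
  have hnI := integrableOn_exp_mul_of_radialWeight (hc.integrable_integral_norm hd1) S₁
  set K : ℝ := Real.exp (2 - 2 * S₁) * ∫ s in Set.Iio S₁, Real.exp (2 * s) * n s with hK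
  have hK0 : 0 ≤ K :=
    mul_nonneg (Real.exp_pos _).le (integral_nonneg fun s => mul_nonneg (Real.exp_pos _).le (hn0 s))
  set ε : ℝ := |ℓ| * Real.pi / 4 with hε
  have hε0 : 0 < ε := by positivity
  have hετ : ∀ τ, ε * |τ| = |ℓ * (2 * Real.pi * τ)| / 8 := fun τ => by
    rw [abs_mul, abs_mul, abs_of_pos (show (0 : ℝ) < 2 * Real.pi by positivity), hε]
    ring
  -- Exponential decay of the Fourier transform in `t`.
  have hdecay : ∀ τ, ∀ᵐ s, s < S₁ - 2 →
      ‖v τ s‖ ≤ (K + n s * Real.exp (|(k : ℝ)| / 2 + 2)) * Real.exp (-ε * |τ|) := fun τ => by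
    have hpos : 0 < Real.exp (-ε * |τ|) := Real.exp_pos _
    by_cases hτ : 4 * |(k : ℝ)| + 16 ≤ |ℓ * (2 * Real.pi * τ)|
    · obtain ⟨y, y₁, hy, hy₁, hvy⟩ := exists_hasDerivAt_of_weak_ode (hvl τ) (hQc τ) (hweak τ)
      have hyn : ∀ᵐ s ∂volume.restrict (Set.Iio S₁),
          Real.exp (2 * s) * ‖y s‖ ≤ Real.exp (2 * s) * n s := by
        rw [ae_restrict_iff' measurableSet_Iio]
        filter_upwards [hvy] with s hs hsS
        rw [← hs (lt_trans hsS hS₁S)]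
        exact mul_le_mul_of_nonneg_left (hvn τ s) (Real.exp_pos _).le
      have hyI : IntegrableOn (fun s => Real.exp (2 * s) * ‖y s‖) (Set.Iio S₁) := by
        refine Integrable.mono' hnI ?_ ?_
        · refine ContinuousOn.aestronglyMeasurable (fun s hs => ?_) measurableSet_Iio
          exact (((by fun_prop : Continuous fun s : ℝ => Real.exp (2 * s)).continuousAt).mul
            (hy s (lt_trans hs hS₁S)).continuousAt.norm).continuousWithinAt
        · filter_upwards [hyn] with s hs
          rwa [Real.norm_of_nonneg (by positivity)]
      filter_upwards [hvy] with s hs hsS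
      rw [hs (by linarith)]
      have h1 := norm_le_exp_mul_integral_of_ode (L := |ℓ * (2 * Real.pi * τ)| / 4)
        (by linarith [abs_nonneg (k : ℝ)]) (fun s hs => hy s (lt_trans hs hS₁S))
        (fun s hs => hy₁ s (lt_trans hs hS₁S))
        (fun s hs => sq_le_re_modalCoeff (hellip s hs) (by linarith)) hyI hsS.le
      refine h1.trans ?_
      have h2 : ∫ s in Set.Iio S₁, Real.exp (2 * s) * ‖y s‖ ≤
          ∫ s in Set.Iio S₁, Real.exp (2 * s) * n s := integral_mono_ae hyI hnI hyn
      have h3 : -(|ℓ * (2 * Real.pi * τ)| / 4 / 2) = -ε * |τ| := by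
        rw [neg_mul, hετ]
        ring
      rw [h3, mul_assoc, mul_comm]
      refine mul_le_mul_of_nonneg_right ?_ hpos.le
      have h4 := mul_le_mul_of_nonneg_left h2 (Real.exp_pos (2 - 2 * S₁)).le
      have h5 := mul_nonneg (hn0 s) (Real.exp_pos (|(k : ℝ)| / 2 + 2)).le
      linarith
    -- For bounded `τ` the trivial estimate suffices.
    · refine ae_of_all _ fun s _ => (hvn τ s).trans ?_
      have h1 : 1 ≤ Real.exp (|(k : ℝ)| / 2 + 2) * Real.exp (-ε * |τ|) := by
        rw [← Real.exp_add]
        refine Real.one_le_exp ?_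
        rw [neg_mul, hετ]
        linarith
      rw [add_mul, mul_assoc (n s)]
      have h2 := mul_le_mul_of_nonneg_left h1 (hn0 s)
      have h3 := mul_nonneg hK0 hpos.le
      linarith
  -- Analyticity in `t` near the axis.
  have hi := hc.ae_integrable hd1
  have hnear : ∀ᵐ s, s ∈ Set.Iio (S₁ - 2) → ∀ᵐ t, c (t, s) = 0 := by
    have h1 := ae_forall_fourier_le (c := fun s t => c (t, s) * 1) (A := Set.Iio (S₁ - 2))
      (B := fun s τ => (K + n s * Real.exp (|(k : ℝ)| / 2 + 2)) * Real.exp (-ε * |τ|))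
      (by filter_upwards [hi] with s hs _ using hs) (fun s => by fun_prop) fun τ => by
        filter_upwards [hdecay τ] with s hs hsA
        rw [fourier_mul_eq_slice]
        simp only [one_mul]
        exact hs hsA
    filter_upwards [h1, hi, ae_ae_of_ae_plane hc.support] with s hs his hsupp hsA
    have h2 := ae_eq_zero_of_norm_fourier_le_exp his (T := T) (by
      filter_upwards [hsupp] with t ht hTt
      rw [ht fun h => absurd h.2 (not_le.2 hTt), zero_mul]) hε0 (hs hsA)
    filter_upwards [h2] with t ht
    simpa using ht
  -- Unique continuation in `s` for each frequency.
  refine ae_eq_zero_of_slice_eq_zero hc.aestronglyMeasurable (g := fun _ => 1)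
    (A := Set.Iio S) (fun _ => one_ne_zero) measurableSet_Iio hi fun τ => ?_
  simp only [one_mul]
  refine ae_eq_zero_of_weak_ode_of_ae_eq_zero_left (s₀ := S₁ - 2) (hvl τ) (hQc τ) (hweak τ) ?_
  filter_upwards [hnear] with s hs hsA
  refine integral_eq_zero_of_ae ?_
  filter_upwards [hs hsA] with t ht
  simp [ht]

/-! ### Return to spacetime -/

/-- The axis is a null set. -/
theorem ae_rad_pos : ∀ᵐ z : Spacetime, 0 < rad z := by
  rw [← measurePreserving_cyl.map_eq, ae_map_iff measurePreserving_cyl.measurable.aemeasurable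
    (measurableSet_lt measurable_const continuous_rad.measurable)]
  refine ae_of_all _ fun q => ?_
  rw [rad_cyl]
  exact Real.exp_pos _

/-- The angular coefficient of a tempered function of mode `k` is tempered, and inherits the
bounds on the support in `t`. -/
theorem exists_isTemperedOn_angCoeff {k : ℤ} {u : Spacetime → ℂ} (hu : IsTemperedL2Mode k u)
    {E : Set ℝ} (hE : ∀ z ∈ essSupp u, z.1 ∈ E) : ∃ M, IsTemperedOn M E (angCoeff k u) := by
  obtain ⟨M, hM⟩ := exists_integrable_weight_of_tempered hu
  refine ⟨M, isTemperedOnPlane_angCoeff (aestronglyMeasurable_of_tempered hu) hM k, ?_⟩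
  refine angCoeff_ae_eq_zero_of_ae_eq_zero k (A := {p : ℝ × ℝ | p.1 ∉ E}) ?_
  filter_upwards [ae_eq_zero_off_essSupp u] with z hz hzE
  exact hz fun h => hzE (hE z h)

theorem angCoeff_ae_eq_zero_of_essSupp_subset {k : ℤ} {u : Spacetime → ℂ} {a : ℝ} (ha : 0 < a)
    (hs : ∀ z ∈ essSupp u, a ≤ rad z) : ∀ᵐ p : ℝ × ℝ, p.2 < Real.log a → angCoeff k u p = 0 := by
  refine angCoeff_ae_eq_zero_of_ae_eq_zero k (A := {p : ℝ × ℝ | p.2 < Real.log a}) ?_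
  filter_upwards [ae_eq_zero_off_essSupp u, ae_rad_pos] with z hz hr hlt
  exact hz fun h => absurd (hs z h) (not_le.2 ((Real.log_lt_log_iff hr ha).1 hlt))

theorem locallyIntegrable_of_tempered {k : ℤ} {u : Spacetime → ℂ} (hu : IsTemperedL2Mode k u) :
    LocallyIntegrable u := by
  obtain ⟨M, hM⟩ := exists_integrable_weight_of_tempered hu
  exact locallyIntegrable_of_integrable_weight hM

theorem isTestMode_modeLift_conj (k : ℤ) {b : ℝ × ℝ → ℂ} (hb : ContDiff ℝ ∞ b)
    (hbc : HasCompactSupport b) : IsTestMode k Set.univ (modeLift k fun p => conj (b p)) :=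
  isTestMode_modeLift k (Complex.conjCLE.contDiff.comp hb) (hbc.comp_left (map_zero _))

/-- The damping operator annihilates functions supported in `r < R`. -/
theorem opW_eq_zero {R : ℝ} {ϱ ψ χ χ' : ℝ → ℝ} (hcut : Cutoffs R ϱ ψ χ χ') {φ : Spacetime → ℂ}
    (hφ : ∀ z, φ z ≠ 0 → rad z < R) (z : Spacetime) : opW ϱ ψ χ χ' φ z = 0 := by
  have h : (fun y => (χ' (rad y) : ℂ) * φ y) = fun _ => 0 := funext fun y => by
    by_cases hy : φ y = 0
    · rw [hy, mul_zero]
    · have h1 : χ' (rad y) = 0 := image_eq_zero_of_notMem_tsupport fun hcon =>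
        lt_asymm (hφ y hy) (hcut.supp_χ' hcon)
      rw [h1, Complex.ofReal_zero, zero_mul]
  rw [opW, h, weyl]
  simp

theorem rad_lt_of_modeLift_ne_zero {k : ℤ} {b : ℝ × ℝ → ℂ} {R : ℝ} (hR : 0 < R)
    (hbA : ∀ p ∈ tsupport b, p.2 < Real.log R) {z : Spacetime} (hz : modeLift k b z ≠ 0) :
    rad z < R := by
  have h0 : rad z ≠ 0 := fun h => hz (modeLift_of_rad_eq_zero k b h)
  have hr : 0 < rad z := lt_of_le_of_ne (Real.sqrt_nonneg _) (Ne.symm h0)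
  rw [modeLift, if_neg h0] at hz
  exact (Real.log_lt_log_iff hr hR).1 (hbA _ (subset_tsupport _ (left_ne_zero_of_mul hz)))

theorem essSupp_subset_of_compact {ℓ m R : ℝ} {k : ℤ} (hℓ : ℓ ≠ 0) (hR : |ℓ| < R)
    {ϱ ψ χ χ' : ℝ → ℝ} (hcut : Cutoffs R ϱ ψ χ χ') {u : Spacetime → ℂ} (hu : IsCompactL2Mode k u)
    (hsol : SolvesP ℓ m k ϱ ψ χ χ' u ∨ SolvesPstar ℓ m k ϱ ψ χ χ' u) :
    essSupp u ⊆ {z | R ≤ rad z} := by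
  have hℓp : 0 < |ℓ| := abs_pos.2 hℓ
  have hR0 : 0 < R := hℓp.trans hR
  have hut := hu.isTemperedL2Mode
  have hred : IsReducedSol ℓ m k (Set.Iio (Real.log R)) 0 (0, 0) (angCoeff k u) := by
    refine isReducedSol_of_boxMass (locallyIntegrable_of_tempered hut) fun b hb hbc hbA => ?_
    have hW := opW_eq_zero hcut (φ := modeLift k fun p => conj (b p)) fun z hz =>
      rad_lt_of_modeLift_ne_zero hR0 (fun p hp => hbA p (tsupport_comp_subset (map_zero _) b hp)) hz
    rw [zero_mul]
    rcases hsol with h | h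
    · have h1 := h _ (isTestMode_modeLift_conj k hb hbc)
      simpa only [opPstar, hW, mul_zero, add_zero] using h1
    · have h1 := h _ (isTestMode_modeLift_conj k hb hbc)
      simpa only [opP, hW, mul_zero, sub_zero] using h1
  obtain ⟨T, hT⟩ := hu.compact.isBounded.exists_norm_le
  obtain ⟨M, hc⟩ := exists_isTemperedOn_angCoeff hut (E := Set.Icc (-T) T) fun z hz =>
    abs_le.1 ((norm_fst_le z).trans (hT z hz))
  have hzero := ae_eq_zero_of_isReducedSol_of_compact hℓ (Real.log_lt_log hℓp hR) hred hc
  have hu0 := ae_eq_zero_of_angCoeff_eq_zero hut (A := {p : ℝ × ℝ | p.2 < Real.log R})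
    (measurableSet_lt measurable_snd measurable_const) hzero
  intro z hz
  by_contra hcon
  have hU : IsOpen {z : Spacetime | rad z < R} := isOpen_lt continuous_rad continuous_const
  refine hz _ hU (lt_of_not_ge hcon : rad z < R) ?_
  rw [Filter.EventuallyEq, ae_restrict_iff' hU.measurableSet]
  filter_upwards [hu0, ae_rad_pos] with z h1 h2 h3
  exact h1 (Real.log_lt_log h2 h3)

theorem ae_eq_zero_of_solvesBox {ℓ m : ℝ} {k : ℤ} (hℓ : ℓ ≠ 0) {u : Spacetime → ℂ}
    (hu : IsTemperedL2Mode k u) (hsol : SolvesBox ℓ m k u)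
    (hs : essSupp u ⊆ {z | |ℓ| ≤ rad z}) : u =ᵐ[volume] 0 := by
  have hred : IsReducedSol ℓ m k Set.univ 0 (0, 0) (angCoeff k u) :=
    isReducedSol_of_boxMass (locallyIntegrable_of_tempered hu) fun b hb hbc _ => by
      rw [zero_mul]
      exact hsol _ (isTestMode_modeLift_conj k hb hbc)
  obtain ⟨M, hc⟩ := exists_isTemperedOn_angCoeff hu (E := Set.univ) fun _ _ => Set.mem_univ _
  have hzero := ae_eq_zero_of_isReducedSol_of_vanishing hred hc
    (angCoeff_ae_eq_zero_of_essSupp_subset (abs_pos.2 hℓ) hs)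
  filter_upwards [ae_eq_zero_of_angCoeff_eq_zero hu MeasurableSet.univ
    (hzero.mono fun p hp _ => hp)] with z hz
  exact hz (Set.mem_univ _)

theorem not_isFundamental_of_essSupp_subset {ℓ m : ℝ} {k : ℤ} (hℓ : ℓ ≠ 0) {q : Spacetime}
    (hq : |ℓ| < rad q) {u : Spacetime → ℂ} (hu : IsTemperedL2Mode k u)
    (hs : essSupp u ⊆ {z | q.1 ≤ z.1 ∧ |ℓ| ≤ rad z}) : ¬ IsFundamental ℓ m k q u := by
  intro hsol
  have hℓp : 0 < |ℓ| := abs_pos.2 hℓ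
  have hr : 0 < rad q := hℓp.trans hq
  -- The phase of the mode at `q`.
  set κ : ℂ := (((q.2.1 : ℂ) + q.2.2 * Complex.I) / rad q) ^ (-k) with hκ
  have hred : IsReducedSol ℓ m k Set.univ κ (q.1, Real.log (rad q)) (angCoeff k u) := by
    refine isReducedSol_of_boxMass (locallyIntegrable_of_tempered hu) fun b hb hbc _ => ?_
    rw [hsol _ (isTestMode_modeLift_conj k hb hbc)]
    simp only
    rw [conj_modeLift, modeLift, if_neg hr.ne',
      Complex.conj_conj, mul_comm]
  obtain ⟨M, hc⟩ := exists_isTemperedOn_angCoeff hu (E := Set.Ici q.1) fun z hz => (hs hz).1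
  have h0 := eq_zero_of_isReducedSol_of_retarded hred hc (s₀ := Real.log |ℓ|)
    (by rw [two_mul, Real.exp_add, Real.exp_log hℓp, abs_mul_abs_self, sq])
    (Real.log_le_log hℓp hq.le)
    (angCoeff_ae_eq_zero_of_essSupp_subset hℓp fun z hz => (hs hz).2)
  have h1 := norm_modeLift_unit hr (-k)
  rw [← hκ, h0, norm_zero] at h1
  exact zero_ne_one h1

end CosmicString

end

theorem mainTheorem3 (ℓ m R : ℝ) (k : ℤ) (hℓ : ℓ ≠ 0) (hR : |ℓ| < R)
    (ϱ ψ χ χ' : ℝ → ℝ) (hcut : CosmicString.Cutoffs R ϱ ψ χ χ') :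
    (∀ u : CosmicString.Spacetime → ℂ, CosmicString.IsCompactL2Mode k u →
      (CosmicString.SolvesP ℓ m k ϱ ψ χ χ' u ∨ CosmicString.SolvesPstar ℓ m k ϱ ψ χ χ' u) →
      CosmicString.essSupp u ⊆ {z | R ≤ CosmicString.rad z}) ∧
    (∀ u : CosmicString.Spacetime → ℂ, CosmicString.IsTemperedL2Mode k u →
      CosmicString.SolvesBox ℓ m k u →
      CosmicString.essSupp u ⊆ {z | |ℓ| ≤ CosmicString.rad z} →
      u =ᵐ[volume] 0) ∧
    (∀ q : CosmicString.Spacetime, |ℓ| < CosmicString.rad q →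
      ¬ ∃ u : CosmicString.Spacetime → ℂ, CosmicString.IsTemperedL2Mode k u ∧
        CosmicString.IsFundamental ℓ m k q u ∧
        CosmicString.essSupp u ⊆ {z | q.1 ≤ z.1 ∧ |ℓ| ≤ CosmicString.rad z}) :=
  ⟨fun _ hu hsol => CosmicString.essSupp_subset_of_compact hℓ hR hcut hu hsol,
    fun _ hu hsol hs => CosmicString.ae_eq_zero_of_solvesBox hℓ hu hsol hs,
    fun _ hq ⟨_, hu, hsol, hs⟩ =>
      CosmicString.not_isFundamental_of_essSupp_subset hℓ hq hu hs hsol⟩
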